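/- Let $2\le K\le d$ be integers, let $I=[a,b]$ with $a<b$, and let $\gamma:I\to\mathbb R^d$ be $C^\infty$. For a cutoff $\chi\in C_0^\infty$ supported in the interior of $I$ put $\widehat\mu(\xi)=\int e^{-i\langle\xi,\gamma(t)\rangle}\chi(t)\,dt$ and, for $R>0$ and $0<q<\infty$, $$G_q(R)=\Big(\int_{S^{d-1}}|\widehat\mu(R\omega)|^q\,d\omega\Big)^{1/q},\qquad G_\infty(R)=\sup_{\omega\in S^{d-1}}|\widehat\mu(R\omega)|,$$ where $d\omega$ is surface measure on the unit sphere $S^{d-1}$. For integers $k\ge1$ let $q_k=\frac{k^2+k+2}{2}$, and for $1\le q\le\infty$ (with $1/\infty=0$) let $$\sigma_K(q)=\begin{cases}\displaystyle\min_{2\le k\le d}\Big(\frac1k+\frac{k^2-k-2}{2kq}\Big),&K=d,\\[2mm]\displaystyle\min\Big\{\min_{2\le k\le K}\Big(\frac1k+\frac{k^2-k-2}{2kq}\Big),\ \frac Kq\Big\},&2\le K<d.\end{cases}$$ Suppose that for some $t_0\in I$ the vectors $\gamma'(t_0),\dots,\gamma^{(K)}(t_0)$ are linearly independent (derivatives at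 an endpoint of $I$ are one-sided). Then there are a $\chi\in C_0^\infty$, real-valued and supported in the interior of $I$, and constants $c>0$ and $R_0\ge1$, such that for all $R>R_0$ the following hold. (i) If $2\le K\le d-1$, then $G_q(R)\ge cR^{-\sigma_K(q)}$ for $2<q<q_K$, and $G_q(R)\ge cR^{-\sigma_K(q)}(\log R)^{1/q}$ for $q\in\{q_k: k=2,\dots,K-1\}$. (ii) If $K=d$, then $G_q(R)\ge cR^{-\sigma_d(q)}$ for $2<q\le\infty$, and $G_q(R)\ge cR^{-\sigma_d(q)}(\log R)^{1/q}$ for $q\in\{q_k: k=2,\dots,d-1\}$. (iii) If $2\le K\le d-1$ and, in addition, $\gamma^{(K+1)}\equiv0$ on $I$, then $G_q(R)\ge cR^{-\sigma_K(q)}$ for $2<q\le\infty$, and $G_q(R)\ge cR^{-\sigma_K(q)}(\log R)^{1/q}$ for $q\in\{q_k: k=2,\dots,K\}$. -/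

import Mathlib

open MeasureTheory Set
open scoped ENNReal ContDiff

noncomputable section

namespace CurveDecay

/-- The Fourier transform `ξ ↦ ∫ exp(-i⟨ξ, γ(t)⟩) χ(t) dt` of the measure
`⟨μ, f⟩ = ∫ f(γ(t)) χ(t) dt`. The cutoff `χ` is supported where `γ` is defined, so the integral may be
taken over the whole line. -/
def muHat {d : ℕ} (γ : ℝ → EuclideanSpace ℝ (Fin d)) (χ : ℝ → ℝ)
    (ξ : EuclideanSpace ℝ (Fin d)) : ℂ :=
  ∫ t : ℝ, Complex.exp (-Complex.I * ((inner ℝ ξ (γ t) : ℝ) : ℂ)) * (χ t : ℂ)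

/-- Surface measure on the unit sphere of `ℝ^d`, induced by Lebesgue measure. -/
def sphereMeasure (d : ℕ) : Measure (Metric.sphere (0 : EuclideanSpace ℝ (Fin d)) 1) :=
  (volume : Measure (EuclideanSpace ℝ (Fin d))).toSphere

/-- `G_q(R)`, the `L^q` norm of `θ ↦ μ̂(Rθ)` over the unit sphere; for `q = ∞` the essential
supremum. (The function is continuous and bounded, so the norm is finite.) -/
def G {d : ℕ} (γ : ℝ → EuclideanSpace ℝ (Fin d)) (χ : ℝ → ℝ) (q : ℝ≥0∞) (R : ℝ) : ℝ :=
  (eLpNorm (fun (θ : Metric.sphere (0 : EuclideanSpace ℝ (Fin d)) 1) =>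
    muHat γ χ (R • (θ : EuclideanSpace ℝ (Fin d)))) q (sphereMeasure d)).toReal

/-- `1 / q` as a real number, with `1 / ∞ = 0`. -/
def recip (q : ℝ≥0∞) : ℝ := (q⁻¹).toReal

/-- `1/k + (k² - k - 2)/(2kq)`. -/
def decayExp (k : ℕ) (q : ℝ≥0∞) : ℝ :=
  1 / (k : ℝ) + ((k : ℝ) ^ 2 - k - 2) / (2 * k) * recip q

/-- The exponent `σ_K(q) = σ_K^d(q)`: the minimum of `1/k + (k² - k - 2)/(2kq)` over `2 ≤ k ≤ K`,
and, when `K < d`, also of `K/q`. -/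
def sigma (d K : ℕ) (hK : 2 ≤ K) (q : ℝ≥0∞) : ℝ :=
  if K = d then
    (Finset.Icc 2 K).inf' (Finset.nonempty_Icc.mpr hK) (fun k => decayExp k q)
  else
    min ((Finset.Icc 2 K).inf' (Finset.nonempty_Icc.mpr hK) (fun k => decayExp k q))
      (K * recip q)

/-- The critical exponents `q_k = (k² + k + 2)/2`. -/
def qcrit (k : ℕ) : ℝ≥0∞ := ENNReal.ofReal (((k : ℝ) ^ 2 + k + 2) / 2)

end CurveDecay

end

/-!
The averages `G_q(R)` are bounded below by exhibiting many directions in which `μ̂(R·)` is large.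
Polar coordinates turn the integral over the sphere into one over the unit ball
(`le_G_of_le_lintegral`), where boxes have an explicit volume.

Fix a base point `t₁` and an orthonormal frame `f` obtained by Gram–Schmidt from
`γ'(t₁), …, γ^{(K)}(t₁)`. Then `⟨f_j, γ(t) - γ(t₁)⟩ = O(|t - t₁|^{j+1})`, and for `j = 0` this quantity is
comparable to `t - t₁`. For `2 ≤ k ≤ K` and a scale `N` with `N^k = δR`, consider the box of those `x`
whose coordinate along `f_j` is `O(N^{j+1}/R)` for `j + 1 < k` and, when `δ` is small, comparable to `δ`
for `j + 1 = k`, while a further coordinate along `f_m` is of size one. There the phase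
`R⟨x, γ(t) - γ(t₁)⟩` is essentially constant for `|t - t₁| ≲ 1/N`, so that piece of the curve
contributes about `1/N` to `μ̂`. The rest of the curve may interfere, but on average it cannot cancel
this contribution: averaging over small rotations in the plane `(f_0, f_m)` by angles
`(N/R)(τ + τ')`, with weights in `τ` and `τ'`, multiplies the integrand at `t` by a factor that is
`O((N(t - t₁))⁻²)`, and is nonnegative up to a small error near `t₁` because it is close to the square of a
Fourier integral of the weight (`exists_le_integral_mul_kernel`, `exists_box_average_bound`). Since
rotations preserve volume, Jensen's inequality gives a lower bound for the integral of `|μ̂|^q` over a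
slab containing the rotated boxes (`exists_slab_lintegral_bound`).

The slabs of about `N` equally spaced base points are disjoint: a point `x` of a slab satisfies
`⟨x, γ^{(k-1)}(t₁)⟩ ≈ 0` while `⟨x, γ^{(k)}⟩` is bounded below by a multiple of `δ`, so `x` determines
`t₁` up to `O(1/N)`. Slabs belonging to sparse scales `δ = a^{l+1}` are disjoint as well, by convexity of
`t ↦ ⟨x, γ^{(k-1)}(t)⟩`, for which `γ^{(k+1)}` has to be nondegenerate or zero
(`abs_sub_le_of_mem_slab_same`, `sq_le_of_mem_slab_of_mem_slab`). Summing over the slabs with `δ = 1` gives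
`G_q(R) ≳ R^{-(1/k + (k² - k - 2)/(2kq))}`, and at `q = q_k` each of about `log R` scales contributes equally,
which yields the logarithm (`exists_lintegral_lower_bound`, `top_scale_bound`, `critical_bound`).

If `γ^{(K+1)} ≡ 0`, the curve lies in an affine `K`-plane, and `|μ̂| ≳ 1` in the `O(1/R)`-neighbourhood of
the orthogonal complement, which gives the remaining bound `R^{-K/q}` (`exists_lower_bound_of_flat`).
As `σ_K` is a minimum of these exponents, it is enough to prove the bounds separately.
-/

noncomputable section

namespace CurveDecay

/-! ### From the sphere to the unit ball -/

open Metric in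
/-- Surface measure is `d` times the image of Lebesgue measure on the unit ball under `x ↦ x/|x|`. -/
theorem lintegral_sphereMeasure {d : ℕ} (h : EuclideanSpace ℝ (Fin d) → ℝ≥0∞) (hh : Measurable h) :
    ∫⁻ θ : sphere (0 : EuclideanSpace ℝ (Fin d)) 1, h θ ∂(sphereMeasure d) =
      d * ∫⁻ x in ball (0 : EuclideanSpace ℝ (Fin d)) 1 \ {0}, h (‖x‖⁻¹ • x) := by
  set μ : Measure (EuclideanSpace ℝ (Fin d)) :=
    volume.restrict (ball (0 : EuclideanSpace ℝ (Fin d)) 1 \ {0})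
  have hm : Measurable (fun x : EuclideanSpace ℝ (Fin d) => ‖x‖⁻¹ • x) := by fun_prop
  have key : (sphereMeasure d).map ((↑) : sphere (0 : EuclideanSpace ℝ (Fin d)) 1 → _) =
      (d : ℝ≥0∞) • μ.map (fun x => ‖x‖⁻¹ • x) := by
    ext s hs
    rw [Measure.map_apply measurable_subtype_coe hs, sphereMeasure,
      Measure.toSphere_apply' _ (measurable_subtype_coe hs), Measure.smul_apply,
      Measure.map_apply hm hs, Measure.restrict_apply (hm hs), finrank_euclideanSpace_fin,
      smul_eq_mul]
    congr 2
    ext x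
    simp only [Set.mem_smul, mem_image, mem_preimage, mem_inter_iff, mem_sdiff, mem_ball,
      dist_zero_right, mem_singleton_iff, mem_Ioo]
    constructor
    · rintro ⟨r, ⟨hr0, hr1⟩, y, ⟨z, hz, rfl⟩, rfl⟩
      have hz1 : ‖(z : EuclideanSpace ℝ (Fin d))‖ = 1 := norm_eq_of_mem_sphere z
      have hn : ‖r • (z : EuclideanSpace ℝ (Fin d))‖ = r := by
        rw [norm_smul, hz1, mul_one, Real.norm_of_nonneg hr0.le]
      refine ⟨?_, ?_, ?_⟩
      · rw [hn, smul_smul, inv_mul_cancel₀ hr0.ne', one_smul]; exact hz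
      · rw [hn]; exact hr1
      · intro h0
        rw [h0, norm_zero] at hn
        exact hr0.ne hn
    · rintro ⟨hx, hx1, hx0⟩
      have hn : 0 < ‖x‖ := norm_pos_iff.mpr hx0
      refine ⟨‖x‖, ⟨hn, hx1⟩, ‖x‖⁻¹ • x, ⟨⟨‖x‖⁻¹ • x, ?_⟩, hx, rfl⟩, ?_⟩
      · rw [mem_sphere_zero_iff_norm, norm_smul, norm_inv, norm_norm, inv_mul_cancel₀ hn.ne']
      · rw [smul_smul, mul_inv_cancel₀ hn.ne', one_smul]
  rw [← lintegral_map hh measurable_subtype_coe, key, lintegral_smul_measure, smul_eq_mul,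
    lintegral_map hh hm]

theorem norm_muHat_le {d : ℕ} (γ : ℝ → EuclideanSpace ℝ (Fin d)) (χ : ℝ → ℝ)
    (ξ : EuclideanSpace ℝ (Fin d)) : ‖muHat γ χ ξ‖ ≤ ∫ t, ‖χ t‖ := by
  refine (norm_integral_le_integral_norm _).trans_eq ?_
  congr 1
  ext t
  rw [norm_mul, show -Complex.I * ((inner ℝ ξ (γ t) : ℝ) : ℂ) =
    ((-(inner ℝ ξ (γ t)) : ℝ) : ℂ) * Complex.I by push_cast; ring,
    Complex.norm_exp_ofReal_mul_I, one_mul, Complex.norm_real]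

theorem continuous_muHat {d : ℕ} {γ : ℝ → EuclideanSpace ℝ (Fin d)} (hγ : Continuous γ)
    {χ : ℝ → ℝ} (hχ : Continuous χ) (hc : HasCompactSupport χ) : Continuous (muHat γ χ) := by
  unfold muHat
  refine continuous_of_dominated (bound := fun t => ‖χ t‖) ?_ ?_ ?_ ?_
  · intro ξ
    refine Continuous.aestronglyMeasurable ?_
    fun_prop
  · intro ξ
    refine Filter.Eventually.of_forall fun t => ?_
    rw [norm_mul, show -Complex.I * ((inner ℝ ξ (γ t) : ℝ) : ℂ) =
      ((-(inner ℝ ξ (γ t)) : ℝ) : ℂ) * Complex.I by push_cast; ring,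
      Complex.norm_exp_ofReal_mul_I, one_mul, Complex.norm_real]
  · exact (hχ.integrable_of_hasCompactSupport hc).norm
  · refine Filter.Eventually.of_forall fun t => ?_
    fun_prop

/-- The degree zero homogeneous extension of `θ ↦ |μ̂(Rθ)|` from the sphere to `ℝ^d`. -/
def radial {d : ℕ} (γ : ℝ → EuclideanSpace ℝ (Fin d)) (χ : ℝ → ℝ) (R : ℝ)
    (x : EuclideanSpace ℝ (Fin d)) : ℝ :=
  ‖muHat γ χ (R • (‖x‖⁻¹ • x))‖

theorem radial_nonneg {d : ℕ} (γ : ℝ → EuclideanSpace ℝ (Fin d)) (χ : ℝ → ℝ) (R : ℝ)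
    (x : EuclideanSpace ℝ (Fin d)) : 0 ≤ radial γ χ R x := norm_nonneg _

theorem measurable_radial {d : ℕ} {γ : ℝ → EuclideanSpace ℝ (Fin d)} (hγ : Continuous γ)
    {χ : ℝ → ℝ} (hχ : Continuous χ) (hc : HasCompactSupport χ) (R : ℝ) :
    Measurable (radial γ χ R) := by
  have h := (continuous_muHat hγ hχ hc).measurable
  unfold radial
  exact (h.comp (by fun_prop)).norm

theorem memLp_muHat {d : ℕ} {γ : ℝ → EuclideanSpace ℝ (Fin d)} (hγ : Continuous γ)
    {χ : ℝ → ℝ} (hχ : Continuous χ) (hc : HasCompactSupport χ) (R : ℝ) (q : ℝ≥0∞) :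
    MemLp (fun (θ : Metric.sphere (0 : EuclideanSpace ℝ (Fin d)) 1) =>
      muHat γ χ (R • (θ : EuclideanSpace ℝ (Fin d)))) q (sphereMeasure d) := by
  have : IsFiniteMeasure (sphereMeasure d) := by unfold sphereMeasure; infer_instance
  refine MemLp.of_bound (C := ∫ t, ‖χ t‖) ?_ ?_
  · have h := continuous_muHat hγ hχ hc
    exact Continuous.aestronglyMeasurable (by fun_prop)
  · exact Filter.Eventually.of_forall fun θ => norm_muHat_le _ _ _

/-- A lower bound for `∫ |μ̂(R x/|x|)|^q dx` over the unit ball gives one for `G_q(R)`. -/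
theorem le_G_of_le_lintegral {d : ℕ} (hd : 1 ≤ d) {γ : ℝ → EuclideanSpace ℝ (Fin d)}
    (hγ : Continuous γ) {χ : ℝ → ℝ} (hχ : Continuous χ) (hc : HasCompactSupport χ) (R : ℝ)
    {q : ℝ≥0∞} (hq0 : q ≠ 0) (hq : q ≠ ⊤) {N : ℝ} (hN : 0 ≤ N)
    (h : ENNReal.ofReal (N ^ q.toReal) ≤
      ∫⁻ x in Metric.ball (0 : EuclideanSpace ℝ (Fin d)) 1 \ {0},
        ENNReal.ofReal (radial γ χ R x) ^ q.toReal) :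
    N ≤ G γ χ q R := by
  have hq' : 0 < q.toReal := ENNReal.toReal_pos hq0 hq
  have hfin := (memLp_muHat hγ hχ hc R q).eLpNorm_ne_top
  rw [G, ← ENNReal.ofReal_le_iff_le_toReal hfin]
  rw [← ENNReal.rpow_le_rpow_iff hq', ENNReal.ofReal_rpow_of_nonneg hN hq'.le,
    eLpNorm_eq_lintegral_rpow_enorm_toReal hq0 hq, ← ENNReal.rpow_mul, one_div,
    inv_mul_cancel₀ hq'.ne', ENNReal.rpow_one]
  have hmeas : Measurable (fun x : EuclideanSpace ℝ (Fin d) =>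
      ‖muHat γ χ (R • x)‖ₑ ^ q.toReal) := by
    exact (((continuous_muHat hγ hχ hc).comp (continuous_const_smul R)).measurable.enorm).pow_const _
  rw [lintegral_sphereMeasure (fun x => ‖muHat γ χ (R • x)‖ₑ ^ q.toReal) hmeas]
  refine h.trans ?_
  have h1 : ∀ x, ENNReal.ofReal (radial γ χ R x) ^ q.toReal =
      ‖muHat γ χ (R • (‖x‖⁻¹ • x))‖ₑ ^ q.toReal := by
    intro x
    rw [radial, ofReal_norm]
  simp_rw [h1]
  refine le_mul_of_one_le_left (by positivity) ?_
  exact_mod_cast hd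

/-- The supremum norm controls `|μ̂(Rθ)|` at every point, by continuity. -/
theorem radial_le_G_top {d : ℕ} {γ : ℝ → EuclideanSpace ℝ (Fin d)}
    (hγ : Continuous γ) {χ : ℝ → ℝ} (hχ : Continuous χ) (hc : HasCompactSupport χ) (R : ℝ)
    {x : EuclideanSpace ℝ (Fin d)} (hx : x ≠ 0) : radial γ χ R x ≤ G γ χ ⊤ R := by
  have hfin := (memLp_muHat hγ hχ hc R ⊤).eLpNorm_ne_top
  rw [G, ← ENNReal.ofReal_le_iff_le_toReal hfin]
  have : (sphereMeasure d).IsOpenPosMeasure := by unfold sphereMeasure; infer_instance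
  set F := fun (θ : Metric.sphere (0 : EuclideanSpace ℝ (Fin d)) 1) =>
      muHat γ χ (R • (θ : EuclideanSpace ℝ (Fin d))) with hF
  have hFc : Continuous F := by
    have h := continuous_muHat hγ hχ hc
    fun_prop
  have hae : ∀ᵐ θ ∂(sphereMeasure d), ‖F θ‖ₑ ≤ eLpNorm F ⊤ (sphereMeasure d) := by
    rw [eLpNorm_exponent_top]; exact ae_le_eLpNormEssSup
  have hd : Dense {θ | ‖F θ‖ₑ ≤ eLpNorm F ⊤ (sphereMeasure d)} := Measure.dense_of_ae hae
  have hcl : IsClosed {θ | ‖F θ‖ₑ ≤ eLpNorm F ⊤ (sphereMeasure d)} :=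
    isClosed_le (by fun_prop) continuous_const
  have huniv := hcl.closure_eq ▸ hd.closure_eq
  have hn : 0 < ‖x‖ := norm_pos_iff.mpr hx
  have hmem : (⟨‖x‖⁻¹ • x, by
      rw [mem_sphere_zero_iff_norm, norm_smul, norm_inv, norm_norm, inv_mul_cancel₀ hn.ne']⟩ :
      Metric.sphere (0 : EuclideanSpace ℝ (Fin d)) 1) ∈
      {θ | ‖F θ‖ₑ ≤ eLpNorm F ⊤ (sphereMeasure d)} := by rw [huniv]; trivial
  have h2 : ‖F _‖ₑ ≤ _ := hmem
  rw [radial, ofReal_norm]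
  exact h2

/-! ### Averaged oscillatory factors -/

/-- The weight `(1 - τ²)²` on `[-1, 1]`. It vanishes to second order at the endpoints, so that two
integrations by parts leave no boundary terms. -/
def bump (τ : ℝ) : ℝ := (1 - τ ^ 2) ^ 2

/-- The square `[-1, 1]²` over which pairs of rotation parameters are averaged. -/
def square : Set (ℝ × ℝ) := Icc (-1) 1 ×ˢ Icc (-1) 1

theorem continuous_bump : Continuous bump := by unfold bump; fun_prop

theorem bump_nonneg (τ : ℝ) : 0 ≤ bump τ := sq_nonneg _

theorem bump_le_one {τ : ℝ} (h : τ ∈ Icc (-1 : ℝ) 1) : bump τ ≤ 1 := by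
  unfold bump
  have : τ ^ 2 ≤ 1 := by nlinarith [h.1, h.2]
  nlinarith [sq_nonneg τ]

theorem integral_bump : ∫ τ in Icc (-1 : ℝ) 1, bump τ = 16 / 15 := by
  rw [integral_Icc_eq_integral_Ioc, ← intervalIntegral.integral_of_le (by norm_num)]
  rw [intervalIntegral.integral_eq_sub_of_hasDerivAt
    (f := fun τ => τ - 2 * τ ^ 3 / 3 + τ ^ 5 / 5)]
  · norm_num
  · intro τ _
    have h := ((hasDerivAt_id τ).sub (((hasDerivAt_pow 3 τ).const_mul 2).div_const 3)).add
      ((hasDerivAt_pow 5 τ).div_const 5)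
    refine h.congr_deriv ?_
    unfold bump
    push_cast
    ring
  · exact continuous_bump.intervalIntegrable _ _

/-- Two integrations by parts against a linear phase. -/
theorem norm_integral_mul_exp_le {a a' a'' : ℝ → ℂ} (h1 : ∀ τ, HasDerivAt a (a' τ) τ)
    (h2 : ∀ τ, HasDerivAt a' (a'' τ) τ) (hc : Continuous a'') {D : ℝ}
    (hD : ∀ τ ∈ Icc (-1 : ℝ) 1, ‖a'' τ‖ ≤ D) (ha1 : a 1 = 0) (ha2 : a (-1) = 0) (ha3 : a' 1 = 0)
    (ha4 : a' (-1) = 0) {b : ℝ} (hb : b ≠ 0) :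
    ‖∫ τ in (-1 : ℝ)..1, a τ * Complex.exp (-Complex.I * (b * τ : ℝ))‖ ≤ 2 * D / b ^ 2 := by
  have hbC : (b : ℂ) ≠ 0 := by exact_mod_cast hb
  have hac : Continuous a := continuous_iff_continuousAt.mpr fun τ => (h1 τ).continuousAt
  have he : ∀ τ : ℝ, HasDerivAt (fun τ : ℝ => Complex.exp (-Complex.I * (b * τ : ℝ)))
      (Complex.exp (-Complex.I * (b * τ : ℝ)) * (-Complex.I * b)) τ := by
    intro τ
    have := (((hasDerivAt_id τ).const_mul b).ofReal_comp.const_mul (-Complex.I)).cexp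
    simpa using this
  have hΦ : ∀ τ ∈ uIcc (-1 : ℝ) 1, HasDerivAt (fun τ : ℝ =>
      (a τ * (Complex.I / b) + a' τ / (b : ℂ) ^ 2) * Complex.exp (-Complex.I * (b * τ : ℝ)))
      (a τ * Complex.exp (-Complex.I * (b * τ : ℝ)) +
        a'' τ * Complex.exp (-Complex.I * (b * τ : ℝ)) / (b : ℂ) ^ 2) τ := by
    intro τ _
    refine ((((h1 τ).mul_const _).add ((h2 τ).div_const _)).mul (he τ)).congr_deriv ?_
    simp only [Pi.add_apply]
    field_simp
    ring_nf
    simp only [Complex.I_sq]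
    ring
  have hint := intervalIntegral.integral_eq_sub_of_hasDerivAt hΦ
    (Continuous.intervalIntegrable (by fun_prop) _ _)
  rw [ha1, ha2, ha3, ha4] at hint
  rw [intervalIntegral.integral_add (Continuous.intervalIntegrable (by fun_prop) _ _)
    (Continuous.intervalIntegrable (by fun_prop) _ _)] at hint
  have h0 : ∫ τ in (-1 : ℝ)..1, a τ * Complex.exp (-Complex.I * (b * τ : ℝ)) =
      -∫ τ in (-1 : ℝ)..1, a'' τ * Complex.exp (-Complex.I * (b * τ : ℝ)) / (b : ℂ) ^ 2 := by
    rw [eq_neg_iff_add_eq_zero, hint]; simp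
  rw [h0, norm_neg]
  have := intervalIntegral.norm_integral_le_of_norm_le_const (a := -1) (b := 1) (C := D / b ^ 2)
    (f := fun τ : ℝ => a'' τ * Complex.exp (-Complex.I * (b * τ : ℝ)) / (b : ℂ) ^ 2) ?_
  · refine this.trans_eq ?_
    norm_num
    ring
  · intro τ hτ
    rw [uIoc_of_le (by norm_num)] at hτ
    rw [norm_div, norm_mul, show -Complex.I * ((b * τ : ℝ) : ℂ) =
      ((-(b * τ) : ℝ) : ℂ) * Complex.I by push_cast; ring,
      Complex.norm_exp_ofReal_mul_I, mul_one, norm_pow, Complex.norm_real, Real.norm_eq_abs, sq_abs]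
    exact div_le_div_of_nonneg_right (hD τ ⟨hτ.1.le, hτ.2⟩) (sq_nonneg _)

theorem abs_integral_bump_mul_cos_le {φ φ' φ'' : ℝ → ℝ} (h1 : ∀ τ, HasDerivAt φ (φ' τ) τ)
    (h2 : ∀ τ, HasDerivAt φ' (φ'' τ) τ) (hc : Continuous φ'')
    (hb1 : ∀ τ ∈ Icc (-1 : ℝ) 1, |φ' τ| ≤ 1) (hb2 : ∀ τ ∈ Icc (-1 : ℝ) 1, |φ'' τ| ≤ 1)
    {b : ℝ} (hb : b ≠ 0) :
    |∫ τ in Icc (-1 : ℝ) 1, bump τ * Real.cos (φ τ + b * τ)| ≤ 36 / b ^ 2 := by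
  rw [integral_Icc_eq_integral_Ioc, ← intervalIntegral.integral_of_le (by norm_num)]
  have hcφ : Continuous φ := continuous_iff_continuousAt.mpr fun τ => (h1 τ).continuousAt
  have hcφ' : Continuous φ' := continuous_iff_continuousAt.mpr fun τ => (h2 τ).continuousAt
  set e : ℝ → ℂ := fun τ => Complex.exp (-Complex.I * φ τ) with he
  have hed : ∀ τ, HasDerivAt e (e τ * (-Complex.I * φ' τ)) τ := by
    intro τ
    exact ((h1 τ).ofReal_comp.const_mul (-Complex.I)).cexp
  have hw : ∀ τ : ℝ, HasDerivAt (fun τ => ((bump τ : ℝ) : ℂ)) ((-4 * τ * (1 - τ ^ 2) : ℝ) : ℂ) τ := by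
    intro τ
    have : HasDerivAt bump (-4 * τ * (1 - τ ^ 2)) τ := by
      have := ((hasDerivAt_pow 2 τ).const_sub 1).pow 2
      refine this.congr_deriv ?_
      push_cast
      ring
    exact this.ofReal_comp
  have hw' : ∀ τ : ℝ, HasDerivAt (fun τ : ℝ => ((-4 * τ * (1 - τ ^ 2) : ℝ) : ℂ))
      ((-4 + 12 * τ ^ 2 : ℝ) : ℂ) τ := by
    intro τ
    have : HasDerivAt (fun τ : ℝ => -4 * τ * (1 - τ ^ 2)) (-4 + 12 * τ ^ 2) τ := by
      have := ((hasDerivAt_id τ).const_mul (-4)).mul ((hasDerivAt_pow 2 τ).const_sub 1)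
      refine this.congr_deriv ?_
      simp
      ring
    exact this.ofReal_comp
  have key := norm_integral_mul_exp_le
    (a := fun τ => (bump τ : ℂ) * e τ)
    (a' := fun τ => ((-4 * τ * (1 - τ ^ 2) : ℝ) : ℂ) * e τ + (bump τ : ℂ) * (e τ * (-Complex.I * φ' τ)))
    (a'' := fun τ => (((-4 + 12 * τ ^ 2 : ℝ) : ℂ) * e τ +
        ((-4 * τ * (1 - τ ^ 2) : ℝ) : ℂ) * (e τ * (-Complex.I * φ' τ))) +
      (((-4 * τ * (1 - τ ^ 2) : ℝ) : ℂ) * (e τ * (-Complex.I * φ' τ)) +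
        (bump τ : ℂ) * (e τ * (-Complex.I * φ' τ) * (-Complex.I * φ' τ) +
          e τ * (-Complex.I * φ'' τ)))) (D := 18)
    (fun τ => (hw τ).mul (hed τ))
    (fun τ => ((hw' τ).mul (hed τ)).add
      ((hw τ).mul ((hed τ).mul ((h2 τ).ofReal_comp.const_mul (-Complex.I))))) ?_ ?_ ?_ ?_ ?_ ?_ hb
  · have hre : ∫ τ in (-1 : ℝ)..1, bump τ * Real.cos (φ τ + b * τ) =
        (∫ τ in (-1 : ℝ)..1, (bump τ : ℂ) * e τ * Complex.exp (-Complex.I * (b * τ : ℝ))).re := by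
      have := Complex.reCLM.intervalIntegral_comp_comm (μ := volume) (a := -1) (b := 1)
        (f := fun τ : ℝ => (bump τ : ℂ) * e τ * Complex.exp (-Complex.I * (b * τ : ℝ)))
        (Continuous.intervalIntegrable (by have := continuous_bump; fun_prop) _ _)
      rw [Complex.reCLM_apply] at this
      rw [← this]
      congr 1
      ext τ
      rw [Complex.reCLM_apply, mul_assoc, he, ← Complex.exp_add,
        show -Complex.I * (φ τ : ℂ) + -Complex.I * ((b * τ : ℝ) : ℂ) =
          ((-(φ τ + b * τ) : ℝ) : ℂ) * Complex.I by push_cast; ring,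
        Complex.re_ofReal_mul, Complex.exp_ofReal_mul_I_re, Real.cos_neg]
    rw [hre]
    refine (Complex.abs_re_le_norm _).trans (key.trans_eq (by norm_num))
  · have := continuous_bump
    fun_prop
  · intro τ hτ
    have hen : ‖e τ‖ = 1 := by
      rw [he]
      simp only
      rw [show -Complex.I * (φ τ : ℂ) = ((-(φ τ) : ℝ) : ℂ) * Complex.I by push_cast; ring,
        Complex.norm_exp_ofReal_mul_I]
    have hn1 : ‖e τ * (-Complex.I * φ' τ)‖ ≤ 1 := by
      simpa [hen] using hb1 τ hτ
    have hn2 : ‖e τ * (-Complex.I * φ' τ) * (-Complex.I * φ' τ)‖ ≤ 1 := by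
      have h3 := hb1 τ hτ
      rw [norm_mul]
      refine mul_le_one₀ hn1 (norm_nonneg _) (by simpa using h3)
    have hn3 : ‖e τ * (-Complex.I * φ'' τ)‖ ≤ 1 := by
      simpa [hen] using hb2 τ hτ
    have hτ2 : τ ^ 2 ≤ 1 := by nlinarith [hτ.1, hτ.2]
    have hw1 : ‖((-4 + 12 * τ ^ 2 : ℝ) : ℂ)‖ ≤ 8 := by
      rw [Complex.norm_real, Real.norm_eq_abs, abs_le]
      constructor <;> nlinarith [sq_nonneg τ]
    have hw2 : ‖((-4 * τ * (1 - τ ^ 2) : ℝ) : ℂ)‖ ≤ 4 := by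
      rw [Complex.norm_real, Real.norm_eq_abs, abs_mul, abs_mul]
      have h3 : |τ| ≤ 1 := abs_le.mpr hτ
      have h4 : |1 - τ ^ 2| ≤ 1 := by rw [abs_le]; constructor <;> nlinarith [sq_nonneg τ]
      have : |(-4 : ℝ)| = 4 := by norm_num
      rw [this]
      nlinarith [abs_nonneg τ, abs_nonneg (1 - τ ^ 2)]
    have hw3 : ‖(bump τ : ℂ)‖ ≤ 1 := by
      rw [Complex.norm_real, Real.norm_of_nonneg (bump_nonneg τ)]
      exact bump_le_one hτ
    have hA : ‖((-4 + 12 * τ ^ 2 : ℝ) : ℂ) * e τ‖ ≤ 8 := by rw [norm_mul, hen, mul_one]; exact hw1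
    have hB : ‖((-4 * τ * (1 - τ ^ 2) : ℝ) : ℂ) * (e τ * (-Complex.I * φ' τ))‖ ≤ 4 := by
      rw [norm_mul]
      nlinarith [norm_nonneg (e τ * (-Complex.I * φ' τ)),
        norm_nonneg ((-4 * τ * (1 - τ ^ 2) : ℝ) : ℂ)]
    have hC : ‖(bump τ : ℂ) * (e τ * (-Complex.I * φ' τ) * (-Complex.I * φ' τ) +
          e τ * (-Complex.I * φ'' τ))‖ ≤ 2 := by
      rw [norm_mul]
      have := norm_add_le (e τ * (-Complex.I * φ' τ) * (-Complex.I * φ' τ)) (e τ * (-Complex.I * φ'' τ))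
      nlinarith [norm_nonneg (bump τ : ℂ), norm_nonneg (e τ * (-Complex.I * φ' τ) * (-Complex.I * φ' τ) +
          e τ * (-Complex.I * φ'' τ))]
    refine (norm_add_le _ _).trans ?_
    have := norm_add_le (((-4 + 12 * τ ^ 2 : ℝ) : ℂ) * e τ)
      (((-4 * τ * (1 - τ ^ 2) : ℝ) : ℂ) * (e τ * (-Complex.I * φ' τ)))
    have := norm_add_le (((-4 * τ * (1 - τ ^ 2) : ℝ) : ℂ) * (e τ * (-Complex.I * φ' τ)))
      ((bump τ : ℂ) * (e τ * (-Complex.I * φ' τ) * (-Complex.I * φ' τ) +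
          e τ * (-Complex.I * φ'' τ)))
    linarith
  all_goals norm_num [bump]

/-- The integral of `cos ψ`, with weight `bump`, over the square of rotation parameters, where
`ψ = Q + A cos θ + B sin θ` and `θ = η (τ₁ + τ₂)`. -/
def kernel (Q A B η : ℝ) : ℝ :=
  ∫ p in square, bump p.1 * bump p.2 *
    Real.cos (Q + A * Real.cos (η * (p.1 + p.2)) + B * Real.sin (η * (p.1 + p.2)))

theorem isCompact_square : IsCompact square := isCompact_Icc.prod isCompact_Icc

theorem measurableSet_square : MeasurableSet square := measurableSet_Icc.prod measurableSet_Icc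

theorem integrableOn_square {f : ℝ × ℝ → ℝ} (hf : Continuous f) :
    IntegrableOn f square := hf.continuousOn.integrableOn_compact isCompact_square

theorem setIntegral_square {f : ℝ × ℝ → ℝ} (hf : Continuous f) :
    ∫ p in square, f p = ∫ x in Icc (-1 : ℝ) 1, ∫ y in Icc (-1 : ℝ) 1, f (x, y) := by
  have h := integrableOn_square hf
  rw [square, Measure.volume_eq_prod] at *
  rw [setIntegral_prod _ h]

theorem setIntegral_square_mul {f g : ℝ → ℝ} :
    ∫ p in square, f p.1 * g p.2 = (∫ x in Icc (-1 : ℝ) 1, f x) * ∫ y in Icc (-1 : ℝ) 1, g y := by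
  rw [square, Measure.volume_eq_prod, setIntegral_prod_mul]

theorem integral_bump_mul_bump : ∫ p in square, bump p.1 * bump p.2 = (16 / 15) ^ 2 := by
  rw [setIntegral_square_mul, integral_bump, sq]

theorem continuous_kernel_integrand (Q A B η : ℝ) :
    Continuous (fun p : ℝ × ℝ => bump p.1 * bump p.2 *
      Real.cos (Q + A * Real.cos (η * (p.1 + p.2)) + B * Real.sin (η * (p.1 + p.2)))) := by
  have := continuous_bump
  fun_prop

/-- Away from stationarity the average decays quadratically in the rate `η B`. -/
theorem abs_kernel_le {Q A B η : ℝ} (hη : 0 ≤ η) (hA : η ^ 2 * |A| ≤ 1 / 4)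
    (hB : η ^ 2 * |B| ≤ 1 / 4) (hb : η * B ≠ 0) : |kernel Q A B η| ≤ 72 / (η * B) ^ 2 := by
  rw [kernel, setIntegral_square (continuous_kernel_integrand Q A B η)]
  have hin : ∀ x ∈ Icc (-1 : ℝ) 1, ‖∫ y in Icc (-1 : ℝ) 1, bump x * bump y *
      Real.cos (Q + A * Real.cos (η * (x + y)) + B * Real.sin (η * (x + y)))‖ ≤
      36 / (η * B) ^ 2 := by
    intro x hx
    simp_rw [mul_assoc (bump x)]
    rw [integral_const_mul, Real.norm_eq_abs, abs_mul, abs_of_nonneg (bump_nonneg x)]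
    have hlin : ∀ y : ℝ, HasDerivAt (fun y => η * (x + y)) η y := by
      intro y
      simpa using ((hasDerivAt_id y).const_add x).const_mul η
    -- The linear part `η B y` is split off; the rest has derivatives bounded by `1`.
    have h := abs_integral_bump_mul_cos_le
      (φ := fun y => Q + A * Real.cos (η * (x + y)) + B * (Real.sin (η * (x + y)) - η * y))
      (φ' := fun y => -(A * η) * Real.sin (η * (x + y)) + B * η * (Real.cos (η * (x + y)) - 1))
      (φ'' := fun y => -(A * η ^ 2) * Real.cos (η * (x + y)) - B * η ^ 2 * Real.sin (η * (x + y)))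
      ?_ ?_ (by fun_prop) ?_ ?_ hb
    · refine (mul_le_of_le_one_left (abs_nonneg _) (bump_le_one hx)).trans (le_trans (le_of_eq ?_) h)
      congr 2
      ext y
      congr 2
      ring
    · intro y
      refine ((((hlin y).cos.const_mul A).const_add Q).add
        (((hlin y).sin.sub ((hasDerivAt_id y).const_mul η)).const_mul B)).congr_deriv ?_
      ring
    · intro y
      refine (((hlin y).sin.const_mul (-(A * η))).add
        (((hlin y).cos.sub_const 1).const_mul (B * η))).congr_deriv ?_
      ring
    · intro y hy
      have hu : |η * (x + y)| ≤ 2 * η := by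
        rw [abs_mul, abs_of_nonneg hη, mul_comm]
        refine mul_le_mul_of_nonneg_right ?_ hη
        rw [abs_le]; constructor <;> linarith [hx.1, hx.2, hy.1, hy.2]
      have hs : |Real.sin (η * (x + y))| ≤ 2 * η := Real.abs_sin_le_abs.trans hu
      have hc : |Real.cos (η * (x + y)) - 1| ≤ 2 * η := by
        have := Real.abs_cos_sub_cos_le (η * (x + y)) 0
        rw [Real.cos_zero, sub_zero] at this
        exact this.trans hu
      calc _ ≤ |-(A * η) * Real.sin (η * (x + y))| + |B * η * (Real.cos (η * (x + y)) - 1)| :=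
            abs_add_le _ _
        _ = |A| * η * |Real.sin (η * (x + y))| + |B| * η * |Real.cos (η * (x + y)) - 1| := by
            simp only [abs_mul, abs_neg, abs_of_nonneg hη]
        _ ≤ |A| * η * (2 * η) + |B| * η * (2 * η) := by gcongr
        _ ≤ 1 := by nlinarith
    · intro y hy
      calc _ ≤ |-(A * η ^ 2) * Real.cos (η * (x + y))| + |B * η ^ 2 * Real.sin (η * (x + y))| :=
            abs_sub _ _
        _ = |A| * η ^ 2 * |Real.cos (η * (x + y))| + |B| * η ^ 2 * |Real.sin (η * (x + y))| := by
            simp only [abs_mul, abs_neg, abs_of_nonneg (sq_nonneg η)]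
        _ ≤ |A| * η ^ 2 * 1 + |B| * η ^ 2 * 1 := by
            gcongr
            · exact Real.abs_cos_le_one _
            · exact Real.abs_sin_le_one _
        _ ≤ 1 := by nlinarith
  have := norm_setIntegral_le_of_norm_le_const (μ := volume) (s := Icc (-1 : ℝ) 1)
    (by simp) hin
  rw [← Real.norm_eq_abs]
  refine this.trans_eq ?_
  simp [Measure.real]
  norm_num
  ring

/-- When the phase is nearly linear in the rotation parameters, the average is nearly
nonnegative: for an exactly linear phase it is the square of a Fourier integral. -/
theorem neg_le_kernel {Q A B η ε : ℝ} (hη : 0 ≤ η)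
    (h : |Q| + |A| + 2 * η ^ 3 * |B| ≤ ε) : -(2 * ε) ≤ kernel Q A B η := by
  have hcb := continuous_bump
  have hε : 0 ≤ ε := le_trans (by positivity) h
  -- The two rotation parameters enter through their sum, so the linear phase factors.
  have hlin : ∫ p in square, bump p.1 * bump p.2 * Real.cos (η * B * (p.1 + p.2)) =
      (∫ x in Icc (-1 : ℝ) 1, bump x * Real.cos (η * B * x)) ^ 2 := by
    have hodd : ∫ x in Icc (-1 : ℝ) 1, bump x * Real.sin (η * B * x) = 0 := by
      rw [integral_Icc_eq_integral_Ioc, ← intervalIntegral.integral_of_le (by norm_num)]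
      have := intervalIntegral.integral_comp_neg (a := -1) (b := 1)
        (fun x => bump x * Real.sin (η * B * x))
      simp only [neg_neg] at this
      have h2 : ∀ x, bump (-x) * Real.sin (η * B * -x) = -(bump x * Real.sin (η * B * x)) := by
        intro x
        rw [mul_neg, Real.sin_neg]; unfold bump; ring
      simp_rw [h2] at this
      rw [intervalIntegral.integral_neg] at this
      linarith
    have h3 : ∀ p : ℝ × ℝ, bump p.1 * bump p.2 * Real.cos (η * B * (p.1 + p.2)) =
        (bump p.1 * Real.cos (η * B * p.1)) * (bump p.2 * Real.cos (η * B * p.2)) -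
        (bump p.1 * Real.sin (η * B * p.1)) * (bump p.2 * Real.sin (η * B * p.2)) := by
      intro p
      rw [mul_add, Real.cos_add]; ring
    simp_rw [h3]
    rw [integral_sub, setIntegral_square_mul (f := fun x => bump x * Real.cos (η * B * x))
      (g := fun x => bump x * Real.cos (η * B * x)),
      setIntegral_square_mul (f := fun x => bump x * Real.sin (η * B * x))
      (g := fun x => bump x * Real.sin (η * B * x)), hodd]
    · ring
    · exact integrableOn_square (by fun_prop)
    · exact integrableOn_square (by fun_prop)
  have hmono : ∫ p in square, (bump p.1 * bump p.2 * Real.cos (η * B * (p.1 + p.2)) -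
      ε * (bump p.1 * bump p.2)) ≤ kernel Q A B η := by
    refine setIntegral_mono_on (integrableOn_square (by fun_prop))
      (integrableOn_square (continuous_kernel_integrand Q A B η)) measurableSet_square ?_
    rintro ⟨x, y⟩ ⟨hx, hy⟩
    simp only at hx hy ⊢
    have hu : |η * (x + y)| ≤ 2 * η := by
      rw [abs_mul, abs_of_nonneg hη, mul_comm]
      refine mul_le_mul_of_nonneg_right ?_ hη
      rw [abs_le]; constructor <;> linarith [hx.1, hx.2, hy.1, hy.2]
    have hs : |Real.sin (η * (x + y)) - η * (x + y)| ≤ 2 * η ^ 3 := by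
      rw [abs_sub_comm]
      refine (Real.abs_sub_sin_le _).trans ?_
      have := pow_le_pow_left₀ (abs_nonneg _) hu 3
      nlinarith [pow_nonneg hη 3]
    have hd := Real.abs_cos_sub_cos_le
      (Q + A * Real.cos (η * (x + y)) + B * Real.sin (η * (x + y))) (η * B * (x + y))
    have hd2 : |Q + A * Real.cos (η * (x + y)) + B * Real.sin (η * (x + y)) - η * B * (x + y)| ≤
        ε := by
      have e : Q + A * Real.cos (η * (x + y)) + B * Real.sin (η * (x + y)) - η * B * (x + y) =
        Q + A * Real.cos (η * (x + y)) + B * (Real.sin (η * (x + y)) - η * (x + y)) := by ring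
      rw [e]
      refine (abs_add_three _ _ _).trans (le_trans ?_ h)
      rw [abs_mul, abs_mul]
      have := mul_le_mul_of_nonneg_left (Real.abs_cos_le_one (η * (x + y))) (abs_nonneg A)
      have := mul_le_mul_of_nonneg_left hs (abs_nonneg B)
      linarith
    have h4 := (abs_le.mp (hd.trans hd2)).1
    have h5 : 0 ≤ bump x * bump y := mul_nonneg (bump_nonneg _) (bump_nonneg _)
    nlinarith
  rw [integral_sub (integrableOn_square (by fun_prop)) (integrableOn_square (by fun_prop)), hlin,
    integral_const_mul, integral_bump_mul_bump] at hmono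
  nlinarith [sq_nonneg (∫ x in Icc (-1 : ℝ) 1, bump x * Real.cos (η * B * x))]

theorem half_le_kernel {Q A B η : ℝ} (hη : 0 ≤ η) (h : |Q| + |A| + 2 * η * |B| ≤ 1) :
    1 / 2 ≤ kernel Q A B η := by
  have hcb := continuous_bump
  have hmono : ∫ p in square, (1 / 2) * (bump p.1 * bump p.2) ≤ kernel Q A B η := by
    refine setIntegral_mono_on (integrableOn_square (by fun_prop))
      (integrableOn_square (continuous_kernel_integrand Q A B η)) measurableSet_square ?_
    rintro ⟨x, y⟩ ⟨hx, hy⟩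
    simp only at hx hy ⊢
    have hu : |η * (x + y)| ≤ 2 * η := by
      rw [abs_mul, abs_of_nonneg hη, mul_comm]
      refine mul_le_mul_of_nonneg_right ?_ hη
      rw [abs_le]; constructor <;> linarith [hx.1, hx.2, hy.1, hy.2]
    have hs : |Real.sin (η * (x + y))| ≤ 2 * η := Real.abs_sin_le_abs.trans hu
    have hψ : |Q + A * Real.cos (η * (x + y)) + B * Real.sin (η * (x + y))| ≤ 1 := by
      refine (abs_add_three _ _ _).trans (le_trans ?_ h)
      rw [abs_mul, abs_mul]
      have := mul_le_mul_of_nonneg_left (Real.abs_cos_le_one (η * (x + y))) (abs_nonneg A)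
      have := mul_le_mul_of_nonneg_left hs (abs_nonneg B)
      linarith
    have h1 := Real.one_sub_sq_div_two_le_cos
      (x := Q + A * Real.cos (η * (x + y)) + B * Real.sin (η * (x + y)))
    have h2 := (sq_le_one_iff_abs_le_one _).mpr hψ
    have h5 : 0 ≤ bump x * bump y := mul_nonneg (bump_nonneg _) (bump_nonneg _)
    nlinarith
  rw [integral_const_mul, integral_bump_mul_bump] at hmono
  linarith

/-- `u⁻²` on `|u| > L`, zero elsewhere. -/
def tail (L u : ℝ) : ℝ :=
  (Ioi L).indicator (fun u => u ^ (-2 : ℝ)) u + (Ioi L).indicator (fun u => u ^ (-2 : ℝ)) (-u)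

theorem integrable_tail {L : ℝ} (hL : 0 < L) : Integrable (tail L) := by
  have h : Integrable ((Ioi L).indicator (fun u : ℝ => u ^ (-2 : ℝ))) :=
    (integrable_indicator_iff measurableSet_Ioi).mpr
      (integrableOn_Ioi_rpow_of_lt (by norm_num) hL)
  exact h.add h.comp_neg

theorem integral_tail {L : ℝ} (hL : 0 < L) : ∫ u, tail L u = 2 / L := by
  have h : Integrable ((Ioi L).indicator (fun u : ℝ => u ^ (-2 : ℝ))) :=
    (integrable_indicator_iff measurableSet_Ioi).mpr
      (integrableOn_Ioi_rpow_of_lt (by norm_num) hL)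
  unfold tail
  rw [integral_add h h.comp_neg,
    integral_neg_eq_self (f := (Ioi L).indicator (fun u : ℝ => u ^ (-2 : ℝ))),
    integral_indicator measurableSet_Ioi, integral_Ioi_rpow_of_lt (by norm_num) hL]
  norm_num [Real.rpow_neg_one]
  ring

theorem tail_of_lt {L u : ℝ} (hL : 0 < L) (h : L < |u|) : tail L u = 1 / u ^ 2 := by
  unfold tail
  rcases lt_abs.mp h with h | h
  · rw [indicator_of_mem (show u ∈ Ioi L from h), indicator_of_notMem (by simp; linarith), add_zero,
      Real.rpow_neg (hL.le.trans h.le)]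
    norm_num
  · rw [indicator_of_mem (show -u ∈ Ioi L from h), indicator_of_notMem (by simp; linarith), zero_add,
      Real.rpow_neg (hL.le.trans h.le)]
    norm_num

theorem tail_nonneg {L : ℝ} (hL : 0 < L) (u : ℝ) : 0 ≤ tail L u := by
  unfold tail
  refine add_nonneg (indicator_nonneg (fun x hx => ?_) _) (indicator_nonneg (fun x hx => ?_) _) <;>
  exact Real.rpow_nonneg (hL.le.trans (le_of_lt hx)) _

/-- Lower bound for the integral of the averaged oscillatory factor against a cutoff: on the scale
`u = M (t - t₁)` the average is at least `1/2` near `0`, almost nonnegative for `|u| ≤ L`, and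
`O(u⁻²)` beyond. -/
theorem exists_le_integral_mul_kernel {c₀ C₀ : ℝ} (hc₀ : 0 < c₀) (hC₀ : 0 < C₀) :
    ∃ L : ℝ, 1 ≤ L ∧ ∃ ε : ℝ, 0 < ε ∧ ∃ lam : ℝ, 0 < lam ∧
      ∀ (χ : ℝ → ℝ) (t₁ M η : ℝ) (Q A B : ℝ → ℝ), Integrable χ → (∀ t, 0 ≤ χ t) → (∀ t, χ t ≤ 1) →
        0 < M → 0 ≤ η → (∀ t, |t - t₁| ≤ L / M → χ t = 1) →
        (∀ t, χ t ≠ 0 → c₀ * M * |t - t₁| ≤ |η * B t| ∧ |η * B t| ≤ C₀ * M * |t - t₁|) →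
        (∀ t, χ t ≠ 0 → η ^ 2 * |A t| ≤ 1 / 4 ∧ η ^ 2 * |B t| ≤ 1 / 4) →
        (∀ t, |t - t₁| ≤ L / M → |Q t| + |A t| + 2 * η ^ 3 * |B t| ≤ ε) →
        Integrable (fun t => χ t * kernel (Q t) (A t) (B t) η) →
        lam / M ≤ ∫ t, χ t * kernel (Q t) (A t) (B t) η := by
  set c₁ : ℝ := min 1 (1 / (4 * C₀)) with hc₁
  have hc₁0 : 0 < c₁ := lt_min one_pos (by positivity)
  set D : ℝ := 72 / c₀ ^ 2 with hD
  have hD0 : 0 < D := by positivity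
  set L : ℝ := max 1 (8 * D / c₁) with hL
  have hL1 : 1 ≤ L := le_max_left _ _
  have hL0 : 0 < L := by linarith
  have hDL : D * (2 / L) ≤ c₁ / 4 := by
    have : 8 * D / c₁ ≤ L := le_max_right _ _
    rw [div_le_iff₀ hc₁0] at this
    rw [← mul_div_assoc, div_le_iff₀ hL0]
    linarith
  set ε : ℝ := min (1 / 2) (c₁ / (16 * L)) with hε
  have hε0 : 0 < ε := lt_min (by norm_num) (by positivity)
  have hεL : 2 * ε * (2 * L) ≤ c₁ / 4 := by
    have : ε ≤ c₁ / (16 * L) := min_le_right _ _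
    rw [le_div_iff₀ (by positivity)] at this
    linarith
  refine ⟨L, hL1, ε, hε0, c₁ / 2, by positivity, ?_⟩
  intro χ t₁ M η Q A B hχi hχ0 hχ1 hM hη hχL hlow hder hnear hint
  -- A minorant of the integrand in the variable `u = M (t - t₁)`. The choices of `L` and then of `ε`
  -- make each of its two negative parts at most `c₁/4`, against a positive part of mass `c₁`.
  set g : ℝ → ℝ := fun u => (Icc (-c₁) c₁).indicator (fun _ => (1 / 2 : ℝ)) u -
    (Icc (-L) L).indicator (fun _ => 2 * ε) u - D * tail L u with hg
  have hi1 : Integrable ((Icc (-c₁) c₁).indicator (fun _ => (1 / 2 : ℝ))) :=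
    (integrable_indicator_iff measurableSet_Icc).mpr
      (continuousOn_const.integrableOn_compact isCompact_Icc)
  have hi2 : Integrable ((Icc (-L) L).indicator (fun _ => 2 * ε)) :=
    (integrable_indicator_iff measurableSet_Icc).mpr
      (continuousOn_const.integrableOn_compact isCompact_Icc)
  have hgi : Integrable g := (hi1.sub hi2).sub ((integrable_tail hL0).const_mul D)
  have hgint : c₁ / 2 ≤ ∫ u, g u := by
    have e : ∫ u, g u = (c₁ + c₁) * (1 / 2) - (L + L) * (2 * ε) - D * (2 / L) := by
      have hi12 : Integrable (fun u => (Icc (-c₁) c₁).indicator (fun _ => (1 / 2 : ℝ)) u -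
        (Icc (-L) L).indicator (fun _ => 2 * ε) u) := hi1.sub hi2
      simp only [hg]
      rw [integral_sub hi12 ((integrable_tail hL0).const_mul D),
        integral_sub hi1 hi2, integral_const_mul, integral_tail hL0,
        integral_indicator measurableSet_Icc, integral_indicator measurableSet_Icc]
      have e1 := ENNReal.toReal_ofReal (show 0 ≤ c₁ + c₁ by linarith)
      have e2 := ENNReal.toReal_ofReal (show 0 ≤ L + L by linarith)
      simp [Measure.real, e1, e2]
    rw [e]; linarith
  have hgM : ∫ t, g (M * (t - t₁)) = (∫ u, g u) / M := by
    rw [integral_sub_right_eq_self (fun t => g (M * t)) t₁, Measure.integral_comp_mul_left,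
      abs_of_pos (inv_pos.mpr hM), smul_eq_mul]
    ring
  have hgMi : Integrable (fun t => g (M * (t - t₁))) :=
    (hgi.comp_mul_left' hM.ne').comp_sub_right t₁
  calc c₁ / 2 / M ≤ (∫ u, g u) / M := by gcongr
    _ = ∫ t, g (M * (t - t₁)) := hgM.symm
    _ ≤ _ := integral_mono hgMi hint ?_
  intro t
  simp only
  have habs : |M * (t - t₁)| = M * |t - t₁| := by rw [abs_mul, abs_of_pos hM]
  by_cases hu : |M * (t - t₁)| ≤ L
  · have htL : |t - t₁| ≤ L / M := by rw [le_div_iff₀ hM, mul_comm, ← habs]; exact hu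
    have hχt := hχL t htL
    rw [hχt, one_mul]
    have hn := hnear t htL
    have hT := mul_nonneg hD0.le (tail_nonneg hL0 (M * (t - t₁)))
    have hmem : M * (t - t₁) ∈ Icc (-L) L := abs_le.mp hu
    have hgu : g (M * (t - t₁)) ≤ (Icc (-c₁) c₁).indicator (fun _ => (1 / 2 : ℝ)) (M * (t - t₁)) -
        2 * ε := by
      rw [hg]; simp only [indicator_of_mem hmem]; linarith
    refine hgu.trans ?_
    by_cases hu1 : M * (t - t₁) ∈ Icc (-c₁) c₁
    · rw [indicator_of_mem hu1]
      refine le_trans (by linarith) (half_le_kernel hη ?_)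
      have hB := (hlow t (by rw [hχt]; exact one_ne_zero)).2
      rw [abs_mul, abs_of_nonneg hη] at hB
      have h1 : M * |t - t₁| ≤ c₁ := by rw [← habs]; exact abs_le.mpr hu1
      have h2 : c₁ ≤ 1 / (4 * C₀) := min_le_right _ _
      have h3 : C₀ * (M * |t - t₁|) ≤ 1 / 4 := by
        calc C₀ * (M * |t - t₁|) ≤ C₀ * (1 / (4 * C₀)) := by gcongr; exact h1.trans h2
          _ = 1 / 4 := by field_simp
      have h4 : |Q t| + |A t| ≤ ε := by
        have : 0 ≤ 2 * η ^ 3 * |B t| := by positivity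
        linarith
      have : ε ≤ 1 / 2 := min_le_left _ _
      linarith
    · rw [indicator_of_notMem hu1]
      have := neg_le_kernel (Q := Q t) (A := A t) (B := B t) hη hn
      linarith
  · rw [not_le] at hu
    have hgu : g (M * (t - t₁)) ≤ - (D * (1 / (M * (t - t₁)) ^ 2)) := by
      have n1 : M * (t - t₁) ∉ Icc (-L) L := fun h => absurd (abs_le.mpr h) (not_le.mpr hu)
      have hcL : c₁ ≤ L := (min_le_left _ _).trans hL1
      have n2 : M * (t - t₁) ∉ Icc (-c₁) c₁ := fun h =>
        n1 ⟨by linarith [h.1], by linarith [h.2]⟩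
      rw [hg]; simp only [indicator_of_notMem n1, indicator_of_notMem n2, tail_of_lt hL0 hu]
      linarith
    refine hgu.trans ?_
    by_cases hχt : χ t = 0
    · rw [hχt, zero_mul, neg_nonpos]; positivity
    · obtain ⟨hB, -⟩ := hlow t hχt
      have hMt : 0 < M * |t - t₁| := by rw [← habs]; linarith
      have hB' : c₀ * (M * |t - t₁|) ≤ |η * B t| := by linarith
      have hpos : 0 < |η * B t| := lt_of_lt_of_le (by positivity) hB'
      have hk := abs_kernel_le (Q := Q t) hη (hder t hχt).1 (hder t hχt).2 (abs_pos.mp hpos)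
      have hk2 : 72 / (η * B t) ^ 2 ≤ D * (1 / (M * (t - t₁)) ^ 2) := by
        rw [hD, ← sq_abs (η * B t), ← sq_abs (M * (t - t₁)), habs, div_mul_div_comm, mul_one,
          ← mul_pow]
        gcongr
      have hk3 := (abs_le.mp (hk.trans hk2)).1
      have : 0 ≤ D * (1 / (M * (t - t₁)) ^ 2) := by positivity
      nlinarith [hχ0 t, hχ1 t]

theorem integrable_cutoff_prod {χ : ℝ → ℝ} (hχ : Integrable χ) (hχc : Continuous χ) {Q A B : ℝ → ℝ}
    (hQ : Continuous Q) (hA : Continuous A) (hB : Continuous B) (η : ℝ) :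
    Integrable (fun z : ℝ × (ℝ × ℝ) => χ z.1 * (bump z.2.1 * bump z.2.2 *
      Real.cos (Q z.1 + A z.1 * Real.cos (η * (z.2.1 + z.2.2)) +
        B z.1 * Real.sin (η * (z.2.1 + z.2.2))))) (volume.prod (volume.restrict square)) := by
  have hcb := continuous_bump
  have h := hχ.mul_prod (integrableOn_square (f := fun p => bump p.1 * bump p.2) (by fun_prop))
  refine h.mono (Continuous.aestronglyMeasurable (by fun_prop)) (Filter.Eventually.of_forall ?_)
  intro z
  rw [norm_mul, norm_mul _ (Real.cos _), norm_mul (χ z.1)]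
  refine mul_le_mul_of_nonneg_left (mul_le_of_le_one_right (norm_nonneg _) ?_) (norm_nonneg _)
  rw [Real.norm_eq_abs]
  exact Real.abs_cos_le_one _

theorem integrable_mul_kernel {χ : ℝ → ℝ} (hχ : Integrable χ) (hχc : Continuous χ) {Q A B : ℝ → ℝ}
    (hQ : Continuous Q) (hA : Continuous A) (hB : Continuous B) (η : ℝ) :
    Integrable (fun t => χ t * kernel (Q t) (A t) (B t) η) := by
  have := (integrable_cutoff_prod hχ hχc hQ hA hB η).integral_prod_left
  simp only [integral_const_mul] at this
  exact this

/-- Averaging over rotations commutes with integration along the curve. -/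
theorem integral_mul_kernel {χ : ℝ → ℝ} (hχ : Integrable χ) (hχc : Continuous χ) {Q A B : ℝ → ℝ}
    (hQ : Continuous Q) (hA : Continuous A) (hB : Continuous B) (η : ℝ) :
    ∫ t, χ t * kernel (Q t) (A t) (B t) η = ∫ p in square, bump p.1 * bump p.2 *
      ∫ t, χ t * Real.cos (Q t + A t * Real.cos (η * (p.1 + p.2)) +
        B t * Real.sin (η * (p.1 + p.2))) := by
  have h := integral_integral_swap (f := fun t (p : ℝ × ℝ) => χ t * (bump p.1 * bump p.2 *
      Real.cos (Q t + A t * Real.cos (η * (p.1 + p.2)) + B t * Real.sin (η * (p.1 + p.2)))))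
    (integrable_cutoff_prod hχ hχc hQ hA hB η)
  simp only [integral_const_mul] at h
  unfold kernel
  rw [h]
  congr 1
  ext p
  rw [← integral_const_mul]
  congr 1
  ext t
  ring

/-! ### Averaging over rotations in a coordinate plane -/

/-- The rotation by the angle `θ` in the plane spanned by `u` and `w`. -/
def rot {E : Type*} [NormedAddCommGroup E] [InnerProductSpace ℝ E] (u w : E) (θ : ℝ) (x : E) : E :=
  x + ((Real.cos θ - 1) * inner ℝ u x + Real.sin θ * inner ℝ w x) • u +
    ((Real.cos θ - 1) * inner ℝ w x - Real.sin θ * inner ℝ u x) • w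

section Rotation

variable {E : Type*} [NormedAddCommGroup E] [InnerProductSpace ℝ E]

theorem norm_rot {u w : E} (hu : ‖u‖ = 1) (hw : ‖w‖ = 1) (huw : inner ℝ u w = 0) (θ : ℝ) (x : E) :
    ‖rot u w θ x‖ = ‖x‖ := by
  rw [← sq_eq_sq₀ (norm_nonneg _) (norm_nonneg _), ← real_inner_self_eq_norm_sq,
    ← real_inner_self_eq_norm_sq]
  have huu : inner ℝ u u = (1 : ℝ) := by rw [real_inner_self_eq_norm_sq, hu]; norm_num
  have hww : inner ℝ w w = (1 : ℝ) := by rw [real_inner_self_eq_norm_sq, hw]; norm_num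
  have hwu : inner ℝ w u = (0 : ℝ) := by rw [real_inner_comm]; exact huw
  unfold rot
  simp only [inner_add_left, inner_add_right, inner_smul_left, inner_smul_right, huu, hww, huw, hwu,
    real_inner_comm u x, real_inner_comm w x]
  simp only [conj_trivial]
  linear_combination ((inner ℝ u x) ^ 2 + (inner ℝ w x) ^ 2) * Real.sin_sq_add_cos_sq θ

theorem inner_rot (u w : E) (θ : ℝ) (x y : E) :
    inner ℝ y (rot u w θ x) = inner ℝ y x +
      ((Real.cos θ - 1) * inner ℝ u x + Real.sin θ * inner ℝ w x) * inner ℝ y u +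
      ((Real.cos θ - 1) * inner ℝ w x - Real.sin θ * inner ℝ u x) * inner ℝ y w := by
  unfold rot
  simp only [inner_add_right, inner_smul_right]

theorem continuous_rot (u w : E) : Continuous (fun z : ℝ × E => rot u w z.1 z.2) := by
  unfold rot; fun_prop

theorem rot_smul (u w : E) (θ c : ℝ) (x : E) : rot u w θ (c • x) = c • rot u w θ x := by
  unfold rot
  simp only [inner_smul_right, smul_add, smul_smul]
  congr 2
  · ring_nf
  · ring_nf

theorem measurePreserving_rot [MeasurableSpace E] [BorelSpace E] [FiniteDimensional ℝ E] {u w : E}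
    (hu : ‖u‖ = 1) (hw : ‖w‖ = 1) (huw : inner ℝ u w = 0) (θ : ℝ) :
    MeasurePreserving (rot u w θ) (volume : Measure E) volume := by
  let f : E →ₗᵢ[ℝ] E :=
    { toFun := rot u w θ
      map_add' := by
        intro x y
        unfold rot
        simp only [inner_add_right]
        module
      map_smul' := fun c x => rot_smul u w θ c x
      norm_map' := norm_rot hu hw huw θ }
  exact (f.toLinearIsometryEquiv rfl).measurePreserving

end Rotation

theorem volume_square : (volume : Measure (ℝ × ℝ)) square = 4 := by
  rw [square, Measure.volume_eq_prod, Measure.prod_prod, Real.volume_Icc]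
  rw [← ENNReal.ofReal_mul (by norm_num)]
  norm_num

/-- Jensen's inequality for `t ↦ t^q` on the square, which has measure `4`. -/
theorem rpow_mul_le_lintegral_square {f : ℝ × ℝ → ℝ} (hf : Measurable f) (hf0 : ∀ p, 0 ≤ f p)
    {q : ℝ} (hq : 1 ≤ q) {m : ℝ≥0∞} (hm : 4 * m ≤ ∫⁻ p in square, ENNReal.ofReal (f p)) :
    4 * m ^ q ≤ ∫⁻ p in square, ENNReal.ofReal (f p) ^ q := by
  have hq0 : 0 < q := by linarith
  have h := eLpNorm'_le_eLpNorm'_mul_rpow_measure_univ (μ := volume.restrict square) one_pos hq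
    hf.aestronglyMeasurable
  rw [eLpNorm', eLpNorm', Measure.restrict_apply_univ, volume_square] at h
  simp only [ENNReal.rpow_one, div_one, Real.enorm_of_nonneg (hf0 _)] at h
  have h2 := ENNReal.rpow_le_rpow (hm.trans h) hq0.le
  rw [ENNReal.mul_rpow_of_nonneg _ _ hq0.le, ENNReal.mul_rpow_of_nonneg _ _ hq0.le,
    ← ENNReal.rpow_mul, ← ENNReal.rpow_mul, one_div, inv_mul_cancel₀ hq0.ne', ENNReal.rpow_one,
    show (1 - q⁻¹) * q = q - 1 by field_simp, ENNReal.rpow_sub _ _ (by norm_num) (by norm_num),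
    ENNReal.rpow_one, mul_comm, ← mul_div_assoc] at h2
  have h40 : (4 : ℝ≥0∞) ^ q ≠ 0 := by simp
  have h4t : (4 : ℝ≥0∞) ^ q ≠ ⊤ := by
    exact ENNReal.rpow_ne_top_of_nonneg hq0.le (by norm_num)
  rw [ENNReal.le_div_iff_mul_le (by simp) (by simp)] at h2
  rw [show m ^ q * 4 ^ q * 4 = (4 * m ^ q) * 4 ^ q by ring] at h2
  exact (ENNReal.mul_le_mul_iff_left h40 h4t).mp h2

/-- Rotations preserve Lebesgue measure, so an average of `h` along rotated points that is bounded
below on `D` gives an `L^q` lower bound for `h` on any set containing the rotates of `D`. -/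
theorem rpow_mul_volume_le_lintegral {d : ℕ} {u w : EuclideanSpace ℝ (Fin d)} (hu : ‖u‖ = 1)
    (hw : ‖w‖ = 1) (huw : inner ℝ u w = 0) {h : EuclideanSpace ℝ (Fin d) → ℝ} (hh : Measurable h)
    (h0 : ∀ x, 0 ≤ h x) {D B : Set (EuclideanSpace ℝ (Fin d))} (hD : MeasurableSet D)
    (hB : MeasurableSet B) {η : ℝ}
    (hDB : ∀ p ∈ square, ∀ x ∈ D, rot u w (η * (p.1 + p.2)) x ∈ B) {q : ℝ} (hq : 1 ≤ q)
    {m : ℝ≥0∞} (hm : ∀ x ∈ D,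
      4 * m ≤ ∫⁻ p in square, ENNReal.ofReal (h (rot u w (η * (p.1 + p.2)) x))) :
    m ^ q * volume D ≤ ∫⁻ x in B, ENNReal.ofReal (h x) ^ q := by
  have hq0 : 0 < q := by linarith
  have hrm : Measurable (fun z : EuclideanSpace ℝ (Fin d) × (ℝ × ℝ) =>
      rot u w (η * (z.2.1 + z.2.2)) z.1) := by
    have := (continuous_rot u w).comp
      (show Continuous (fun z : EuclideanSpace ℝ (Fin d) × (ℝ × ℝ) => (η * (z.2.1 + z.2.2), z.1)) by
        fun_prop)
    exact this.measurable
  have h1 : ∫⁻ x in D, ∫⁻ p in square, ENNReal.ofReal (h (rot u w (η * (p.1 + p.2)) x)) ^ q =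
      ∫⁻ p in square, ∫⁻ x in D, ENNReal.ofReal (h (rot u w (η * (p.1 + p.2)) x)) ^ q := by
    refine lintegral_lintegral_swap (Measurable.aemeasurable ?_)
    exact ((hh.comp hrm).ennreal_ofReal).pow_const _
  have h2 : ∫⁻ x in D, 4 * m ^ q ≤
      ∫⁻ x in D, ∫⁻ p in square, ENNReal.ofReal (h (rot u w (η * (p.1 + p.2)) x)) ^ q := by
    refine setLIntegral_mono' hD fun x hx => ?_
    refine rpow_mul_le_lintegral_square ?_ (fun p => h0 _) hq (hm x hx)
    exact (hh.comp hrm).comp (measurable_const.prodMk measurable_id)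
  have h3 : ∫⁻ p in square, ∫⁻ x in D, ENNReal.ofReal (h (rot u w (η * (p.1 + p.2)) x)) ^ q ≤
      ∫⁻ _ in square, ∫⁻ x in B, ENNReal.ofReal (h x) ^ q := by
    refine setLIntegral_mono' measurableSet_square fun p hp => ?_
    have hmp := measurePreserving_rot hu hw huw (η * (p.1 + p.2))
    rw [← hmp.setLIntegral_comp_preimage hB (hh.ennreal_ofReal.pow_const q)]
    exact lintegral_mono_set (fun x hx => hDB p hp x hx)
  rw [setLIntegral_const] at h2 h3
  rw [volume_square, mul_comm _ (4 : ℝ≥0∞)] at h3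
  have h4 := (h2.trans_eq h1).trans h3
  rw [mul_assoc] at h4
  exact (ENNReal.mul_le_mul_iff_right (by norm_num) (by norm_num)).mp h4

/-! ### Averages of the Fourier transform over a rotated box -/

/-- The real part of `exp(i⟨ξ, y⟩) μ̂(ξ)` is a lower bound for `|μ̂(ξ)|`. -/
theorem integral_mul_cos_le_norm_muHat {d : ℕ} {γ : ℝ → EuclideanSpace ℝ (Fin d)}
    (hγ : Continuous γ) {χ : ℝ → ℝ} (hχ : Continuous χ) (hc : HasCompactSupport χ)
    (ξ y : EuclideanSpace ℝ (Fin d)) :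
    ∫ t, χ t * Real.cos (inner ℝ ξ (γ t - y)) ≤ ‖muHat γ χ ξ‖ := by
  have hint : Integrable (fun t => Complex.exp (Complex.I * ((inner ℝ ξ y : ℝ) : ℂ)) *
      (Complex.exp (-Complex.I * ((inner ℝ ξ (γ t) : ℝ) : ℂ)) * (χ t : ℂ))) := by
    refine Continuous.integrable_of_hasCompactSupport (by fun_prop) ?_
    have : HasCompactSupport (fun t => (χ t : ℂ)) := hc.comp_left (g := fun x : ℝ => (x : ℂ)) (by simp)
    exact (this.mul_left).mul_left
  have h1 : ‖muHat γ χ ξ‖ = ‖Complex.exp (Complex.I * ((inner ℝ ξ y : ℝ) : ℂ)) * muHat γ χ ξ‖ := by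
    rw [norm_mul, mul_comm Complex.I, Complex.norm_exp_ofReal_mul_I, one_mul]
  rw [h1, muHat, ← integral_const_mul]
  refine le_trans (le_of_eq ?_) (Complex.re_le_norm _)
  have := Complex.reCLM.integral_comp_comm hint
  rw [Complex.reCLM_apply] at this
  rw [← this]
  congr 1
  ext t
  rw [Complex.reCLM_apply, ← mul_assoc, ← Complex.exp_add,
    show Complex.I * ((inner ℝ ξ y : ℝ) : ℂ) + -Complex.I * ((inner ℝ ξ (γ t) : ℝ) : ℂ) =
      ((-(inner ℝ ξ (γ t - y)) : ℝ) : ℂ) * Complex.I by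
        rw [inner_sub_right]; push_cast; ring,
    Complex.re_mul_ofReal, Complex.exp_ofReal_mul_I_re, Real.cos_neg, mul_comm]

/-- The box `lo_j ≤ ⟨f_j, x⟩ ≤ W_j` for `j ≠ m`, `1/2 ≤ ⟨f_m, x⟩ ≤ 3/4`. -/
def box {d : ℕ} (f : OrthonormalBasis (Fin d) ℝ (EuclideanSpace ℝ (Fin d))) (m : Fin d)
    (lo W : Fin d → ℝ) : Set (EuclideanSpace ℝ (Fin d)) :=
  {x | (∀ j, j ≠ m → lo j ≤ inner ℝ (f j) x ∧ inner ℝ (f j) x ≤ W j) ∧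
    1 / 2 ≤ inner ℝ (f m) x ∧ inner ℝ (f m) x ≤ 3 / 4}

theorem inner_eq_sum {d : ℕ} (f : OrthonormalBasis (Fin d) ℝ (EuclideanSpace ℝ (Fin d)))
    (x y : EuclideanSpace ℝ (Fin d)) :
    inner ℝ x y = ∑ j, inner ℝ (f j) x * inner ℝ (f j) y := by
  rw [← f.sum_inner_mul_inner x y]
  refine Finset.sum_congr rfl fun j _ => ?_
  rw [real_inner_comm]

theorem norm_sq_eq_sum {d : ℕ} (f : OrthonormalBasis (Fin d) ℝ (EuclideanSpace ℝ (Fin d)))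
    (x : EuclideanSpace ℝ (Fin d)) : ‖x‖ ^ 2 = ∑ j, (inner ℝ (f j) x) ^ 2 := by
  rw [← real_inner_self_eq_norm_sq, inner_eq_sum f]
  exact Finset.sum_congr rfl fun j _ => (sq _).symm

theorem half_le_norm_of_mem_box {d : ℕ} {f : OrthonormalBasis (Fin d) ℝ (EuclideanSpace ℝ (Fin d))}
    {m : Fin d} {lo W : Fin d → ℝ} {x : EuclideanSpace ℝ (Fin d)} (hx : x ∈ box f m lo W) :
    1 / 2 ≤ ‖x‖ := by
  have h := abs_real_inner_le_norm (f m) x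
  rw [f.norm_eq_one, one_mul] at h
  exact hx.2.1.trans ((le_abs_self _).trans h)

theorem norm_lt_one_of_mem_box {d : ℕ} {f : OrthonormalBasis (Fin d) ℝ (EuclideanSpace ℝ (Fin d))}
    {m : Fin d} {lo W : Fin d → ℝ} (hlo : ∀ j, j ≠ m → -W j ≤ lo j)
    (hW : ∀ j, j ≠ m → W j ≤ 1 / (4 * d)) {x : EuclideanSpace ℝ (Fin d)} (hx : x ∈ box f m lo W) :
    ‖x‖ < 1 := by
  have hd : (1 : ℝ) ≤ d := by exact_mod_cast (Nat.one_le_iff_ne_zero.mpr (by rintro rfl; exact m.elim0))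
  have h1 : ‖x‖ ^ 2 ≤ 9 / 16 + d * (1 / (4 * d)) ^ 2 := by
    rw [norm_sq_eq_sum f, ← Finset.add_sum_erase _ _ (Finset.mem_univ m)]
    have hs : ∑ j ∈ Finset.univ.erase m, (inner ℝ (f j) x) ^ 2 ≤
        ∑ j ∈ Finset.univ.erase m, (1 / (4 * (d : ℝ))) ^ 2 := by
      refine Finset.sum_le_sum fun j hj => ?_
      have hj' := Finset.ne_of_mem_erase hj
      obtain ⟨h1, h2⟩ := hx.1 j hj'
      exact sq_le_sq' (by linarith [hlo j hj', hW j hj']) (h2.trans (hW j hj'))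
    rw [Finset.sum_const, nsmul_eq_mul] at hs
    have hcard : ((Finset.univ.erase m).card : ℝ) ≤ d := by
      have := Finset.card_erase_le (s := (Finset.univ : Finset (Fin d))) (a := m)
      rw [Finset.card_univ, Fintype.card_fin] at this
      exact_mod_cast this
    have h3 := mul_le_mul_of_nonneg_right hcard (sq_nonneg (1 / (4 * (d : ℝ))))
    have h4 : (inner ℝ (f m) x) ^ 2 ≤ 9 / 16 := by
      nlinarith [hx.2.1, hx.2.2]
    linarith
  have h2 : (d : ℝ) * (1 / (4 * d)) ^ 2 ≤ 1 / 16 := by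
    have : (d : ℝ) * (1 / (4 * d)) ^ 2 = 1 / (16 * d) := by field_simp; norm_num
    rw [this]
    exact one_div_le_one_div_of_le (by norm_num) (by linarith)
  nlinarith [norm_nonneg x]

set_option maxHeartbeats 1600000 in
/-- The rotation average of `|μ̂(R x/|x|)|` over the plane `(f_z, f_m)` is `≳ 1/M` on a box adapted
to an orthonormal frame at `t₁`, on which the phase is `O(ε)` for `|t - t₁| ≤ L/M` up to its
dependence on the coordinate along `f_z`. -/
theorem exists_box_average_bound (d : ℕ) {c₀ C₀ : ℝ} (hc₀ : 0 < c₀) (hC₀ : 0 < C₀) :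
    ∃ L : ℝ, 1 ≤ L ∧ ∃ ε : ℝ, 0 < ε ∧ ∃ ν : ℝ, 0 < ν ∧ ∃ lam : ℝ, 0 < lam ∧
      ∀ (γ : ℝ → EuclideanSpace ℝ (Fin d)) (χ : ℝ → ℝ) (t₁ M R ρ : ℝ)
        (f : OrthonormalBasis (Fin d) ℝ (EuclideanSpace ℝ (Fin d))) (z m : Fin d)
        (lo W : Fin d → ℝ), Continuous γ → Continuous χ → HasCompactSupport χ →
        (∀ t, 0 ≤ χ t) → (∀ t, χ t ≤ 1) → 0 < M → 0 < R → z ≠ m → ρ ≤ 1 →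
        M / R ≤ ν → M / R ≤ ρ → C₀ * (M ^ 2 / R) * ρ ≤ 1 / 16 →
        (∀ t, |t - t₁| ≤ L / M → χ t = 1) → (∀ t, χ t ≠ 0 → |t - t₁| ≤ ρ) →
        (∀ t, |t - t₁| ≤ ρ → c₀ * |t - t₁| ≤ |inner ℝ (f z) (γ t - γ t₁)|) →
        (∀ t, |t - t₁| ≤ ρ → |inner ℝ (f z) (γ t - γ t₁)| ≤ C₀ * |t - t₁|) →
        (∀ t, |t - t₁| ≤ ρ → |inner ℝ (f m) (γ t - γ t₁)| ≤ C₀ * |t - t₁| ^ 2) →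
        (∀ j, j ≠ m → -W j ≤ lo j) → (∀ j, j ≠ m → W j ≤ 1 / (4 * d)) → W z ≤ ν * (M / R) →
        (∀ t, |t - t₁| ≤ L / M → ∀ j, j ≠ z → j ≠ m → R * (W j * |inner ℝ (f j) (γ t - γ t₁)|) ≤ ε) →
        (∀ t, |t - t₁| ≤ L / M → R * |inner ℝ (f m) (γ t - γ t₁)| ≤ ε) →
        ∀ x ∈ box f m lo W, 4 * ENNReal.ofReal (lam / M) ≤ ∫⁻ p in square,
          ENNReal.ofReal (radial γ χ R (rot (f z) (f m) (M / R * (p.1 + p.2)) x)) := by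
  obtain ⟨L, hL, ε, hε, lam, hlam, key⟩ :=
    exists_le_integral_mul_kernel (c₀ := c₀ / 4) (C₀ := 2 * C₀) (by positivity) (by positivity)
  have hd0 : (0 : ℝ) ≤ d := Nat.cast_nonneg d
  set ν : ℝ := min (min (1 / 4) (c₀ / (4 * C₀))) (ε / (32 * C₀ * L)) with hν
  have hL0 : 0 < L := by linarith
  have hν0 : 0 < ν := by positivity
  have hν1 : ν ≤ 1 / 4 := (min_le_left _ _).trans (min_le_left _ _)
  have hν2 : ν * C₀ ≤ c₀ / 4 := by
    have : ν ≤ c₀ / (4 * C₀) := (min_le_left _ _).trans (min_le_right _ _)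
    rw [le_div_iff₀ (by positivity)] at this
    linarith
  have hν3 : ν * (C₀ * L) ≤ ε / 32 := by
    have : ν ≤ ε / (32 * C₀ * L) := min_le_right _ _
    rw [le_div_iff₀ (by positivity)] at this
    linarith
  refine ⟨L, hL, ε / (8 * (d + 1)), by positivity, ν, hν0, lam / 4, by positivity, ?_⟩
  intro γ χ t₁ M R ρ f z m lo W hγ hχ hc hχ0 hχ1 hM hR hzm hρ1 hη1 hηρ hMR hχL hχρ hP1 hP2 hP3 hlo
    hW hWz hn1 hn2 x hx
  set η := M / R with hη
  have hη0 : 0 < η := by positivity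
  have hRη : R * η = M := by rw [hη]; field_simp
  have hηM : M ^ 2 / R = η * M := by rw [hη]; ring
  rw [hηM] at hMR
  have hxn1 := (norm_lt_one_of_mem_box hlo hW hx).le
  have hxn2 := half_le_norm_of_mem_box hx
  obtain ⟨hx1, hx2, hx3⟩ := hx
  set a := inner ℝ (f z) x with ha
  set b := inner ℝ (f m) x with hb
  have haz : |a| ≤ ν * η := by
    obtain ⟨h1, h2⟩ := hx1 z hzm
    exact abs_le.mpr ⟨by linarith [hlo z hzm], h2.trans hWz⟩
  have hη4 : η ≤ 1 / 4 := hη1.trans hν1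
  have haη : |a| ≤ η := haz.trans (by nlinarith)
  have ha4 : |a| ≤ ν := haz.trans (by nlinarith)
  have hxpos : 0 < ‖x‖ := by linarith
  set r := R * ‖x‖⁻¹ with hr
  have hinv1 : 1 ≤ ‖x‖⁻¹ := (one_le_inv₀ hxpos).mpr hxn1
  have hinv2 : ‖x‖⁻¹ ≤ 2 := by
    rw [inv_le_comm₀ hxpos two_pos]; linarith
  have hrR : R ≤ r := by rw [hr]; nlinarith
  have hr2 : r ≤ 2 * R := by rw [hr]; nlinarith
  have hr0 : 0 < r := by linarith
  -- After rotating `x` by `θ`, the phase at `t` is `Q t + A t cos θ + B t sin θ`.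
  set P : Fin d → ℝ → ℝ := fun j t => inner ℝ (f j) (γ t - γ t₁) with hP
  set Q : ℝ → ℝ := fun t => r * (inner ℝ x (γ t - γ t₁) - a * P z t - b * P m t) with hQ
  set A : ℝ → ℝ := fun t => r * (a * P z t + b * P m t) with hA
  set B : ℝ → ℝ := fun t => r * (b * P z t - a * P m t) with hB
  have hPc : ∀ j, Continuous (P j) := fun j => by simp only [hP]; fun_prop
  have hQc : Continuous Q := by
    have := hPc z; have := hPc m
    simp only [hQ]; fun_prop
  have hAc : Continuous A := by
    have := hPc z; have := hPc m
    simp only [hA]; fun_prop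
  have hBc : Continuous B := by
    have := hPc z; have := hPc m
    simp only [hB]; fun_prop
  have hχi := hχ.integrable_of_hasCompactSupport hc (μ := volume)
  have hPm : ∀ t, |t - t₁| ≤ ρ → |P m t| ≤ C₀ * |t - t₁| := by
    intro t ht
    refine (hP3 t ht).trans ?_
    have h0 := abs_nonneg (t - t₁)
    have : |t - t₁| ^ 2 ≤ |t - t₁| := by nlinarith
    gcongr
  have hBup : ∀ t, |t - t₁| ≤ ρ → |η * B t| ≤ 2 * C₀ * M * |t - t₁| := by
    intro t ht
    have h1 : |b * P z t - a * P m t| ≤ C₀ * |t - t₁| := by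
      refine (abs_sub _ _).trans ?_
      rw [abs_mul, abs_mul, abs_of_nonneg (show 0 ≤ b by linarith)]
      have i1 := mul_le_mul hx3 (hP2 t ht) (abs_nonneg _) (by norm_num)
      have i2 := mul_le_mul (haη.trans hη4) (hPm t ht) (abs_nonneg _) (by norm_num)
      linarith
    simp only [hB]
    rw [abs_mul, abs_mul, abs_of_pos hη0, abs_of_pos hr0]
    calc η * (r * |b * P z t - a * P m t|) ≤ η * (2 * R * (C₀ * |t - t₁|)) := by gcongr
      _ = 2 * C₀ * (R * η) * |t - t₁| := by ring
      _ = _ := by rw [hRη]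
  have hBlow : ∀ t, |t - t₁| ≤ ρ → c₀ / 4 * M * |t - t₁| ≤ |η * B t| := by
    intro t ht
    have h1 : c₀ / 4 * |t - t₁| ≤ |b * P z t - a * P m t| := by
      have := abs_sub_abs_le_abs_sub (b * P z t) (a * P m t)
      rw [abs_mul, abs_mul, abs_of_nonneg (show 0 ≤ b by linarith)] at this
      have i1 := mul_le_mul hx2 (hP1 t ht) (by positivity) (by linarith)
      have i2 := mul_le_mul ha4 (hPm t ht) (abs_nonneg _) hν0.le
      have i3 := mul_le_mul_of_nonneg_right hν2 (abs_nonneg (t - t₁))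
      simp only [hP] at this i1 i2 ⊢
      linarith
    simp only [hB]
    rw [abs_mul, abs_mul, abs_of_pos hη0, abs_of_pos hr0]
    calc c₀ / 4 * M * |t - t₁| = η * (R * (c₀ / 4 * |t - t₁|)) := by rw [← hRη]; ring
      _ ≤ _ := by gcongr
  have hmain := key χ t₁ M η Q A B hχi hχ0 hχ1 hM hη0.le hχL
    (fun t ht => ⟨hBlow t (hχρ t ht), hBup t (hχρ t ht)⟩) ?_ ?_
    (integrable_mul_kernel hχi hχ hQc hAc hBc η)
  · rw [integral_mul_kernel hχi hχ hQc hAc hBc] at hmain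
    have hrm : Measurable (fun p : ℝ × ℝ => rot (f z) (f m) (η * (p.1 + p.2)) x) :=
      ((continuous_rot (f z) (f m)).comp
        (show Continuous (fun p : ℝ × ℝ => (η * (p.1 + p.2), x)) by fun_prop)).measurable
    have hmeas := (measurable_radial hγ hχ hc R).comp hrm
    have hfin : IsFiniteMeasure (volume.restrict square) :=
      isFiniteMeasure_restrict.mpr isCompact_square.measure_ne_top
    have hint : Integrable (fun p : ℝ × ℝ => radial γ χ R (rot (f z) (f m) (η * (p.1 + p.2)) x))
        (volume.restrict square) := by
      refine Integrable.of_bound hmeas.aestronglyMeasurable (∫ t, ‖χ t‖)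
        (Filter.Eventually.of_forall fun p => ?_)
      rw [Real.norm_of_nonneg (radial_nonneg _ _ _ _)]
      exact norm_muHat_le _ _ _
    rw [← ofReal_integral_eq_lintegral_ofReal hint
      (Filter.Eventually.of_forall fun p => radial_nonneg _ _ _ _),
      show (4 : ℝ≥0∞) = ENNReal.ofReal 4 by norm_num, ← ENNReal.ofReal_mul (by norm_num)]
    refine ENNReal.ofReal_le_ofReal ?_
    rw [show 4 * (lam / 4 / M) = lam / M by ring]
    refine hmain.trans ?_
    have hint2 := (integrable_cutoff_prod hχi hχ hQc hAc hBc η).integral_prod_right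
    refine setIntegral_mono_on ?_ hint measurableSet_square ?_
    · refine hint2.congr (Filter.Eventually.of_forall fun p => ?_)
      simp only
      rw [← integral_const_mul]
      congr 1
      ext t
      ring
    · rintro ⟨τ, τ'⟩ ⟨hτ, hτ'⟩
      simp only at hτ hτ' ⊢
      have hcos : ∫ t, χ t * Real.cos (Q t + A t * Real.cos (η * (τ + τ')) +
          B t * Real.sin (η * (τ + τ'))) ≤
          radial γ χ R (rot (f z) (f m) (η * (τ + τ')) x) := by
        unfold radial
        rw [norm_rot (f.norm_eq_one z) (f.norm_eq_one m)
          (f.inner_eq_zero hzm)]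
        refine le_trans (le_of_eq ?_) (integral_mul_cos_le_norm_muHat hγ hχ hc _ (γ t₁))
        congr 1
        ext t
        congr 2
        rw [smul_smul, inner_smul_left, conj_trivial, real_inner_comm, inner_rot]
        simp only [hQ, hA, hB, hP, ← hr, ← ha, ← hb]
        rw [real_inner_comm x, real_inner_comm (f z), real_inner_comm (f m)]
        ring
      have hb1 : bump τ * bump τ' ≤ 1 :=
        mul_le_one₀ (bump_le_one hτ) (bump_nonneg _) (bump_le_one hτ')
      have hb0 : 0 ≤ bump τ * bump τ' := mul_nonneg (bump_nonneg _) (bump_nonneg _)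
      have hr00 := radial_nonneg γ χ R (rot (f z) (f m) (η * (τ + τ')) x)
      exact (mul_le_mul_of_nonneg_left hcos hb0).trans (mul_le_of_le_one_left hr00 hb1)
  · intro t ht
    have ht := hχρ t ht
    have h0 := abs_nonneg (t - t₁)
    have hρ0 : 0 ≤ ρ := h0.trans ht
    have hηA : 0 ≤ C₀ * (η * M) * ρ := by positivity
    constructor
    · have h1 : |a * P z t + b * P m t| ≤ 2 * C₀ * ρ ^ 2 := by
        refine (abs_add_le _ _).trans ?_
        rw [abs_mul, abs_mul, abs_of_nonneg (show 0 ≤ b by linarith)]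
        have i1 := mul_le_mul (haη.trans hηρ) ((hP2 t ht).trans
          (mul_le_mul_of_nonneg_left ht hC₀.le)) (abs_nonneg _) hρ0
        have i2 := mul_le_mul (hx3.trans (by norm_num : (3 / 4 : ℝ) ≤ 1)) ((hP3 t ht).trans
          (mul_le_mul_of_nonneg_left (pow_le_pow_left₀ h0 ht 2) hC₀.le)) (abs_nonneg _) zero_le_one
        simp only [hP] at i1 i2 ⊢
        linarith
      simp only [hA]
      rw [abs_mul, abs_of_pos hr0]
      calc η ^ 2 * (r * |a * P z t + b * P m t|) ≤ η ^ 2 * (2 * R * (2 * C₀ * ρ ^ 2)) := by gcongr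
        _ = 4 * (C₀ * (η * (R * η)) * ρ) * ρ := by ring
        _ = 4 * (C₀ * (η * M) * ρ) * ρ := by rw [hRη]
        _ ≤ 1 / 4 := by nlinarith
    · have h1 := hBup t ht
      rw [abs_mul, abs_of_pos hη0] at h1
      calc η ^ 2 * |B t| = η * (η * |B t|) := by ring
        _ ≤ η * (2 * C₀ * M * ρ) :=
            mul_le_mul_of_nonneg_left (h1.trans (by gcongr)) hη0.le
        _ = 2 * (C₀ * (η * M) * ρ) := by ring
        _ ≤ 1 / 4 := by linarith
  · intro t ht
    have htρ : |t - t₁| ≤ ρ := hχρ t (by rw [hχL t ht]; exact one_ne_zero)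
    have hts : M * |t - t₁| ≤ L := by rw [le_div_iff₀ hM] at ht; linarith
    have h0 := abs_nonneg (t - t₁)
    have hd1 : (d : ℝ) * (ε / (8 * (d + 1))) ≤ ε / 8 := by
      rw [mul_div_assoc', div_le_div_iff₀ (by positivity) (by norm_num)]
      nlinarith
    have hd2 : ε / (8 * ((d : ℝ) + 1)) ≤ ε / 8 := by
      gcongr; linarith
    have hQb : |Q t| ≤ 2 * (d * (ε / (8 * (d + 1)))) := by
      simp only [hQ]
      have e : inner ℝ x (γ t - γ t₁) - a * P z t - b * P m t =
          ∑ j ∈ (Finset.univ.erase z).erase m, inner ℝ (f j) x * P j t := by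
        rw [inner_eq_sum f, ← Finset.add_sum_erase _ _ (Finset.mem_univ z),
          ← Finset.add_sum_erase _ _ (Finset.mem_erase.mpr ⟨hzm.symm, Finset.mem_univ m⟩)]
        simp only [hP]
        ring
      rw [e, abs_mul, abs_of_pos hr0]
      have h1 : R * |∑ j ∈ (Finset.univ.erase z).erase m, inner ℝ (f j) x * P j t| ≤
          d * (ε / (8 * (d + 1))) := by
        refine (mul_le_mul_of_nonneg_left (Finset.abs_sum_le_sum_abs _ _) hR.le).trans ?_
        rw [Finset.mul_sum]
        refine (Finset.sum_le_card_nsmul _ _ (ε / (8 * (d + 1))) ?_).trans ?_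
        · intro j hj
          have hjm := Finset.ne_of_mem_erase hj
          have hjz := Finset.ne_of_mem_erase (Finset.mem_of_mem_erase hj)
          refine le_trans ?_ (hn1 t ht j hjz hjm)
          rw [abs_mul]
          have : |inner ℝ (f j) x| ≤ W j := by
            obtain ⟨h1, h2⟩ := hx1 j hjm
            exact abs_le.mpr ⟨by linarith [hlo j hjm], h2⟩
          gcongr
        · rw [nsmul_eq_mul]
          refine mul_le_mul_of_nonneg_right ?_ (by positivity)
          have : ((Finset.univ.erase z).erase m).card ≤ (Finset.univ : Finset (Fin d)).card :=
            Finset.card_le_card ((Finset.erase_subset _ _).trans (Finset.erase_subset _ _))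
          rw [Finset.card_univ, Fintype.card_fin] at this
          exact_mod_cast this
      calc r * |∑ j ∈ (Finset.univ.erase z).erase m, inner ℝ (f j) x * P j t|
          ≤ 2 * R * |∑ j ∈ (Finset.univ.erase z).erase m, inner ℝ (f j) x * P j t| := by gcongr
        _ ≤ _ := by linarith
    have hAb : |A t| ≤ 2 * (ν * (C₀ * L)) + 2 * (ε / (8 * (d + 1))) := by
      simp only [hA]
      rw [abs_mul, abs_of_pos hr0]
      have h1 : |a * P z t + b * P m t| ≤ ν * η * (C₀ * |t - t₁|) + |P m t| := by
        refine (abs_add_le _ _).trans ?_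
        rw [abs_mul, abs_mul, abs_of_nonneg (show 0 ≤ b by linarith)]
        have i1 := mul_le_mul haz (hP2 t htρ) (abs_nonneg _) (by positivity)
        have i2 := mul_le_of_le_one_left (abs_nonneg (P m t)) (by linarith : b ≤ 1)
        simp only [hP] at i1 i2 ⊢
        linarith
      have h2 := hn2 t ht
      have h3 : ν * (C₀ * (M * |t - t₁|)) ≤ ν * (C₀ * L) := by gcongr
      calc r * |a * P z t + b * P m t| ≤ 2 * R * (ν * η * (C₀ * |t - t₁|) + |P m t|) := by gcongr
        _ = 2 * (ν * (C₀ * ((R * η) * |t - t₁|))) + 2 * (R * |P m t|) := by ring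
        _ = 2 * (ν * (C₀ * (M * |t - t₁|))) + 2 * (R * |P m t|) := by rw [hRη]
        _ ≤ _ := by simp only [hP] at h2 ⊢; linarith
    have hBb : 2 * η ^ 3 * |B t| ≤ 4 * (ν * (C₀ * L)) := by
      have h1 := hBup t htρ
      rw [abs_mul, abs_of_pos hη0] at h1
      have h2 : η * |B t| ≤ 2 * (C₀ * L) := by
        refine h1.trans ?_
        have := mul_le_mul_of_nonneg_left hts hC₀.le
        linarith
      have h3 : η ^ 2 ≤ ν := by nlinarith
      calc 2 * η ^ 3 * |B t| = 2 * η ^ 2 * (η * |B t|) := by ring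
        _ ≤ 2 * ν * (2 * (C₀ * L)) := by gcongr
        _ = _ := by ring
    linarith

/-! ### Curves with adapted orthonormal frames -/

/-- An orthonormal basis triangular with respect to `γ'(t₁), …, γ^{(K)}(t₁)`, with diagonal entries
at least `c₀`. The basis vector with index `j` corresponds to the derivative of order `j + 1`. -/
structure IsFrame {d : ℕ} (γ : ℝ → EuclideanSpace ℝ (Fin d)) (K : ℕ) (c₀ t₁ : ℝ)
    (f : OrthonormalBasis (Fin d) ℝ (EuclideanSpace ℝ (Fin d))) : Prop where
  inner_eq_zero : ∀ (j : Fin d) (i : ℕ), 1 ≤ i → i ≤ K → i ≤ j →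
    inner ℝ (f j) (iteratedDeriv i γ t₁) = 0
  le_inner : ∀ j : Fin d, (j : ℕ) + 1 ≤ K → c₀ ≤ inner ℝ (f j) (iteratedDeriv (j + 1) γ t₁)

/-- A smooth curve with bounded derivatives of order up to `K + 1` and uniformly nondegenerate
adapted frames on `|t - tc| ≤ κ₀`. -/
structure IsNondegenerate {d : ℕ} (γ : ℝ → EuclideanSpace ℝ (Fin d)) (K : ℕ) (c₀ C₀ tc κ₀ : ℝ) :
    Prop where
  contDiff : ContDiff ℝ ∞ γ
  norm_le : ∀ t, |t - tc| ≤ κ₀ → ∀ i, i ≤ K + 1 → ‖iteratedDeriv i γ t‖ ≤ C₀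
  exists_frame : ∀ t, |t - tc| ≤ κ₀ → ∃ f, IsFrame γ K c₀ t f

/-- Taylor's bound for a chain of derivatives vanishing at `t₁` below order `n`. -/
theorem abs_le_of_derivs_eq_zero {ρ C t₁ : ℝ} (n : ℕ) (g : ℕ → ℝ → ℝ)
    (hg : ∀ i t, HasDerivAt (g i) (g (i + 1) t) t) (h0 : ∀ i, i < n → g i t₁ = 0)
    (hn : ∀ t, |t - t₁| ≤ ρ → |g n t| ≤ C) : ∀ t, |t - t₁| ≤ ρ → |g 0 t| ≤ C * |t - t₁| ^ n := by
  induction n generalizing g with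
  | zero => intro t ht; simpa using hn t ht
  | succ n ih =>
    intro t ht
    have h1 := ih (fun i => g (i + 1)) (fun i t => hg (i + 1) t) (fun i hi => h0 (i + 1) (by omega)) hn
    have hC : 0 ≤ C := (abs_nonneg _).trans (hn t ht)
    have hmv := (convex_uIcc t₁ t).norm_image_sub_le_of_norm_hasDerivWithin_le (f := g 0)
      (f' := g 1) (C := C * |t - t₁| ^ n) (fun x _ => (hg 0 x).hasDerivWithinAt) ?_
      left_mem_uIcc right_mem_uIcc
    · rw [h0 0 (by omega), sub_zero, Real.norm_eq_abs, Real.norm_eq_abs] at hmv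
      rw [pow_succ, ← mul_assoc]
      exact hmv
    · intro x hx
      have hx' : |x - t₁| ≤ |t - t₁| := by
        have := abs_sub_left_of_mem_uIcc hx
        exact this
      refine (h1 x (hx'.trans ht)).trans ?_
      gcongr

theorem hasDerivAt_iteratedDeriv {d : ℕ} {γ : ℝ → EuclideanSpace ℝ (Fin d)} (hγ : ContDiff ℝ ∞ γ)
    (i : ℕ) (t : ℝ) : HasDerivAt (iteratedDeriv i γ) (iteratedDeriv (i + 1) γ t) t := by
  rw [iteratedDeriv_succ]
  refine DifferentiableAt.hasDerivAt ?_
  exact (hγ.differentiable_iteratedDeriv i (by exact_mod_cast WithTop.coe_lt_top _)) t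

theorem hasDerivAt_inner_iteratedDeriv {d : ℕ} {γ : ℝ → EuclideanSpace ℝ (Fin d)}
    (hγ : ContDiff ℝ ∞ γ) (x : EuclideanSpace ℝ (Fin d)) (i : ℕ) (t : ℝ) :
    HasDerivAt (fun t => inner ℝ x (iteratedDeriv i γ t)) (inner ℝ x (iteratedDeriv (i + 1) γ t)) t := by
  have := (hasDerivAt_const t x).inner ℝ (hasDerivAt_iteratedDeriv hγ i t)
  simpa using this

section Frame

variable {d K : ℕ} {γ : ℝ → EuclideanSpace ℝ (Fin d)} {c₀ C₀ tc κ₀ t₁ ρ : ℝ}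
  {f : OrthonormalBasis (Fin d) ℝ (EuclideanSpace ℝ (Fin d))}

/-- Along `f_j` the curve leaves `γ(t₁)` to order `j + 1`. -/
theorem IsNondegenerate.abs_inner_sub_le (h : IsNondegenerate γ K c₀ C₀ tc κ₀)
    (hf : IsFrame γ K c₀ t₁ f) (hρ : |t₁ - tc| + ρ ≤ κ₀) (j : Fin d) {n : ℕ} (hn1 : 1 ≤ n)
    (hnj : n ≤ j + 1) (hnK : n ≤ K + 1) {t : ℝ} (ht : |t - t₁| ≤ ρ) :
    |inner ℝ (f j) (γ t - γ t₁)| ≤ C₀ * |t - t₁| ^ n := by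
  have key := abs_le_of_derivs_eq_zero (ρ := ρ) (C := C₀) (t₁ := t₁) n
    (fun i t => inner ℝ (f j) (iteratedDeriv i γ t - if i = 0 then γ t₁ else 0)) ?_ ?_ ?_ t ht
  · simpa using key
  · intro i t
    have h1 := hasDerivAt_inner_iteratedDeriv h.contDiff (f j) i t
    simp only [inner_sub_right, Nat.add_eq_zero_iff, one_ne_zero, and_false, if_false, sub_zero]
    exact h1.sub_const _
  · intro i hi
    rcases Nat.eq_zero_or_pos i with rfl | hi0
    · simp
    · simp only [hi0.ne', if_false, sub_zero]
      exact hf.inner_eq_zero j i hi0 (by omega) (by omega)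
  · intro t ht
    have hn0 : n ≠ 0 := by omega
    simp only [hn0, if_false, sub_zero]
    refine (abs_real_inner_le_norm _ _).trans ?_
    rw [f.norm_eq_one, one_mul]
    refine h.norm_le t ?_ n hnK
    have := abs_sub_le t t₁ tc
    linarith

theorem IsNondegenerate.norm_iteratedDeriv_sub_le (h : IsNondegenerate γ K c₀ C₀ tc κ₀) {i : ℕ}
    (hi : i ≤ K) {t t' : ℝ} (ht : |t - tc| ≤ κ₀) (ht' : |t' - tc| ≤ κ₀) :
    ‖iteratedDeriv i γ t - iteratedDeriv i γ t'‖ ≤ C₀ * |t - t'| := by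
  have hmv := (convex_Icc (tc - κ₀) (tc + κ₀)).norm_image_sub_le_of_norm_hasDerivWithin_le
    (f := iteratedDeriv i γ) (f' := iteratedDeriv (i + 1) γ) (C := C₀)
    (fun x _ => (hasDerivAt_iteratedDeriv h.contDiff i x).hasDerivWithinAt)
    (fun x hx => h.norm_le x (by rw [abs_le]; constructor <;> linarith [hx.1, hx.2]) _ (by omega))
    (x := t') (y := t)
    (by rw [abs_le] at ht'; constructor <;> linarith [ht'.1, ht'.2])
    (by rw [abs_le] at ht; constructor <;> linarith [ht.1, ht.2])
  simpa using hmv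

/-- Along the first frame vector the curve leaves `γ(t₁)` with speed at least `c₀/2`. -/
theorem IsNondegenerate.le_abs_inner_sub (h : IsNondegenerate γ K c₀ C₀ tc κ₀)
    (hf : IsFrame γ K c₀ t₁ f) (hK : 1 ≤ K) (hρ : |t₁ - tc| + ρ ≤ κ₀) (hρc : C₀ * ρ ≤ c₀ / 2)
    (hC₀ : 0 ≤ C₀) {z : Fin d} (hz : (z : ℕ) = 0) {t : ℝ} (ht : |t - t₁| ≤ ρ) :
    c₀ / 2 * |t - t₁| ≤ |inner ℝ (f z) (γ t - γ t₁)| := by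
  have hmem : ∀ x ∈ uIcc t₁ t, |x - t₁| ≤ ρ := fun x hx => (abs_sub_left_of_mem_uIcc hx).trans ht
  have hder : ∀ x, HasDerivAt (fun t => inner ℝ (f z) (γ t)) (inner ℝ (f z) (iteratedDeriv 1 γ x)) x := by
    intro x
    have := hasDerivAt_inner_iteratedDeriv h.contDiff (f z) 0 x
    simpa using this
  have hlow : ∀ x ∈ uIcc t₁ t, c₀ / 2 ≤ inner ℝ (f z) (iteratedDeriv 1 γ x) := by
    intro x hx
    have h1 := hf.le_inner z (by omega)
    rw [hz, zero_add] at h1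
    have hx1 := hmem x hx
    have h2 := h.norm_iteratedDeriv_sub_le hK (t := x) (t' := t₁)
      (by have := abs_sub_le x t₁ tc; linarith) (by linarith [abs_nonneg (x - t₁)])
    have h3 := abs_real_inner_le_norm (f z) (iteratedDeriv 1 γ x - iteratedDeriv 1 γ t₁)
    rw [f.norm_eq_one, one_mul, inner_sub_right] at h3
    have h4 := (abs_le.mp (h3.trans h2)).1
    have h5 : C₀ * |x - t₁| ≤ C₀ * ρ := by gcongr
    linarith
  have hmv : ∀ x ∈ uIcc t₁ t, ∀ y ∈ uIcc t₁ t, x ≤ y →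
      c₀ / 2 * (y - x) ≤ inner ℝ (f z) (γ y) - inner ℝ (f z) (γ x) := by
    refine (convex_uIcc t₁ t).mul_sub_le_image_sub_of_le_deriv
      (fun x _ => (hder x).continuousAt.continuousWithinAt)
      (fun x _ => (hder x).differentiableAt.differentiableWithinAt) ?_
    intro x hx
    rw [(hder x).deriv]
    exact hlow x (interior_subset hx)
  rw [inner_sub_right]
  rcases le_total t₁ t with hle | hle
  · rw [abs_of_nonneg (sub_nonneg.mpr hle)]
    exact (hmv t₁ left_mem_uIcc t right_mem_uIcc hle).trans (le_abs_self _)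
  · rw [abs_of_nonpos (sub_nonpos.mpr hle), abs_sub_comm, neg_sub]
    exact (hmv t right_mem_uIcc t₁ left_mem_uIcc hle).trans (le_abs_self _)

end Frame

/-! ### The boxes -/

/-- Upper ends of the box at scale `M` for order `k`: `ν M^{j+1}/R` below the order `k`, `2δ` at the
order `k`, and `ν` above. Below the order `k` this makes the contribution of the `j`-th coordinate to
the phase `O(ν)` for `|t - t₁| ≲ 1/M`. -/
def width (k : ℕ) (ν δ M R : ℝ) {d : ℕ} (j : Fin d) : ℝ :=
  if (j : ℕ) + 1 < k then ν * (M ^ ((j : ℕ) + 1) / R) else if (j : ℕ) + 1 = k then 2 * δ else ν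

/-- Lower ends of the box: symmetric intervals, except `[δ, 2δ]` at the order `k`. -/
def lower (k : ℕ) (ν δ M R : ℝ) {d : ℕ} (j : Fin d) : ℝ :=
  if (j : ℕ) + 1 = k then δ else -width k ν δ M R j

theorem neg_width_le_lower {k d : ℕ} {ν δ M R : ℝ} (hδ : 0 ≤ δ) (j : Fin d) :
    -width k ν δ M R j ≤ lower k ν δ M R j := by
  unfold lower
  split_ifs with h
  · unfold width
    rw [if_neg (by omega), if_pos h]; linarith
  · exact le_rfl

theorem measurableSet_box {d : ℕ} (f : OrthonormalBasis (Fin d) ℝ (EuclideanSpace ℝ (Fin d)))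
    (m : Fin d) (lo W : Fin d → ℝ) : MeasurableSet (box f m lo W) := by
  refine IsClosed.measurableSet ?_
  have hc : ∀ j, Continuous (fun x => inner ℝ (f j) x) := fun j => by fun_prop
  have e : box f m lo W = (⋂ j, {x | j ≠ m → lo j ≤ inner ℝ (f j) x ∧ inner ℝ (f j) x ≤ W j}) ∩
      ({x | 1 / 2 ≤ inner ℝ (f m) x} ∩ {x | inner ℝ (f m) x ≤ 3 / 4}) := by
    ext x; simp [box]
  rw [e]
  refine (isClosed_iInter fun j => ?_).inter
    ((isClosed_le continuous_const (hc _)).inter (isClosed_le (hc _) continuous_const))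
  by_cases hj : j = m
  · simp [hj]
  · simp only [ne_eq, hj, not_false_eq_true, true_implies]
    exact (isClosed_le continuous_const (hc _)).inter (isClosed_le (hc _) continuous_const)

theorem volume_box {d : ℕ} (f : OrthonormalBasis (Fin d) ℝ (EuclideanSpace ℝ (Fin d)))
    (m : Fin d) (lo W : Fin d → ℝ) : volume (box f m lo W) =
      ∏ j, ENNReal.ofReal (if j = m then 1 / 4 else W j - lo j) := by
  have h1 : box f m lo W = f.repr ⁻¹' ((WithLp.ofLp : EuclideanSpace ℝ (Fin d) → (Fin d → ℝ)) ⁻¹'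
      (Set.pi univ fun j => Icc (if j = m then 1 / 2 else lo j) (if j = m then 3 / 4 else W j))) := by
    ext x
    simp only [box, mem_preimage, Set.mem_pi, mem_univ, true_implies, mem_Icc,
      OrthonormalBasis.repr_apply_apply]
    constructor
    · rintro ⟨h1, h2⟩ j
      by_cases hj : j = m
      · subst hj; simpa using h2
      · simpa [hj] using h1 j hj
    · intro h
      refine ⟨fun j hj => by simpa [hj] using h j, by simpa using h m⟩
  have hms : MeasurableSet (Set.pi univ fun j : Fin d =>
      Icc (if j = m then 1 / 2 else lo j) (if j = m then 3 / 4 else W j)) :=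
    MeasurableSet.univ_pi fun j => measurableSet_Icc
  rw [h1, f.measurePreserving_repr.measure_preimage
    ((PiLp.volume_preserving_ofLp (Fin d)).measurable hms).nullMeasurableSet,
    (PiLp.volume_preserving_ofLp (Fin d)).measure_preimage hms.nullMeasurableSet, volume_pi,
    Measure.pi_pi]
  refine Finset.prod_congr rfl fun j _ => ?_
  rw [Real.volume_Icc]
  congr 1
  split_ifs
  · norm_num
  · rfl

/-- The powers of `M` add up to `1 + ⋯ + (k - 1) = k(k - 1)/2`. -/
theorem prod_widths {d k : ℕ} (hk : 1 ≤ k) (hkd : k ≤ d) (δ M R : ℝ) :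
    ∏ j : Fin d, (if (j : ℕ) + 1 < k then M ^ ((j : ℕ) + 1) / R else
      if (j : ℕ) + 1 = k then δ else 1) = δ * (M ^ (k * (k - 1) / 2) / R ^ (k - 1)) := by
  rw [Fin.prod_univ_eq_prod_range (fun j => if j + 1 < k then M ^ (j + 1) / R else
      if j + 1 = k then δ else 1) d]
  obtain ⟨k, rfl⟩ : ∃ l, k = l + 1 := ⟨k - 1, by omega⟩
  rw [← Finset.prod_range_mul_prod_Ico _ hkd, Finset.prod_range_succ]
  have h1 : ∏ j ∈ Finset.Ico (k + 1) d, (if j + 1 < k + 1 then M ^ (j + 1) / R else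
      if j + 1 = k + 1 then δ else 1) = 1 := by
    refine Finset.prod_eq_one fun j hj => ?_
    have := (Finset.mem_Ico.mp hj).1
    rw [if_neg (by omega), if_neg (by omega)]
  have h2 : ∏ j ∈ Finset.range k, (if j + 1 < k + 1 then M ^ (j + 1) / R else
      if j + 1 = k + 1 then δ else 1) = ∏ j ∈ Finset.range k, M ^ (j + 1) / R := by
    refine Finset.prod_congr rfl fun j hj => ?_
    have := Finset.mem_range.mp hj
    rw [if_pos (by omega)]
  have h3 : ∏ j ∈ Finset.range k, M ^ (j + 1) / R = M ^ ((k + 1) * k / 2) / R ^ k := by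
    rw [Finset.prod_div_distrib, Finset.prod_const, Finset.card_range, Finset.prod_pow_eq_pow_sum]
    congr 2
    rw [← Finset.sum_range_succ' (fun j => j) k |>.trans (add_zero _), Finset.sum_range_id]
    simp
  rw [h1, h2, h3]
  simp
  ring

/-- The volume of the box at scale `M`, up to a constant. -/
theorem le_volume_box {d k : ℕ} (hk : 1 ≤ k) (hkd : k ≤ d) {ν δ M R : ℝ} (hν : 0 < ν)
    (hδ : 0 < δ) (hM : 0 < M) (hR : 0 < R) {m : Fin d} (hm : (m : ℕ) + 1 = k → δ = 1) (hm' : k ≤ (m : ℕ) + 1)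
    (f : OrthonormalBasis (Fin d) ℝ (EuclideanSpace ℝ (Fin d))) :
    ENNReal.ofReal (min ν (1 / 4) ^ d * (δ * (M ^ (k * (k - 1) / 2) / R ^ (k - 1)))) ≤
      volume (box f m (lower k ν δ M R) (width k ν δ M R)) := by
  set c := min ν (1 / 4) with hc
  have hc0 : 0 < c := lt_min hν (by norm_num)
  have hcν : c ≤ ν := min_le_left _ _
  have hc4 : c ≤ 1 / 4 := min_le_right _ _
  have h0 : ∀ j : Fin d, 0 ≤ c * (if (j : ℕ) + 1 < k then M ^ ((j : ℕ) + 1) / R else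
      if (j : ℕ) + 1 = k then δ else 1) := by
    intro j
    refine mul_nonneg hc0.le ?_
    split_ifs <;> positivity
  have hcd : c ^ d = ∏ _j : Fin d, c := by simp
  rw [volume_box, ← prod_widths hk hkd, hcd, ← Finset.prod_mul_distrib]
  rw [ENNReal.ofReal_prod_of_nonneg fun j _ => h0 j]
  refine Finset.prod_le_prod' fun j _ => ENNReal.ofReal_le_ofReal ?_
  by_cases hj : j = m
  · subst hj
    rw [if_pos rfl, if_neg (by omega)]
    split_ifs with h
    · rw [hm h]; linarith
    · linarith
  · rw [if_neg hj]
    unfold lower width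
    by_cases h1 : (j : ℕ) + 1 < k
    · rw [if_pos h1, if_pos h1, if_neg (by omega)]
      have : 0 < M ^ ((j : ℕ) + 1) / R := by positivity
      nlinarith
    · rw [if_neg h1, if_neg h1]
      by_cases h2 : (j : ℕ) + 1 = k
      · rw [if_pos h2, if_pos h2, if_pos h2]
        nlinarith
      · rw [if_neg h2, if_neg h2, if_neg h2]
        linarith

/-- A slab containing all rotates, by angles at most `2M/R` in the plane `(f_z, f_m)`, of the box with
ends `lower` and `width`. -/
def slab {d : ℕ} (f : OrthonormalBasis (Fin d) ℝ (EuclideanSpace ℝ (Fin d))) (z m : Fin d) (k : ℕ)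
    (ν δ M R : ℝ) : Set (EuclideanSpace ℝ (Fin d)) :=
  {x | ‖x‖ < 1 ∧ 1 / 4 ≤ inner ℝ (f m) x ∧ |inner ℝ (f z) x| ≤ 3 * (M / R) ∧
    ∀ j, j ≠ z → j ≠ m → lower k ν δ M R j ≤ inner ℝ (f j) x ∧ inner ℝ (f j) x ≤ width k ν δ M R j}

theorem measurableSet_slab {d : ℕ} (f : OrthonormalBasis (Fin d) ℝ (EuclideanSpace ℝ (Fin d)))
    (z m : Fin d) (k : ℕ) (ν δ M R : ℝ) : MeasurableSet (slab f z m k ν δ M R) := by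
  have hc : ∀ j, Continuous (fun x => inner ℝ (f j) x) := fun j => by fun_prop
  have e : slab f z m k ν δ M R = {x | ‖x‖ < 1} ∩ ({x | 1 / 4 ≤ inner ℝ (f m) x} ∩
      ({x | |inner ℝ (f z) x| ≤ 3 * (M / R)} ∩ (⋂ j, {x | j ≠ z → j ≠ m →
        lower k ν δ M R j ≤ inner ℝ (f j) x ∧ inner ℝ (f j) x ≤ width k ν δ M R j}))) := by
    ext x; simp [slab]
  rw [e]
  refine (isOpen_lt (by fun_prop) (by fun_prop)).measurableSet.inter
    (IsClosed.measurableSet ?_)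
  refine (isClosed_le continuous_const (hc m)).inter
    ((isClosed_le (hc z).abs continuous_const).inter (isClosed_iInter fun j => ?_))
  by_cases hj : j = z
  · simp [hj]
  by_cases hj' : j = m
  · simp [hj']
  · simp only [ne_eq, hj, hj', not_false_eq_true, true_implies]
    exact (isClosed_le continuous_const (hc _)).inter (isClosed_le (hc _) continuous_const)

theorem slab_subset {d : ℕ} (f : OrthonormalBasis (Fin d) ℝ (EuclideanSpace ℝ (Fin d)))
    (z m : Fin d) (k : ℕ) (ν δ M R : ℝ) :
    slab f z m k ν δ M R ⊆ Metric.ball (0 : EuclideanSpace ℝ (Fin d)) 1 \ {0} := by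
  rintro x ⟨h1, h2, -⟩
  refine ⟨by simpa using h1, ?_⟩
  rintro rfl
  rw [inner_zero_right] at h2
  norm_num at h2

theorem rot_mem_slab {d k : ℕ} {f : OrthonormalBasis (Fin d) ℝ (EuclideanSpace ℝ (Fin d))}
    {z m : Fin d} (hzm : z ≠ m) {ν δ M R : ℝ} (hδ : 0 ≤ δ) (hMR : 0 ≤ M / R)
    (hMR1 : M / R ≤ 1 / 16)
    (hz : width k ν δ M R z ≤ M / R) (hW : ∀ j : Fin d, j ≠ m → width k ν δ M R j ≤ 1 / (4 * d))
    {x : EuclideanSpace ℝ (Fin d)} (hx : x ∈ box f m (lower k ν δ M R) (width k ν δ M R))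
    {p : ℝ × ℝ} (hp : p ∈ square) :
    rot (f z) (f m) (M / R * (p.1 + p.2)) x ∈ slab f z m k ν δ M R := by
  set η := M / R with hη
  set θ := η * (p.1 + p.2) with hθ
  have hθ2 : |θ| ≤ 2 * η := by
    rw [hθ, abs_mul, abs_of_nonneg hMR, mul_comm]
    refine mul_le_mul_of_nonneg_right ?_ hMR
    obtain ⟨h1, h2⟩ := hp
    rw [abs_le]; constructor <;> linarith [h1.1, h1.2, h2.1, h2.2]
  have hxn := norm_lt_one_of_mem_box (fun j _ => neg_width_le_lower hδ j) hW hx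
  obtain ⟨hx1, hx2, hx3⟩ := hx
  have ha : |inner ℝ (f z) x| ≤ η := by
    obtain ⟨h1, h2⟩ := hx1 z hzm
    have := neg_width_le_lower (k := k) (ν := ν) (M := M) (R := R) hδ z
    exact abs_le.mpr ⟨by linarith, h2.trans hz⟩
  have hs : |Real.sin θ| ≤ 2 * η := Real.abs_sin_le_abs.trans hθ2
  have hc := Real.one_sub_sq_div_two_le_cos (x := θ)
  have hc1 := Real.cos_le_one θ
  have hθsq : θ ^ 2 ≤ 1 / 64 := by
    have h := hθ2.trans (by linarith : 2 * η ≤ 1 / 8)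
    have := sq_le_sq' (by linarith [(abs_le.mp h).1]) (abs_le.mp h).2
    linarith
  have ha' := abs_le.mp (ha.trans hMR1)
  have hs' := abs_le.mp (hs.trans (by linarith : 2 * η ≤ 1 / 8))
  refine ⟨?_, ?_, ?_, ?_⟩
  · rw [norm_rot (f.norm_eq_one z) (f.norm_eq_one m) (f.inner_eq_zero hzm)]
    exact hxn
  · rw [inner_rot, f.inner_eq_zero hzm.symm, f.inner_eq_one]
    have h1 : |Real.sin θ * inner ℝ (f z) x| ≤ 1 / 8 * (1 / 16) := by
      rw [abs_mul]
      exact mul_le_mul (hs.trans (by linarith)) (ha.trans hMR1) (abs_nonneg _) (by norm_num)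
    have := (abs_le.mp h1).2
    nlinarith
  · rw [inner_rot, f.inner_eq_one, f.inner_eq_zero hzm]
    have e : inner ℝ (f z) x + ((Real.cos θ - 1) * inner ℝ (f z) x +
        Real.sin θ * inner ℝ (f m) x) * 1 +
        ((Real.cos θ - 1) * inner ℝ (f m) x - Real.sin θ * inner ℝ (f z) x) * 0 =
        Real.cos θ * inner ℝ (f z) x + Real.sin θ * inner ℝ (f m) x := by ring
    rw [e]
    refine (abs_add_le _ _).trans ?_
    rw [abs_mul, abs_mul, abs_of_nonneg (show 0 ≤ inner ℝ (f m) x by linarith)]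
    have h1 := mul_le_mul (Real.abs_cos_le_one θ) ha (abs_nonneg _) zero_le_one
    have h2 := mul_le_mul hs (hx3.trans (by norm_num : (3 / 4 : ℝ) ≤ 1)) (by linarith) (by linarith)
    linarith
  · intro j hjz hjm
    rw [inner_rot, f.inner_eq_zero hjz, f.inner_eq_zero hjm]
    simpa using hx1 j hjm

set_option maxHeartbeats 1600000 in
/-- Lower bounds for the `L^q` mass of `|μ̂(R x/|x|)|` on slabs adapted to order `k`. The index `m` is
`k - 1` at the top scale `δ = 1` and `k` at the intermediate scales, where `⟨f_{k-1}, x⟩ ∈ [δ, 2δ]`. With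
`N^k = δR`, the scale of stationarity in `t` is `1/M` with `M = ΛN`. -/
theorem exists_slab_lintegral_bound (d K : ℕ) (hK : 2 ≤ K) (hKd : K ≤ d) {c₀ C₀ κ₀ κ₁ : ℝ}
    (hc₀ : 0 < c₀) (hC₀ : 0 < C₀) (hκ₀ : 0 < κ₀) (hκ₁ : 0 < κ₁) :
    ∃ κ : ℝ, 0 < κ ∧ κ ≤ κ₁ ∧ 3 * κ ≤ κ₀ ∧ ∃ Λ : ℝ, 1 ≤ Λ ∧ ∃ ν : ℝ, 0 < ν ∧ ν ≤ 1 ∧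
    ∃ lam : ℝ, 0 < lam ∧ ∃ N₀ : ℝ, 1 ≤ N₀ ∧
    ∀ (tc : ℝ) (γ : ℝ → EuclideanSpace ℝ (Fin d)) (χ : ℝ → ℝ),
      IsNondegenerate γ K c₀ C₀ tc κ₀ → Continuous χ → HasCompactSupport χ →
      (∀ t, 0 ≤ χ t) → (∀ t, χ t ≤ 1) → (∀ t, |t - tc| ≤ κ / 2 → χ t = 1) →
      (∀ t, χ t ≠ 0 → |t - tc| ≤ κ) →
      ∀ (k : ℕ) (z m : Fin d) (t₁ R δ N : ℝ)
        (f : OrthonormalBasis (Fin d) ℝ (EuclideanSpace ℝ (Fin d))),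
        2 ≤ k → k ≤ K → (z : ℕ) = 0 → |t₁ - tc| ≤ κ / 4 → IsFrame γ K c₀ t₁ f → 0 < δ → δ ≤ 1 →
        N₀ ≤ N → N ^ k = δ * R → R ≤ N ^ ((m : ℕ) + 1) →
        (((m : ℕ) + 1 = k ∧ δ = 1) ∨ ((m : ℕ) = k ∧ 8 * d * δ ≤ 1)) →
        (∀ q : ℝ, 1 ≤ q → ENNReal.ofReal (lam / (Λ * N)) ^ q *
          volume (box f m (lower k ν δ (Λ * N) R) (width k ν δ (Λ * N) R)) ≤
          ∫⁻ x in slab f z m k ν δ (Λ * N) R, ENNReal.ofReal (radial γ χ R x) ^ q) ∧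
        ∃ x, x ≠ 0 ∧ lam / (Λ * N) ≤ radial γ χ R x := by
  obtain ⟨L, hL, ε, hε, ν₁, hν₁, lam, hlam, key⟩ :=
    exists_box_average_bound d (c₀ := c₀ / 2) (C₀ := C₀) (by positivity) hC₀
  have hL0 : 0 < L := by linarith
  have hd2 : (2 : ℝ) ≤ d := by exact_mod_cast hK.trans hKd
  -- Coordinates of order at least `k` are controlled by making `L/Λ` small, those of order below `k`
  -- by making `ν` small.
  set Λ : ℝ := L * max 1 (2 * C₀ / ε) with hΛ
  have hΛL : L ≤ Λ := le_mul_of_one_le_right hL0.le (le_max_left _ _)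
  have hΛ1 : 1 ≤ Λ := hL.trans hΛL
  have hΛ0 : 0 < Λ := by linarith
  have hLΛ0 : 0 ≤ L / Λ := by positivity
  have hLΛ1 : L / Λ ≤ 1 := (div_le_one hΛ0).mpr hΛL
  have hLΛ : 2 * C₀ * (L / Λ) ≤ ε := by
    have h1 : 2 * C₀ / ε ≤ max 1 (2 * C₀ / ε) := le_max_right _ _
    rw [div_le_iff₀ hε] at h1
    rw [mul_div_assoc', div_le_iff₀ hΛ0, hΛ]
    linarith [mul_le_mul_of_nonneg_left h1 hL0.le]
  set ν : ℝ := min (min ν₁ (1 / (4 * d))) (ε / (C₀ * L ^ d)) with hν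
  have hν0 : 0 < ν := by positivity
  have hνν : ν ≤ ν₁ := (min_le_left _ _).trans (min_le_left _ _)
  have hνd : ν ≤ 1 / (4 * d) := (min_le_left _ _).trans (min_le_right _ _)
  have hν1 : ν ≤ 1 := hνd.trans (by rw [div_le_one (by positivity)]; linarith)
  have hνL : ν * (C₀ * L ^ d) ≤ ε := by
    have : ν ≤ ε / (C₀ * L ^ d) := min_le_right _ _
    rwa [le_div_iff₀ (by positivity)] at this
  set κ : ℝ := min (min (min κ₁ (κ₀ / 3)) (1 / 2)) (min (1 / (32 * C₀ * Λ ^ 2)) (c₀ / (4 * C₀))) with hκ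
  have hκ0 : 0 < κ := by positivity
  have hκ2 : κ ≤ κ₀ / 3 := (min_le_left _ _).trans ((min_le_left _ _).trans (min_le_right _ _))
  have hκ3 : κ ≤ 1 / 2 := (min_le_left _ _).trans (min_le_right _ _)
  have hκ4 : C₀ * Λ ^ 2 * (2 * κ) ≤ 1 / 16 := by
    have : κ ≤ 1 / (32 * C₀ * Λ ^ 2) := (min_le_right _ _).trans (min_le_left _ _)
    rw [le_div_iff₀ (by positivity)] at this
    linarith
  have hκ5 : C₀ * (2 * κ) ≤ c₀ / 2 := by
    have : κ ≤ c₀ / (4 * C₀) := (min_le_right _ _).trans (min_le_right _ _)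
    rw [le_div_iff₀ (by positivity)] at this
    linarith
  -- Large `N` makes the rotation angles `M/R ≤ Λ/N` and the scale `L/M` small, and `Λ^d ≤ N` keeps the
  -- box inside the unit ball.
  set N₀ : ℝ := max (max 1 (Λ / ν)) (max (max (Λ / κ) (Λ ^ d)) (max (4 * L / κ) (16 * Λ))) with hN₀
  refine ⟨κ, hκ0, (min_le_left _ _).trans ((min_le_left _ _).trans (min_le_left _ _)), by linarith,
    Λ, hΛ1, ν, hν0, hν1, lam / 2, by positivity, N₀, (le_max_left _ _).trans (le_max_left _ _), ?_⟩
  intro tc γ χ hγ hχ hc hχ0 hχ1 hχκ hχs k z m t₁ R δ N f hk hkK hz ht₁ hf hδ hδ1 hN hNk hRN hm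
  have hN1 : 1 ≤ N := ((le_max_left _ _).trans (le_max_left _ _)).trans hN
  have hNν : Λ / ν ≤ N := ((le_max_right _ _).trans (le_max_left _ _)).trans hN
  have hNκ : Λ / κ ≤ N :=
    ((le_max_left _ _).trans ((le_max_left _ _).trans (le_max_right _ _))).trans hN
  have hNd : Λ ^ d ≤ N :=
    ((le_max_right _ _).trans ((le_max_left _ _).trans (le_max_right _ _))).trans hN
  have hNL : 4 * L / κ ≤ N :=
    ((le_max_left _ _).trans ((le_max_right _ _).trans (le_max_right _ _))).trans hN
  have hN16 : 16 * Λ ≤ N :=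
    ((le_max_right _ _).trans ((le_max_right _ _).trans (le_max_right _ _))).trans hN
  have hN0 : 0 < N := by linarith
  have hR0 : 0 < R := by
    have : 0 < δ * R := hNk ▸ pow_pos hN0 k
    exact (mul_pos_iff_of_pos_left hδ).mp this
  have hNR : N ^ k ≤ R := by rw [hNk]; exact mul_le_of_le_one_left hR0.le hδ1
  have hN2R : N ^ 2 ≤ R := (pow_le_pow_right₀ hN1 hk).trans hNR
  set M := Λ * N with hM
  have hM0 : 0 < M := by positivity
  have hMR : M / R ≤ Λ / N := by
    rw [div_le_div_iff₀ hR0 hN0, hM]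
    calc Λ * N * N = Λ * N ^ 2 := by ring
      _ ≤ Λ * R := by gcongr
  have hMRν : M / R ≤ ν := hMR.trans (by rwa [div_le_iff₀ hN0, ← div_le_iff₀' hν0])
  have hMRκ : M / R ≤ 2 * κ := hMR.trans (by
    rw [div_le_iff₀ hN0]; rw [div_le_iff₀ hκ0] at hNκ; linarith [mul_pos hN0 hκ0])
  have hMR16 : M / R ≤ 1 / 16 := hMR.trans (by rw [div_le_iff₀ hN0]; linarith)
  have hMR0 : 0 < M / R := by positivity
  have hzk : (z : ℕ) + 1 < k := by omega
  have hzm : z ≠ m := by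
    rintro rfl
    omega
  have hkm : k ≤ (m : ℕ) + 1 := by omega
  have hmK : (m : ℕ) ≤ K := by omega
  have hLM : L / M ≤ κ / 4 := by
    rw [div_le_div_iff₀ hM0 (by norm_num), hM]
    rw [div_le_iff₀ hκ0] at hNL
    have := le_mul_of_one_le_left (mul_pos hκ0 hN0).le hΛ1
    linarith
  have hLMN : L / M = L / Λ / N := by rw [hM, div_div]
  have hMsq : C₀ * (M ^ 2 / R) * (2 * κ) ≤ 1 / 16 := by
    have : M ^ 2 / R ≤ Λ ^ 2 := by
      rw [div_le_iff₀ hR0, hM, mul_pow]; gcongr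
    calc C₀ * (M ^ 2 / R) * (2 * κ) ≤ C₀ * Λ ^ 2 * (2 * κ) := by gcongr
      _ ≤ _ := hκ4
  have hwd : ∀ j : Fin d, j ≠ m → width k ν δ M R j ≤ 1 / (4 * d) := by
    intro j hj
    unfold width
    split_ifs with h1 h2
    · have h3 : M ^ ((j : ℕ) + 1) / R ≤ 1 := by
        rw [div_le_one hR0, hM, mul_pow]
        calc Λ ^ ((j : ℕ) + 1) * N ^ ((j : ℕ) + 1) ≤ Λ ^ d * N ^ (k - 1) := by
              gcongr <;> omega
          _ ≤ N * N ^ (k - 1) := by gcongr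
          _ = N ^ k := by rw [← pow_succ', show k - 1 + 1 = k by omega]
          _ ≤ R := hNR
      calc ν * (M ^ ((j : ℕ) + 1) / R) ≤ ν * 1 := by gcongr
        _ ≤ _ := by linarith
    · rcases hm with ⟨hm1, -⟩ | ⟨-, hm2⟩
      · exact absurd (Fin.ext (by omega)) hj
      · rw [le_div_iff₀ (by positivity)]; linarith
    · exact hνd
  have hwz : width k ν δ M R z = ν * (M / R) := by
    unfold width
    rw [if_pos hzk, hz]; simp
  have hρκ : |t₁ - tc| + 2 * κ ≤ κ₀ := by linarith
  have hPm : ∀ t, |t - t₁| ≤ L / M → R * |inner ℝ (f m) (γ t - γ t₁)| ≤ ε / 2 ∧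
      ∀ j : Fin d, (m : ℕ) ≤ j → R * |inner ℝ (f j) (γ t - γ t₁)| ≤ ε / 2 := by
    intro t ht
    have : ∀ j : Fin d, (m : ℕ) ≤ j → R * |inner ℝ (f j) (γ t - γ t₁)| ≤ ε / 2 := by
      intro j hj
      have h1 := hγ.abs_inner_sub_le hf hρκ j (n := m + 1) (by omega) (by omega) (by omega)
        (t := t) (by linarith)
      calc R * |inner ℝ (f j) (γ t - γ t₁)| ≤ R * (C₀ * (L / M) ^ ((m : ℕ) + 1)) := by
            gcongr; exact h1.trans (by gcongr)
        _ = C₀ * (L / Λ) ^ ((m : ℕ) + 1) * (R / N ^ ((m : ℕ) + 1)) := by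
            rw [hLMN, div_pow (L / Λ)]; ring
        _ ≤ C₀ * (L / Λ) * 1 := by
            gcongr
            · exact pow_le_of_le_one hLΛ0 hLΛ1 (by omega)
            · rw [div_le_one (by positivity)]; exact hRN
        _ ≤ ε / 2 := by linarith
    exact ⟨this m le_rfl, this⟩
  have havg := key γ χ t₁ M R (2 * κ) f z m (lower k ν δ M R) (width k ν δ M R)
    hγ.contDiff.continuous hχ hc hχ0 hχ1 hM0 hR0 hzm (by linarith) (hMRν.trans hνν) hMRκ hMsq
    ?_ ?_ ?_ ?_ ?_ (fun j _ => neg_width_le_lower hδ.le j) hwd ?_ ?_ ?_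
  · constructor
    · intro q hq
      have h1 := rpow_mul_volume_le_lintegral (f.norm_eq_one z) (f.norm_eq_one m)
        (f.inner_eq_zero hzm) (measurable_radial hγ.contDiff.continuous hχ hc R)
        (radial_nonneg γ χ R) (measurableSet_box f m _ _) (measurableSet_slab f z m k ν δ M R)
        (η := M / R) (fun p hp x hx => rot_mem_slab hzm hδ.le hMR0.le hMR16
          (by rw [hwz]; exact mul_le_of_le_one_left hMR0.le hν1) hwd hx hp) hq havg
      refine le_trans ?_ h1
      gcongr
      linarith
    · have hvol := le_volume_box (by omega) (hkK.trans hKd) hν0 hδ hM0 hR0 (m := m)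
        (fun h => by rcases hm with h' | h' <;> [exact h'.2; omega]) hkm f
      have hne : (box f m (lower k ν δ M R) (width k ν δ M R)).Nonempty := by
        refine nonempty_of_measure_ne_zero (μ := volume) (ne_of_gt (lt_of_lt_of_le ?_ hvol))
        rw [ENNReal.ofReal_pos]
        positivity
      obtain ⟨x, hx⟩ := hne
      by_contra hcon
      push Not at hcon
      have h1 := havg x hx
      have h2 : ∫⁻ p in square, ENNReal.ofReal
          (radial γ χ R (rot (f z) (f m) (M / R * (p.1 + p.2)) x)) ≤
          ∫⁻ _ in square, ENNReal.ofReal (lam / 2 / M) := by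
        refine setLIntegral_mono' measurableSet_square fun p hp => ENNReal.ofReal_le_ofReal ?_
        refine (hcon _ ?_).le
        have := (slab_subset f z m k ν δ M R (rot_mem_slab hzm hδ.le hMR0.le hMR16
          (by rw [hwz]; exact mul_le_of_le_one_left hMR0.le hν1) hwd hx hp)).2
        simpa using this
      rw [setLIntegral_const, volume_square, mul_comm _ (4 : ℝ≥0∞)] at h2
      have h3 := (ENNReal.mul_le_mul_iff_right (by norm_num) (by norm_num)).mp (h1.trans h2)
      rw [ENNReal.ofReal_le_ofReal_iff (by positivity)] at h3
      have : lam / 2 / M < lam / M := by gcongr; linarith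
      linarith
  · intro t ht
    refine hχκ t ?_
    have := abs_sub_le t t₁ tc
    linarith
  · intro t ht
    have := abs_sub_le t tc t₁
    rw [abs_sub_comm tc t₁] at this
    linarith [hχs t ht]
  · intro t ht
    exact hγ.le_abs_inner_sub hf (by omega) hρκ hκ5 hC₀.le hz ht
  · intro t ht
    have := hγ.abs_inner_sub_le hf hρκ z (n := 1) le_rfl (by omega) (by omega) ht
    simpa using this
  · intro t ht
    exact hγ.abs_inner_sub_le hf hρκ m (n := 2) (by norm_num) (by omega) (by omega) ht
  · rw [hwz]; gcongr
  · intro t ht j hjz hjm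
    have htρ : |t - t₁| ≤ 2 * κ := by linarith
    unfold width
    split_ifs with h1 h2
    · have h3 := hγ.abs_inner_sub_le hf hρκ j (n := j + 1) (by omega) le_rfl (by omega) htρ
      calc R * (ν * (M ^ ((j : ℕ) + 1) / R) * |inner ℝ (f j) (γ t - γ t₁)|)
          ≤ R * (ν * (M ^ ((j : ℕ) + 1) / R) * (C₀ * (L / M) ^ ((j : ℕ) + 1))) := by
            gcongr; exact h3.trans (by gcongr)
        _ = ν * (C₀ * L ^ ((j : ℕ) + 1)) := by
            rw [div_pow]; field_simp
        _ ≤ ν * (C₀ * L ^ d) := by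
            gcongr
            omega
        _ ≤ ε := hνL
    · have h3 := hγ.abs_inner_sub_le hf hρκ j (n := k) (by omega) (by omega) (by omega) htρ
      calc R * (2 * δ * |inner ℝ (f j) (γ t - γ t₁)|)
          ≤ R * (2 * δ * (C₀ * (L / M) ^ k)) := by
            gcongr; exact h3.trans (by gcongr)
        _ = 2 * C₀ * (L / Λ) ^ k * (δ * R / N ^ k) := by
            rw [hLMN, div_pow (L / Λ)]; ring
        _ = 2 * C₀ * (L / Λ) ^ k := by rw [hNk, div_self (by positivity), mul_one]
        _ ≤ 2 * C₀ * (L / Λ) := by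
            gcongr
            exact pow_le_of_le_one hLΛ0 hLΛ1 (by omega)
        _ ≤ ε := hLΛ
    · have hmj : (m : ℕ) ≤ j := by
        have : (j : ℕ) ≠ m := fun h => hjm (Fin.ext h)
        omega
      have h3 := (hPm t ht).2 j hmj
      have h4 : 0 ≤ |inner ℝ (f j) (γ t - γ t₁)| := abs_nonneg _
      calc R * (ν * |inner ℝ (f j) (γ t - γ t₁)|) ≤ R * (1 * |inner ℝ (f j) (γ t - γ t₁)|) := by
            gcongr
        _ ≤ ε := by linarith
  · intro t ht
    have := (hPm t ht).1
    linarith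

/-! ### Disjointness of the slabs -/

section Slab

variable {d K k : ℕ} {γ : ℝ → EuclideanSpace ℝ (Fin d)} {c₀ C₀ tc κ₀ t₁ ν δ M R : ℝ}
  {f : OrthonormalBasis (Fin d) ℝ (EuclideanSpace ℝ (Fin d))} {z m : Fin d}
  {x : EuclideanSpace ℝ (Fin d)}

theorem abs_inner_le_of_mem_slab (hx : x ∈ slab f z m k ν δ M R) (hz : (z : ℕ) = 0)
    (hkm : k ≤ (m : ℕ) + 1) (hν1 : ν ≤ 1) (hM : 0 < M) (hR : 0 < R)
    {j : Fin d} (hj : (j : ℕ) + 1 < k) :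
    |inner ℝ (f j) x| ≤ 3 * (M ^ ((j : ℕ) + 1) / R) := by
  obtain ⟨-, -, h2, h3⟩ := hx
  by_cases hjz : j = z
  · subst hjz
    rw [hz]; simpa using h2
  · have hjm : j ≠ m := by rintro rfl; omega
    obtain ⟨h4, h5⟩ := h3 j hjz hjm
    have hp : 0 < M ^ ((j : ℕ) + 1) / R := by positivity
    unfold lower at h4
    rw [if_neg (by omega)] at h4
    unfold width at h4 h5
    rw [if_pos hj] at h4 h5
    have : ν * (M ^ ((j : ℕ) + 1) / R) ≤ 1 * (M ^ ((j : ℕ) + 1) / R) := by gcongr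
    exact abs_le.mpr ⟨by linarith, by linarith⟩

/-- Up to the small coordinates of order below `k`, the pairing of a point of the slab with `y` is
carried by the coordinates in `s`. -/
theorem abs_inner_sub_sum_le_of_mem_slab (hx : x ∈ slab f z m k ν δ M R) (hz : (z : ℕ) = 0)
    (hk : 2 ≤ k) (hkm : k ≤ (m : ℕ) + 1) (hν1 : ν ≤ 1) (hM : 1 ≤ M) (hR : 0 < R)
    {y : EuclideanSpace ℝ (Fin d)} (hy : ‖y‖ ≤ C₀) (s : Finset (Fin d))
    (hs : ∀ j, j ∉ s → (j : ℕ) + 1 < k ∨ inner ℝ (f j) y = 0) :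
    |inner ℝ x y - ∑ j ∈ s, inner ℝ (f j) x * inner ℝ (f j) y| ≤
      3 * d * C₀ * (M ^ (k - 1) / R) := by
  have hC : 0 ≤ C₀ := (norm_nonneg _).trans hy
  have hp : 0 < M ^ (k - 1) / R := by positivity
  rw [inner_eq_sum f, ← Finset.sum_compl_add_sum s, add_sub_cancel_right]
  refine (Finset.abs_sum_le_sum_abs _ _).trans ((Finset.sum_le_card_nsmul _ _
    (3 * C₀ * (M ^ (k - 1) / R)) ?_).trans ?_)
  · intro j hj
    rw [abs_mul]
    rcases hs j (Finset.mem_compl.mp hj) with h | h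
    · have h1 := abs_inner_le_of_mem_slab hx hz hkm hν1 (by linarith) hR h
      have h2 := abs_real_inner_le_norm (f j) y
      rw [f.norm_eq_one, one_mul] at h2
      calc |inner ℝ (f j) x| * |inner ℝ (f j) y| ≤ 3 * (M ^ ((j : ℕ) + 1) / R) * C₀ := by
            gcongr; exact h2.trans hy
        _ ≤ 3 * (M ^ (k - 1) / R) * C₀ := by gcongr; omega
        _ = _ := by ring
    · rw [h]; simp; positivity
  · rw [nsmul_eq_mul]
    have : ((sᶜ).card : ℝ) ≤ d := by
      have := Finset.card_le_univ sᶜ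
      rw [Fintype.card_fin] at this
      exact_mod_cast this
    calc ((sᶜ).card : ℝ) * (3 * C₀ * (M ^ (k - 1) / R)) ≤ d * (3 * C₀ * (M ^ (k - 1) / R)) := by
          gcongr
      _ = _ := by ring

/-- On the slabs `⟨x, γ^{(k-1)}(t₁)⟩` nearly vanishes. -/
theorem abs_inner_deriv_le (h : IsNondegenerate γ K c₀ C₀ tc κ₀) (hf : IsFrame γ K c₀ t₁ f)
    (ht₁ : |t₁ - tc| ≤ κ₀) (hx : x ∈ slab f z m k ν δ M R) (hz : (z : ℕ) = 0)
    (hk : 2 ≤ k) (hkK : k ≤ K) (hkm : k ≤ (m : ℕ) + 1) (hν1 : ν ≤ 1) (hM : 1 ≤ M) (hR : 0 < R) :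
    |inner ℝ x (iteratedDeriv (k - 1) γ t₁)| ≤ 3 * d * C₀ * (M ^ (k - 1) / R) := by
  have := abs_inner_sub_sum_le_of_mem_slab hx hz hk hkm hν1 hM hR
    (h.norm_le t₁ ht₁ (k - 1) (by omega)) ∅ (fun j _ => by
      by_cases hj : (j : ℕ) + 1 < k
      · exact Or.inl hj
      · exact Or.inr (hf.inner_eq_zero j _ (by omega) (by omega) (by omega)))
  simpa using this

/-- On the slabs at the top scale `⟨x, γ^{(k)}(t₁)⟩ ≳ 1`. -/
theorem le_inner_deriv_of_eq (h : IsNondegenerate γ K c₀ C₀ tc κ₀) (hf : IsFrame γ K c₀ t₁ f)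
    (hc₀ : 0 ≤ c₀) (ht₁ : |t₁ - tc| ≤ κ₀) (hx : x ∈ slab f z m k ν δ M R) (hz : (z : ℕ) = 0)
    (hk : 2 ≤ k) (hkK : k ≤ K) (hkm : (m : ℕ) + 1 = k) (hν1 : ν ≤ 1) (hM : 1 ≤ M) (hR : 0 < R) :
    c₀ / 4 - 3 * d * C₀ * (M ^ (k - 1) / R) ≤ inner ℝ x (iteratedDeriv k γ t₁) := by
  have h1 := abs_inner_sub_sum_le_of_mem_slab hx hz hk hkm.ge hν1 hM hR
    (h.norm_le t₁ ht₁ k (by omega)) {m} (fun j hj => by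
      have hjm : (j : ℕ) ≠ m := fun e => hj (by rw [Finset.mem_singleton]; exact Fin.ext e)
      by_cases hj' : (j : ℕ) + 1 < k
      · exact Or.inl hj'
      · exact Or.inr (hf.inner_eq_zero j _ (by omega) (by omega) (by omega)))
  rw [Finset.sum_singleton] at h1
  have h2 := hf.le_inner m (by omega)
  rw [hkm] at h2
  have h3 := hx.2.1
  have h4 := (abs_le.mp h1).1
  nlinarith

/-- On the slabs at an intermediate scale `⟨x, γ^{(k)}(t₁)⟩` is comparable to `δ`. -/
theorem inner_deriv_mem_of_mem_slab (h : IsNondegenerate γ K c₀ C₀ tc κ₀) (hf : IsFrame γ K c₀ t₁ f)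
    (hc₀ : 0 ≤ c₀) (hδ : 0 ≤ δ) (ht₁ : |t₁ - tc| ≤ κ₀) (hx : x ∈ slab f z m k ν δ M R)
    (hz : (z : ℕ) = 0)
    (hk : 2 ≤ k) (hkK : k ≤ K) (hkm : (m : ℕ) = k) (hν1 : ν ≤ 1) (hM : 1 ≤ M) (hR : 0 < R) :
    c₀ * δ - 3 * d * C₀ * (M ^ (k - 1) / R) ≤ inner ℝ x (iteratedDeriv k γ t₁) ∧
    inner ℝ x (iteratedDeriv k γ t₁) ≤ 2 * C₀ * δ + 3 * d * C₀ * (M ^ (k - 1) / R) := by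
  have hl : k - 1 < d := by omega
  set l : Fin d := ⟨k - 1, hl⟩ with hldef
  have hlv : (l : ℕ) = k - 1 := rfl
  have h1 := abs_inner_sub_sum_le_of_mem_slab hx hz hk (by omega) hν1 hM hR
    (h.norm_le t₁ ht₁ k (by omega)) {l} (fun j hj => by
      have hjm : (j : ℕ) ≠ l := fun e => hj (by rw [Finset.mem_singleton]; exact Fin.ext e)
      by_cases hj' : (j : ℕ) + 1 < k
      · exact Or.inl hj'
      · exact Or.inr (hf.inner_eq_zero j _ (by omega) (by omega) (by omega)))
  rw [Finset.sum_singleton] at h1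
  have h2 := hf.le_inner l (by omega)
  rw [hlv, show k - 1 + 1 = k by omega] at h2
  have h3 := hx.2.2.2 l (fun e => by have := congrArg Fin.val e; omega)
    (fun e => by have := congrArg Fin.val e; omega)
  have h5 := abs_real_inner_le_norm (f l) (iteratedDeriv k γ t₁)
  rw [f.norm_eq_one, one_mul] at h5
  have h6 := (le_abs_self _).trans (h5.trans (h.norm_le t₁ ht₁ k (by omega)))
  unfold lower width at h3
  rw [if_pos (by omega), if_neg (by omega), if_pos (by omega)] at h3
  obtain ⟨h7, h8⟩ := abs_le.mp h1
  have h9 : c₀ * δ ≤ inner ℝ (f l) x * inner ℝ (f l) (iteratedDeriv k γ t₁) := by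
    rw [mul_comm]; exact mul_le_mul h3.1 h2 hc₀ (hδ.trans h3.1)
  have h10 : inner ℝ (f l) x * inner ℝ (f l) (iteratedDeriv k γ t₁) ≤ 2 * δ * C₀ :=
    mul_le_mul h3.2 h6 (hc₀.trans h2) (by linarith)
  constructor <;> linarith

/-- On the slabs at an intermediate scale `⟨x, γ^{(k+1)}(t₁)⟩ ≳ 1`. -/
theorem le_inner_deriv_succ_of_mem_slab (h : IsNondegenerate γ K c₀ C₀ tc κ₀)
    (hf : IsFrame γ K c₀ t₁ f) (hc₀ : 0 ≤ c₀) (hδ : 0 ≤ δ) (ht₁ : |t₁ - tc| ≤ κ₀)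
    (hx : x ∈ slab f z m k ν δ M R) (hz : (z : ℕ) = 0)
    (hk : 2 ≤ k) (hkK : k + 1 ≤ K) (hkm : (m : ℕ) = k) (hν1 : ν ≤ 1) (hM : 1 ≤ M) (hR : 0 < R) :
    c₀ / 4 - 2 * C₀ * δ - 3 * d * C₀ * (M ^ (k - 1) / R) ≤
      inner ℝ x (iteratedDeriv (k + 1) γ t₁) := by
  have hl : k - 1 < d := by omega
  set l : Fin d := ⟨k - 1, hl⟩ with hldef
  have hlv : (l : ℕ) = k - 1 := rfl
  have hlm : l ≠ m := fun e => by have := congrArg Fin.val e; omega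
  have h1 := abs_inner_sub_sum_le_of_mem_slab hx hz hk (by omega) hν1 hM hR
    (h.norm_le t₁ ht₁ (k + 1) (by omega)) {l, m} (fun j hj => by
      have hjl : (j : ℕ) ≠ l := fun e => hj (by simp [Fin.ext e])
      have hjm : (j : ℕ) ≠ m := fun e => hj (by simp [Fin.ext e])
      by_cases hj' : (j : ℕ) + 1 < k
      · exact Or.inl hj'
      · exact Or.inr (hf.inner_eq_zero j _ (by omega) (by omega) (by omega)))
  rw [Finset.sum_pair hlm] at h1
  have h2 := hf.le_inner m (by omega)
  rw [hkm] at h2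
  have h3 := hx.2.2.2 l (fun e => by have := congrArg Fin.val e; omega) hlm
  unfold lower width at h3
  rw [if_pos (by omega), if_neg (by omega), if_pos (by omega)] at h3
  have h5 := abs_real_inner_le_norm (f l) (iteratedDeriv (k + 1) γ t₁)
  rw [f.norm_eq_one, one_mul] at h5
  have h6 := h5.trans (h.norm_le t₁ ht₁ (k + 1) (by omega))
  have h7 := (abs_le.mp h1).1
  have h8 : |inner ℝ (f l) x * inner ℝ (f l) (iteratedDeriv (k + 1) γ t₁)| ≤ 2 * δ * C₀ := by
    rw [abs_mul, abs_of_nonneg (hδ.trans h3.1)]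
    exact mul_le_mul h3.2 h6 (abs_nonneg _) (by linarith)
  have h9 := (abs_le.mp h8).1
  have h10 := hx.2.1
  have h11 : 1 / 4 * c₀ ≤ inner ℝ (f m) x * inner ℝ (f m) (iteratedDeriv (k + 1) γ t₁) :=
    mul_le_mul h10 h2 hc₀ (by linarith)
  linarith

end Slab

theorem mul_sub_le_of_le_deriv {F F' : ℝ → ℝ} (hF : ∀ t, HasDerivAt F (F' t) t) {a s t : ℝ}
    (hst : s ≤ t) (ha : ∀ u ∈ Icc s t, a ≤ F' u) : a * (t - s) ≤ F t - F s := by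
  refine (convex_Icc s t).mul_sub_le_image_sub_of_le_deriv
    (fun x _ => (hF x).continuousAt.continuousWithinAt)
    (fun x _ => (hF x).differentiableAt.differentiableWithinAt) ?_ s (left_mem_Icc.mpr hst) t
    (right_mem_Icc.mpr hst) hst
  intro x hx
  rw [(hF x).deriv]
  exact ha x (interior_subset hx)

/-- A function with `0 ≤ F'' ≤ C` whose derivative is small positive at `t'` and at least `a` at `t`
increases by a multiple of `a²` between the two points. -/
theorem sq_le_of_convex {F F' F'' : ℝ → ℝ} (hF : ∀ t, HasDerivAt F (F' t) t)
    (hF' : ∀ t, HasDerivAt F' (F'' t) t) {C a b B lo hi t t' : ℝ} (hC : 0 < C) (ha : 0 < a)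
    (h0 : ∀ u ∈ Icc lo hi, 0 ≤ F'' u) (h1 : ∀ u ∈ Icc lo hi, F'' u ≤ C) (ht : t ∈ Icc lo hi)
    (ht' : t' ∈ Icc lo hi) (hpos : 0 ≤ F' t') (hsmall : F' t' ≤ a / 2) (hlarge : a ≤ F' t)
    (hb : |F t| ≤ b) (hB : |F t'| ≤ B) : a ^ 2 / (4 * C) ≤ b + B := by
  have hlt : t' < t := by
    by_contra hcon
    have := mul_sub_le_of_le_deriv hF' (not_lt.mp hcon) (a := 0)
      (fun u hu => h0 u ⟨ht.1.trans hu.1, hu.2.trans ht'.2⟩)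
    linarith
  have hFC : ∀ s ∈ Icc t' t, F' t - C * (t - s) ≤ F' s := by
    intro s hs
    have h2 := mul_sub_le_of_le_deriv (F := fun t => -F' t) (F' := fun t => -F'' t)
      (fun t => (hF' t).neg) hs.2 (a := -C)
      (fun u hu => neg_le_neg (h1 u ⟨ht'.1.trans (hs.1.trans hu.1), hu.2.trans ht.2⟩))
    linarith
  set u := a / (2 * C) with hu
  have hu0 : 0 < u := by positivity
  have hCu : C * u = a / 2 := by rw [hu]; field_simp
  have hge : t' ≤ t - u := by
    have h2 := hFC t' (left_mem_Icc.mpr hlt.le)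
    have h3 : a / 2 ≤ C * (t - t') := by linarith
    rw [← hCu] at h3
    have := le_of_mul_le_mul_left h3 hC
    linarith
  have i1 := mul_sub_le_of_le_deriv hF (s := t - u) (t := t) (by linarith) (a := a / 2) (by
    intro s hs
    have h2 := hFC s ⟨hge.trans hs.1, hs.2⟩
    have h3 : C * (t - s) ≤ C * u := by gcongr; linarith [hs.1]
    linarith)
  have i2 := mul_sub_le_of_le_deriv hF hge (a := 0) (by
    intro s hs
    have h2 := mul_sub_le_of_le_deriv hF' hs.1 (a := 0)
      (fun u hu => h0 u ⟨ht'.1.trans hu.1, hu.2.trans (hs.2.trans (by linarith [ht.2]))⟩)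
    linarith)
  have e : a / 2 * (t - (t - u)) = a ^ 2 / (4 * C) := by rw [hu]; field_simp; ring
  rw [e] at i1
  have := le_abs_self (F t)
  have := neg_abs_le (F t')
  linarith

theorem sum_le_lintegral_of_disjoint {ι E : Type*} [MeasurableSpace E] {μ : Measure E} (s : Finset ι)
    (B : ι → Set E) (S : Set E) (g : E → ℝ≥0∞) (V : ι → ℝ≥0∞)
    (hd : (s : Set ι).PairwiseDisjoint B) (hB : ∀ i ∈ s, MeasurableSet (B i))
    (hS : ∀ i ∈ s, B i ⊆ S) (hV : ∀ i ∈ s, V i ≤ ∫⁻ x in B i, g x ∂μ) :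
    ∑ i ∈ s, V i ≤ ∫⁻ x in S, g x ∂μ := by
  calc ∑ i ∈ s, V i ≤ ∑ i ∈ s, ∫⁻ x in B i, g x ∂μ := Finset.sum_le_sum hV
    _ = ∫⁻ x in ⋃ i ∈ s, B i, g x ∂μ := (lintegral_biUnion_finset hd hB g).symm
    _ ≤ _ := lintegral_mono_set (iUnion₂_subset hS)

section Pair

variable {d K k : ℕ} {γ : ℝ → EuclideanSpace ℝ (Fin d)} {c₀ C₀ tc κ₀ κ t₁ t₂ ν δ M R β : ℝ}
  {f f' : OrthonormalBasis (Fin d) ℝ (EuclideanSpace ℝ (Fin d))} {z m : Fin d}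
  {x : EuclideanSpace ℝ (Fin d)}

theorem abs_inner_iteratedDeriv_sub_le (h : IsNondegenerate γ K c₀ C₀ tc κ₀) (hC₀ : 0 ≤ C₀)
    (hκ : 4 * κ ≤ κ₀) (hκ0 : 0 ≤ κ)
    (hx : ‖x‖ < 1) {i : ℕ} (hi : i ≤ K) {t : ℝ} (ht : |t - tc| ≤ κ) (ht₁ : |t₁ - tc| ≤ κ) :
    |inner ℝ x (iteratedDeriv i γ t) - inner ℝ x (iteratedDeriv i γ t₁)| ≤ C₀ * (2 * κ) := by
  rw [← inner_sub_right]
  refine (abs_real_inner_le_norm _ _).trans ?_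
  have h1 := h.norm_iteratedDeriv_sub_le hi (t := t) (t' := t₁) (by linarith) (by linarith)
  have h2 : |t - t₁| ≤ 2 * κ := by
    have := abs_sub_le t tc t₁
    rw [abs_sub_comm tc] at this
    linarith
  calc ‖x‖ * ‖iteratedDeriv i γ t - iteratedDeriv i γ t₁‖ ≤ 1 * (C₀ * |t - t₁|) := by gcongr
    _ ≤ C₀ * (2 * κ) := by rw [one_mul]; gcongr

/-- Two slabs at the top scale, `⟨x, γ^{(k)}⟩ ≳ 1`, meet only if their base points are close. -/
theorem abs_sub_le_of_mem_slab_top (h : IsNondegenerate γ K c₀ C₀ tc κ₀) (hc₀ : 0 < c₀)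
    (hκ : 4 * κ ≤ κ₀) (hκ0 : 0 ≤ κ)
    (hκc : C₀ * (2 * κ) ≤ c₀ / 16) (hf : IsFrame γ K c₀ t₁ f) (hf' : IsFrame γ K c₀ t₂ f')
    (ht₁ : |t₁ - tc| ≤ κ) (ht₂ : |t₂ - tc| ≤ κ) (h12 : t₁ ≤ t₂) (hx : x ∈ slab f z m k ν δ M R)
    (hx' : x ∈ slab f' z m k ν δ M R) (hz : (z : ℕ) = 0) (hk : 2 ≤ k) (hkK : k ≤ K)
    (hkm : (m : ℕ) + 1 = k) (hν1 : ν ≤ 1) (hM : 1 ≤ M) (hR : 0 < R)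
    (hβ : 3 * d * C₀ * (M ^ (k - 1) / R) ≤ β) (hβc : β ≤ c₀ / 16) :
    c₀ / 8 * (t₂ - t₁) ≤ 2 * β := by
  have hC₀ : 0 ≤ C₀ := (norm_nonneg _).trans (h.norm_le t₁ (by linarith) 0 (by omega))
  have b1 := (abs_inner_deriv_le h hf (by linarith) hx hz hk hkK hkm.ge hν1 hM hR).trans hβ
  have b2 := (abs_inner_deriv_le h hf' (by linarith) hx' hz hk hkK hkm.ge hν1 hM hR).trans hβ
  have b3 := le_inner_deriv_of_eq h hf hc₀.le (by linarith) hx hz hk hkK hkm hν1 hM hR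
  have hder : ∀ t, HasDerivAt (fun t => inner ℝ x (iteratedDeriv (k - 1) γ t))
      (inner ℝ x (iteratedDeriv k γ t)) t := by
    intro t
    have := hasDerivAt_inner_iteratedDeriv h.contDiff x (k - 1) t
    rwa [show k - 1 + 1 = k by omega] at this
  have := mul_sub_le_of_le_deriv hder h12 (a := c₀ / 8) (by
    intro u hu
    have hu' : |u - tc| ≤ κ := by
      rw [abs_le] at ht₁ ht₂ ⊢
      constructor <;> linarith [hu.1, hu.2]
    have := (abs_le.mp (abs_inner_iteratedDeriv_sub_le h hC₀ hκ hκ0 hx.1 hkK hu' ht₁)).1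
    linarith)
  have := (abs_le.mp b1).1
  have := (abs_le.mp b2).2
  linarith

/-- In the degenerate regime `⟨x, γ^{(k)}⟩ ∼ δ` the derivative of order `k + 1` in direction `x` is
nonnegative, either by nondegeneracy or because it vanishes. -/
theorem inner_deriv_succ_nonneg (h : IsNondegenerate γ K c₀ C₀ tc κ₀) (hc₀ : 0 < c₀)
    (hκ : 4 * κ ≤ κ₀) (hκ0 : 0 ≤ κ)
    (hκc : C₀ * (2 * κ) ≤ c₀ / 16) (hf : IsFrame γ K c₀ t₁ f) (ht₁ : |t₁ - tc| ≤ κ)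
    (hx : x ∈ slab f z m k ν δ M R) (hz : (z : ℕ) = 0) (hk : 2 ≤ k)
    (hkm : (m : ℕ) = k)
    (htop : k + 1 ≤ K ∨ ∀ t, |t - tc| ≤ κ → iteratedDeriv (k + 1) γ t = 0) (hν1 : ν ≤ 1)
    (hM : 1 ≤ M) (hR : 0 < R) (hδ : 0 ≤ δ) (hδc : 2 * C₀ * δ ≤ c₀ / 16)
    (hβ : 3 * d * C₀ * (M ^ (k - 1) / R) ≤ β) (hβc : β ≤ c₀ / 16) {t : ℝ} (ht : |t - tc| ≤ κ) :
    0 ≤ inner ℝ x (iteratedDeriv (k + 1) γ t) := by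
  have hC₀ : 0 ≤ C₀ := (norm_nonneg _).trans (h.norm_le t₁ (by linarith) 0 (by omega))
  rcases htop with htop | htop
  · have h1 := le_inner_deriv_succ_of_mem_slab h hf hc₀.le hδ (by linarith) hx hz hk htop hkm hν1 hM hR
    have h2 := (abs_le.mp (abs_inner_iteratedDeriv_sub_le h hC₀ hκ hκ0 hx.1 htop ht ht₁)).1
    linarith
  · rw [htop t ht, inner_zero_right]

/-- Two slabs at the same intermediate scale meet only if their base points are close. -/
theorem abs_sub_le_of_mem_slab_same (h : IsNondegenerate γ K c₀ C₀ tc κ₀) (hc₀ : 0 < c₀)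
    (hκ : 4 * κ ≤ κ₀) (hκ0 : 0 ≤ κ)
    (hκc : C₀ * (2 * κ) ≤ c₀ / 16) (hf : IsFrame γ K c₀ t₁ f) (hf' : IsFrame γ K c₀ t₂ f')
    (ht₁ : |t₁ - tc| ≤ κ) (ht₂ : |t₂ - tc| ≤ κ) (h12 : t₁ ≤ t₂) (hx : x ∈ slab f z m k ν δ M R)
    (hx' : x ∈ slab f' z m k ν δ M R) (hz : (z : ℕ) = 0) (hk : 2 ≤ k) (hkK : k ≤ K)
    (hkm : (m : ℕ) = k)
    (htop : k + 1 ≤ K ∨ ∀ t, |t - tc| ≤ κ → iteratedDeriv (k + 1) γ t = 0) (hν1 : ν ≤ 1)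
    (hM : 1 ≤ M) (hR : 0 < R) (hδ : 0 ≤ δ) (hδc : 2 * C₀ * δ ≤ c₀ / 16)
    (hβ : 3 * d * C₀ * (M ^ (k - 1) / R) ≤ β) (hβc : β ≤ c₀ / 16) (hβδ : β ≤ c₀ / 2 * δ) :
    c₀ / 2 * δ * (t₂ - t₁) ≤ 2 * β := by
  have b1 := (abs_inner_deriv_le h hf (by linarith) hx hz hk hkK (by omega) hν1 hM hR).trans hβ
  have b2 := (abs_inner_deriv_le h hf' (by linarith) hx' hz hk hkK (by omega) hν1 hM hR).trans hβ
  have b3 := (inner_deriv_mem_of_mem_slab h hf hc₀.le hδ (by linarith) hx hz hk hkK hkm hν1 hM hR).1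
  have hder : ∀ t, HasDerivAt (fun t => inner ℝ x (iteratedDeriv (k - 1) γ t))
      (inner ℝ x (iteratedDeriv k γ t)) t := by
    intro t
    have := hasDerivAt_inner_iteratedDeriv h.contDiff x (k - 1) t
    rwa [show k - 1 + 1 = k by omega] at this
  have hin : ∀ u ∈ Icc t₁ t₂, |u - tc| ≤ κ := by
    intro u hu
    rw [abs_le] at ht₁ ht₂ ⊢
    constructor <;> linarith [hu.1, hu.2]
  have := mul_sub_le_of_le_deriv hder h12 (a := c₀ / 2 * δ) (by
    intro u hu
    have := mul_sub_le_of_le_deriv (hasDerivAt_inner_iteratedDeriv h.contDiff x k) hu.1 (a := 0)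
      (fun v hv => inner_deriv_succ_nonneg h hc₀ hκ hκ0 hκc hf ht₁ hx hz hk hkm htop hν1 hM hR hδ
        hδc hβ hβc (hin v ⟨hv.1, hv.2.trans hu.2⟩))
    linarith)
  have := (abs_le.mp b1).1
  have := (abs_le.mp b2).2
  linarith

/-- A point common to two slabs at well separated intermediate scales `δ' ≪ δ` forces
`δ² ≲ β + β'`, which fails once `δN` is large: `F = ⟨x, γ^{(k-1)}⟩` is convex with `|F| ≤ β` at `t₁` and
`|F| ≤ β'` at `t₂`, but its slope changes from about `δ'` to about `δ` in between. -/
theorem sq_le_of_mem_slab_of_mem_slab {δ' M' β' : ℝ} (h : IsNondegenerate γ K c₀ C₀ tc κ₀)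
    (hc₀ : 0 < c₀) (hC₀ : 0 < C₀) (hκ : 4 * κ ≤ κ₀) (hκ0 : 0 ≤ κ)
    (hκc : C₀ * (2 * κ) ≤ c₀ / 16) (hf : IsFrame γ K c₀ t₁ f) (hf' : IsFrame γ K c₀ t₂ f')
    (ht₁ : |t₁ - tc| ≤ κ) (ht₂ : |t₂ - tc| ≤ κ) (hx : x ∈ slab f z m k ν δ M R)
    (hx' : x ∈ slab f' z m k ν δ' M' R) (hz : (z : ℕ) = 0) (hk : 2 ≤ k) (hkK : k ≤ K)
    (hkm : (m : ℕ) = k)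
    (htop : k + 1 ≤ K ∨ ∀ t, |t - tc| ≤ κ → iteratedDeriv (k + 1) γ t = 0) (hν1 : ν ≤ 1)
    (hM : 1 ≤ M) (hM' : 1 ≤ M') (hR : 0 < R) (hδ : 0 < δ) (hδ' : 0 ≤ δ')
    (hδc : 2 * C₀ * δ ≤ c₀ / 16)
    (hβ : 3 * d * C₀ * (M ^ (k - 1) / R) ≤ β) (hβ' : 3 * d * C₀ * (M' ^ (k - 1) / R) ≤ β')
    (hβc : β ≤ c₀ / 16) (hβδ : β ≤ c₀ / 2 * δ) (hβC' : β' ≤ C₀ * δ') (hβδ' : β' ≤ c₀ / 2 * δ')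
    (hδδ' : 3 * C₀ * δ' ≤ c₀ / 4 * δ) :
    (c₀ / 2 * δ) ^ 2 / (4 * C₀) ≤ β + β' := by
  have b1 := (abs_inner_deriv_le h hf (by linarith) hx hz hk hkK (by omega) hν1 hM hR).trans hβ
  have b2 := (abs_inner_deriv_le h hf' (by linarith) hx' hz hk hkK (by omega) hν1 hM' hR).trans hβ'
  have b3 := (inner_deriv_mem_of_mem_slab h hf hc₀.le hδ.le (by linarith) hx hz hk hkK hkm hν1 hM hR).1
  obtain ⟨b4, b5⟩ :=
    inner_deriv_mem_of_mem_slab h hf' hc₀.le hδ' (by linarith) hx' hz hk hkK hkm hν1 hM' hR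
  have hder : ∀ t, HasDerivAt (fun t => inner ℝ x (iteratedDeriv (k - 1) γ t))
      (inner ℝ x (iteratedDeriv k γ t)) t := by
    intro t
    have := hasDerivAt_inner_iteratedDeriv h.contDiff x (k - 1) t
    rwa [show k - 1 + 1 = k by omega] at this
  have hin : ∀ u ∈ Icc (tc - κ) (tc + κ), |u - tc| ≤ κ := by
    intro u hu
    rw [abs_le]
    constructor <;> linarith [hu.1, hu.2]
  have hcδ : 0 ≤ c₀ / 2 * δ' := by positivity
  refine sq_le_of_convex hder (hasDerivAt_inner_iteratedDeriv h.contDiff x k) hC₀ (by positivity)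
    (lo := tc - κ) (hi := tc + κ) (t := t₁) (t' := t₂)
    (fun u hu => inner_deriv_succ_nonneg h hc₀ hκ hκ0 hκc hf ht₁ hx hz hk hkm htop hν1 hM hR hδ.le
        hδc hβ hβc (hin u hu)) (fun u hu => ?_) ?_ ?_ ?_ ?_ ?_ b1 b2
  · refine (le_abs_self _).trans ((abs_real_inner_le_norm _ _).trans ?_)
    have h1 := h.norm_le u (by linarith [hin u hu]) (k + 1) (by omega)
    calc ‖x‖ * ‖iteratedDeriv (k + 1) γ u‖ ≤ 1 * C₀ := by
          gcongr
          exact hx.1.le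
      _ = C₀ := one_mul _
  · rw [abs_le] at ht₁; constructor <;> linarith [ht₁.1, ht₁.2]
  · rw [abs_le] at ht₂; constructor <;> linarith [ht₂.1, ht₂.2]
  · linarith
  · linarith
  · linarith

end Pair

/-! ### Packing the slabs -/

/-- The error `β ∼ M^{k-1}/R` in `⟨x, γ^{(k-1)}(t₁)⟩ = O(β)` on a slab is at most a multiple of `δ/N`,
where `M = ΛN` and `N^k = δR`. -/
theorem beta_le {d k : ℕ} (hk : 1 ≤ k) (hkd : k ≤ d) {C₀ Λ δ N R : ℝ} (hC₀ : 0 ≤ C₀) (hΛ : 1 ≤ Λ)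
    (hN : 0 < N) (hR : 0 < R) (hNk : N ^ k = δ * R) :
    3 * d * C₀ * ((Λ * N) ^ (k - 1) / R) ≤ 3 * d * C₀ * Λ ^ d * (δ / N) := by
  have h1 : N ^ (k - 1) / R = δ / N := by
    rw [div_eq_div_iff hR.ne' hN.ne', ← pow_succ, show k - 1 + 1 = k by omega, hNk]
  rw [mul_pow, mul_div_assoc, h1]
  have hδN : 0 ≤ δ / N := by rw [← h1]; positivity
  calc 3 * d * C₀ * (Λ ^ (k - 1) * (δ / N)) ≤ 3 * d * C₀ * (Λ ^ d * (δ / N)) := by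
        gcongr
        omega
    _ = _ := by ring

/-- The contribution of all slabs at one scale `N` with `N^k = δR`, up to constants: about `N` slabs,
each of measure `δ N^{k(k-1)/2}/R^{k-1}`, on which `|μ̂|` is of size `lam/N`. -/
def scaleMass (k : ℕ) (c lam δ N R q : ℝ) : ℝ :=
  c * (δ * (N ^ (k * (k - 1) / 2 + 1) / R ^ (k - 1))) * (lam / N) ^ q

/-- The number of grid points of spacing `H/N` in an interval of length `κ/4`. -/
def gridCard (κ H N : ℝ) : ℕ := ⌊κ * N / (4 * H)⌋₊ + 1

theorem le_gridCard (κ H N : ℝ) : κ * N / (4 * H) ≤ gridCard κ H N := by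
  unfold gridCard
  push_cast
  exact (Nat.lt_floor_add_one _).le

theorem grid_le {κ H N : ℝ} (hκ : 0 < κ) (hH : 0 < H) (hN : 0 < N) {i : ℕ}
    (hi : i < gridCard κ H N) : i * (H / N) ≤ κ / 4 := by
  have h1 : i ≤ ⌊κ * N / (4 * H)⌋₊ := by unfold gridCard at hi; omega
  have h2 := (Nat.le_floor_iff (by positivity)).mp h1
  rw [le_div_iff₀ (by positivity)] at h2
  rw [mul_div_assoc', div_le_div_iff₀ hN (by norm_num)]
  linarith

theorem scaleMass_le {k d : ℕ} {ν lam Λ κ H δ N R q : ℝ} (hν : 0 < ν) (hlam : 0 < lam) (hΛ : 1 ≤ Λ)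
    (_hκ : 0 < κ) (_hH : 0 < H) (hδ : 0 < δ) (hN : 0 < N) (hR : 0 < R) (hq : 0 ≤ q) {v : ℝ≥0∞}
    (hv : ENNReal.ofReal (min ν (1 / 4) ^ d *
      (δ * ((Λ * N) ^ (k * (k - 1) / 2) / R ^ (k - 1)))) ≤ v) :
    ENNReal.ofReal (scaleMass k (min ν (1 / 4) ^ d * (κ / (4 * H))) (lam / Λ) δ N R q) ≤
      gridCard κ H N * (ENNReal.ofReal (lam / (Λ * N)) ^ q * v) := by
  have h1 : (gridCard κ H N : ℝ≥0∞) = ENNReal.ofReal (gridCard κ H N) := by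
    rw [ENNReal.ofReal_natCast]
  have hc0 : 0 < min ν (1 / 4) := lt_min hν (by norm_num)
  refine le_trans ?_ (mul_le_mul_right (mul_le_mul_right hv _) _)
  rw [h1, ENNReal.ofReal_rpow_of_nonneg (by positivity) hq, ← ENNReal.ofReal_mul (by positivity),
    ← ENNReal.ofReal_mul (by positivity)]
  refine ENNReal.ofReal_le_ofReal ?_
  have h2 := le_gridCard κ H N
  have h3 : N ^ (k * (k - 1) / 2) ≤ (Λ * N) ^ (k * (k - 1) / 2) := by
    gcongr
    exact le_mul_of_one_le_left hN.le hΛ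
  unfold scaleMass
  rw [div_div]
  calc _ = κ * N / (4 * H) * ((lam / (Λ * N)) ^ q * (min ν (1 / 4) ^ d *
        (δ * (N ^ (k * (k - 1) / 2) / R ^ (k - 1))))) := by
        rw [pow_succ]; ring
    _ ≤ _ := by gcongr

theorem abs_sub_grid (tc h : ℝ) (i j : ℕ) (hij : i < j) (hh : 0 ≤ h) :
    tc + i * h ≤ tc + j * h ∧ h ≤ (tc + j * h) - (tc + i * h) := by
  have : (i : ℝ) + 1 ≤ j := by exact_mod_cast hij
  constructor <;> nlinarith

set_option maxHeartbeats 1600000 in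
/-- Lower bounds for the `L^q` mass of `|μ̂(R x/|x|)|` on the unit ball: from the slabs of order `k`
at the top scale, and from a sparse family of intermediate scales between the orders `k` and
`k + 1`. -/
theorem exists_lintegral_lower_bound (d K : ℕ) (hK : 2 ≤ K) (hKd : K ≤ d) {c₀ C₀ κ₀ : ℝ}
    (hc₀ : 0 < c₀) (hC₀ : 0 < C₀) (hκ₀ : 0 < κ₀) :
    ∃ κ : ℝ, 0 < κ ∧ 4 * κ ≤ κ₀ ∧ ∃ c : ℝ, 0 < c ∧ ∃ lam : ℝ, 0 < lam ∧ ∃ N₀ : ℝ, 1 ≤ N₀ ∧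
    ∃ a : ℝ, 0 < a ∧ a < 1 ∧
    ∀ (tc : ℝ) (γ : ℝ → EuclideanSpace ℝ (Fin d)) (χ : ℝ → ℝ),
      IsNondegenerate γ K c₀ C₀ tc κ₀ → Continuous χ → HasCompactSupport χ →
      (∀ t, 0 ≤ χ t) → (∀ t, χ t ≤ 1) → (∀ t, |t - tc| ≤ κ / 2 → χ t = 1) →
      (∀ t, χ t ≠ 0 → |t - tc| ≤ κ) → ∀ (k : ℕ) (R : ℝ), 2 ≤ k → k ≤ K → 0 < R →
      (∀ N : ℝ, N₀ ≤ N → N ^ k = R →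
        (∀ q : ℝ, 1 ≤ q → ENNReal.ofReal (scaleMass k c lam 1 N R q) ≤
          ∫⁻ x in Metric.ball (0 : EuclideanSpace ℝ (Fin d)) 1 \ {0},
            ENNReal.ofReal (radial γ χ R x) ^ q) ∧
        ∃ x, x ≠ 0 ∧ lam / N ≤ radial γ χ R x) ∧
      (k < d → (k + 1 ≤ K ∨ ∀ t, |t - tc| ≤ κ → iteratedDeriv (k + 1) γ t = 0) →
        ∀ (s : Finset ℕ) (N : ℕ → ℝ), (∀ l ∈ s, N₀ ≤ a ^ (l + 1) * N l ∧ N l ^ k = a ^ (l + 1) * R) →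
        ∀ q : ℝ, 1 ≤ q → ENNReal.ofReal (∑ l ∈ s, scaleMass k c lam (a ^ (l + 1)) (N l) R q) ≤
          ∫⁻ x in Metric.ball (0 : EuclideanSpace ℝ (Fin d)) 1 \ {0},
            ENNReal.ofReal (radial γ χ R x) ^ q) := by
  obtain ⟨κ, hκ0, hκ1, -, Λ, hΛ1, ν, hν0, hν1, lam, hlam, N₁, hN₁, key⟩ :=
    exists_slab_lintegral_bound d K hK hKd (κ₁ := min (κ₀ / 4) (c₀ / (32 * C₀))) hc₀ hC₀ hκ₀
      (by positivity)
  have hd2 : (2 : ℝ) ≤ d := by exact_mod_cast hK.trans hKd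
  have hκ4 : 4 * κ ≤ κ₀ := by
    have := hκ1.trans (min_le_left _ _); linarith
  have hκc : C₀ * (2 * κ) ≤ c₀ / 16 := by
    have := hκ1.trans (min_le_right _ _)
    rw [le_div_iff₀ (by positivity)] at this
    linarith
  -- `β ≤ D δ/N` by `beta_le`. A grid spacing `H/N` with `c₀ H > 16 D` separates slabs of equal scale,
  -- and a small ratio `a` separates different scales.
  set D : ℝ := 3 * d * C₀ * Λ ^ d with hD
  have hD0 : 0 < D := by positivity
  set H : ℝ := 17 * D / c₀ with hH
  have hH0 : 0 < H := by positivity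
  have hHD : c₀ * H = 17 * D := by rw [hH]; field_simp
  set a : ℝ := min (min (1 / (8 * d)) (c₀ / (12 * C₀))) (c₀ / (32 * C₀)) with ha
  have ha0 : 0 < a := by positivity
  have ha1 : 8 * d * a ≤ 1 := by
    have : a ≤ 1 / (8 * d) := (min_le_left _ _).trans (min_le_left _ _)
    rw [le_div_iff₀ (by positivity)] at this
    linarith
  have ha2 : 3 * C₀ * a ≤ c₀ / 4 := by
    have : a ≤ c₀ / (12 * C₀) := (min_le_left _ _).trans (min_le_right _ _)
    rw [le_div_iff₀ (by positivity)] at this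
    linarith
  have ha3 : 2 * C₀ * a ≤ c₀ / 16 := by
    have : a ≤ c₀ / (32 * C₀) := min_le_right _ _
    rw [le_div_iff₀ (by positivity)] at this
    linarith
  have ha4 : a < 1 := by nlinarith
  set N₀ : ℝ := max (max N₁ (16 * D / c₀)) (max (D / C₀) (32 * C₀ * D / c₀ ^ 2 + 1)) with hN₀
  have hN₀1 : 1 ≤ N₀ := hN₁.trans ((le_max_left _ _).trans (le_max_left _ _))
  refine ⟨κ, hκ0, hκ4, min ν (1 / 4) ^ d * (κ / (4 * H)), by positivity, lam / Λ, by positivity,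
    N₀, hN₀1, a, ha0, ha4, ?_⟩
  intro tc γ χ hγ hχ hc hχ0 hχ1 hχκ hχs k R hk hkK hR
  have key' := key tc γ χ hγ hχ hc hχ0 hχ1 hχκ hχs k
  have hN₀' : ∀ N, N₀ ≤ N → N₁ ≤ N ∧ D / N ≤ c₀ / 16 ∧ D / N ≤ C₀ := by
    intro N hN
    have hN0 : 0 < N := by linarith
    have e1 : 16 * D / c₀ ≤ N := ((le_max_right _ _).trans (le_max_left _ _)).trans hN
    have e2 : D / C₀ ≤ N := ((le_max_left _ _).trans (le_max_right _ _)).trans hN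
    rw [div_le_iff₀ hc₀] at e1
    rw [div_le_iff₀ hC₀] at e2
    refine ⟨((le_max_left _ _).trans (le_max_left _ _)).trans hN, ?_, ?_⟩
    · rw [div_le_iff₀ hN0]; linarith
    · rw [div_le_iff₀ hN0]; linarith
  have hframe : ∀ t : ℝ, ∃ f, |t - tc| ≤ κ₀ → IsFrame γ K c₀ t f := by
    intro t
    by_cases ht : |t - tc| ≤ κ₀
    · obtain ⟨f, hf⟩ := hγ.exists_frame t ht
      exact ⟨f, fun _ => hf⟩
    · exact ⟨EuclideanSpace.basisFun (Fin d) ℝ, fun h => absurd h ht⟩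
  choose F hF using hframe
  set z : Fin d := ⟨0, by omega⟩ with hz
  have hgrid : ∀ N, 0 < N → ∀ i, i < gridCard κ H N →
      |tc + i * (H / N) - tc| ≤ κ / 4 ∧ |tc + i * (H / N) - tc| ≤ κ ∧
        IsFrame γ K c₀ (tc + i * (H / N)) (F (tc + i * (H / N))) := by
    intro N hN i hi
    have h1 : |tc + i * (H / N) - tc| ≤ κ / 4 := by
      rw [add_sub_cancel_left, abs_of_nonneg (by positivity)]
      exact grid_le hκ0 hH0 hN hi
    exact ⟨h1, by linarith, hF _ (by linarith)⟩
  constructor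
  · intro N hN hNk
    obtain ⟨n1, n2, -⟩ := hN₀' N hN
    have hN0 : 0 < N := by linarith
    have hN1 : 1 ≤ N := hN₀1.trans hN
    set m : Fin d := ⟨k - 1, by omega⟩ with hm
    have hmk : (m : ℕ) + 1 = k := by simp only [hm]; omega
    have hNk' : N ^ k = 1 * R := by rw [one_mul]; exact hNk
    have hM1 : 1 ≤ Λ * N := one_le_mul_of_one_le_of_one_le hΛ1 hN1
    have hβ := beta_le (d := d) (by omega) (hkK.trans hKd) hC₀.le hΛ1 hN0 hR hNk'
    rw [← hD] at hβ
    constructor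
    · intro q hq
      refine (scaleMass_le (k := k) (d := d) hν0 hlam hΛ1 hκ0 hH0 one_pos hN0 hR (by linarith)
        (v := ENNReal.ofReal (min ν (1 / 4) ^ d *
      (1 * ((Λ * N) ^ (k * (k - 1) / 2) / R ^ (k - 1))))) le_rfl).trans ?_
      rw [← nsmul_eq_mul, ← Finset.card_range (gridCard κ H N), ← Finset.sum_const]
      refine sum_le_lintegral_of_disjoint _
        (fun i : ℕ => slab (F (tc + i * (H / N))) z m k ν 1 (Λ * N) R) _ _ _ ?_
        (fun i _ => measurableSet_slab _ _ _ _ _ _ _ _) (fun i _ => slab_subset _ _ _ _ _ _ _ _) ?_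
      · have hdis : ∀ i j : ℕ, i < j → i < gridCard κ H N → j < gridCard κ H N →
            Disjoint (slab (F (tc + i * (H / N))) z m k ν 1 (Λ * N) R)
              (slab (F (tc + j * (H / N))) z m k ν 1 (Λ * N) R) := by
          intro i j hij hi hj
          rw [Set.disjoint_left]
          intro x hx hx'
          obtain ⟨-, g1, g2⟩ := hgrid N hN0 i hi
          obtain ⟨-, g3, g4⟩ := hgrid N hN0 j hj
          obtain ⟨g5, g6⟩ := abs_sub_grid tc (H / N) i j hij (by positivity)
          have := abs_sub_le_of_mem_slab_top hγ hc₀ hκ4 hκ0.le hκc g2 g4 g1 g3 g5 hx hx' rfl hk hkK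
            hmk hν1 hM1 hR hβ (by rw [mul_one_div]; exact n2)
          have h2 : c₀ / 8 * (H / N) ≤ 2 * (D * (1 / N)) := le_trans (by gcongr) this
          rw [show c₀ / 8 * (H / N) = (c₀ * H) / 8 * (1 / N) by ring, hHD] at h2
          have : 0 < D * (1 / N) := by positivity
          linarith
        intro i hi j hj hij
        rw [Finset.coe_range, mem_Iio] at hi hj
        rcases lt_or_gt_of_ne hij with h | h
        · exact hdis i j h hi hj
        · exact (hdis j i h hj hi).symm
      · intro i hi
        obtain ⟨g0, g1, g2⟩ := hgrid N hN0 i (Finset.mem_range.mp hi)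
        refine le_trans ?_ ((key' z m _ R 1 N _ hk hkK rfl g0 g2 one_pos le_rfl n1 hNk'
          (by rw [hmk, hNk]) (Or.inl ⟨hmk, rfl⟩)).1 q hq)
        gcongr
        exact le_volume_box (by omega) (hkK.trans hKd) hν0 one_pos (by positivity) hR
          (fun _ => rfl) hmk.ge _
    · have hN00 := hgrid N hN0 0 (by unfold gridCard; omega)
      obtain ⟨g0, -, g2⟩ := hN00
      obtain ⟨x, hx, hx2⟩ := (key' z m _ R 1 N _ hk hkK rfl g0 g2 one_pos le_rfl n1 hNk'
          (by rw [hmk, hNk]) (Or.inl ⟨hmk, rfl⟩)).2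
      exact ⟨x, hx, by rw [div_div]; exact hx2⟩
  · intro hkd htop s N hNs q hq
    set m : Fin d := ⟨k, hkd⟩ with hm
    have hmk : (m : ℕ) = k := rfl
    -- Each scale `δ = a^{l+1}` satisfies the smallness requirements, and so does `β = D δ/N`.
    have hscale : ∀ l ∈ s, 0 < a ^ (l + 1) ∧ a ^ (l + 1) ≤ a ∧ N₀ ≤ N l ∧ 1 ≤ N l := by
      intro l hl
      have h1 : 0 < a ^ (l + 1) := by positivity
      have h2 : a ^ (l + 1) ≤ a := pow_le_of_le_one ha0.le ha4.le (by omega)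
      have h3 := (hNs l hl).1
      have h4 : 0 < N l := by
        by_contra hcon
        have := mul_nonpos_of_nonneg_of_nonpos h1.le (not_lt.mp hcon)
        linarith
      have h5 : a ^ (l + 1) * N l ≤ N l := mul_le_of_le_one_left h4.le (h2.trans ha4.le)
      exact ⟨h1, h2, h3.trans h5, by linarith⟩
    have hβ : ∀ l ∈ s, 3 * d * C₀ * ((Λ * N l) ^ (k - 1) / R) ≤ D * (a ^ (l + 1) / N l) :=
      fun l hl => beta_le (by omega) (hkK.trans hKd) hC₀.le hΛ1 (by linarith [(hscale l hl).2.2.2]) hR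
        (hNs l hl).2
    have hβ2 : ∀ l ∈ s, D * (a ^ (l + 1) / N l) ≤ c₀ / 16 * a ^ (l + 1) ∧
        D * (a ^ (l + 1) / N l) ≤ C₀ * a ^ (l + 1) ∧ D * (a ^ (l + 1) / N l) ≤ c₀ / 16 := by
      intro l hl
      obtain ⟨e1, e2, e3, e4⟩ := hscale l hl
      obtain ⟨-, n2, n3⟩ := hN₀' _ e3
      rw [show D * (a ^ (l + 1) / N l) = D / N l * a ^ (l + 1) by ring]
      have h1 : D / N l * a ^ (l + 1) ≤ c₀ / 16 * a ^ (l + 1) := by gcongr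
      refine ⟨h1, by gcongr, h1.trans ?_⟩
      exact mul_le_of_le_one_right (by positivity) (e2.trans ha4.le)
    have hδc : ∀ l ∈ s, 2 * C₀ * a ^ (l + 1) ≤ c₀ / 16 := fun l hl =>
      le_trans (by gcongr; exact (hscale l hl).2.1) ha3
    have hM1 : ∀ l ∈ s, 1 ≤ Λ * N l := fun l hl =>
      one_le_mul_of_one_le_of_one_le hΛ1 (hscale l hl).2.2.2
    set B : (Σ _ : ℕ, ℕ) → Set (EuclideanSpace ℝ (Fin d)) := fun p =>
      slab (F (tc + p.2 * (H / N p.1))) z m k ν (a ^ (p.1 + 1)) (Λ * N p.1) R with hB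
    have hdis1 : ∀ l ∈ s, ∀ i j : ℕ, i < j → i < gridCard κ H (N l) → j < gridCard κ H (N l) →
        Disjoint (B ⟨l, i⟩) (B ⟨l, j⟩) := by
      intro l hl i j hij hi hj
      rw [Set.disjoint_left]
      intro x hx hx'
      obtain ⟨e1, e2, e3, e4⟩ := hscale l hl
      have hN0 : 0 < N l := by linarith
      obtain ⟨-, g1, g2⟩ := hgrid (N l) hN0 i hi
      obtain ⟨-, g3, g4⟩ := hgrid (N l) hN0 j hj
      obtain ⟨g5, g6⟩ := abs_sub_grid tc (H / N l) i j hij (by positivity)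
      obtain ⟨b1, -, b3⟩ := hβ2 l hl
      have := abs_sub_le_of_mem_slab_same hγ hc₀ hκ4 hκ0.le hκc g2 g4 g1 g3 g5 hx hx' rfl hk hkK
        hmk htop hν1 (hM1 l hl) hR e1.le (hδc l hl) (hβ l hl) b3
        (b1.trans (by gcongr; norm_num))
      have h2 : c₀ / 2 * a ^ (l + 1) * (H / N l) ≤ 2 * (D * (a ^ (l + 1) / N l)) :=
        le_trans (by gcongr) this
      rw [show c₀ / 2 * a ^ (l + 1) * (H / N l) = (c₀ * H) / 2 * (a ^ (l + 1) / N l) by ring,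
        hHD] at h2
      have : 0 < D * (a ^ (l + 1) / N l) := by positivity
      linarith
    have hdis2 : ∀ l ∈ s, ∀ l' ∈ s, l < l' → ∀ i j : ℕ, i < gridCard κ H (N l) →
        j < gridCard κ H (N l') → Disjoint (B ⟨l, i⟩) (B ⟨l', j⟩) := by
      intro l hl l' hl' hll i j hi hj
      rw [Set.disjoint_left]
      intro x hx hx'
      obtain ⟨e1, e2, e3, e4⟩ := hscale l hl
      obtain ⟨e1', e2', e3', e4'⟩ := hscale l' hl'
      have hN0 : 0 < N l := by linarith
      have hN0' : 0 < N l' := by linarith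
      obtain ⟨-, g1, g2⟩ := hgrid (N l) hN0 i hi
      obtain ⟨-, g3, g4⟩ := hgrid (N l') hN0' j hj
      obtain ⟨b1, -, b3⟩ := hβ2 l hl
      obtain ⟨b1', b2', b3'⟩ := hβ2 l' hl'
      have hδδ : a ^ (l' + 1) ≤ a * a ^ (l + 1) := by
        rw [← pow_succ']
        exact pow_le_pow_of_le_one ha0.le ha4.le (by omega)
      have := sq_le_of_mem_slab_of_mem_slab hγ hc₀ hC₀ hκ4 hκ0.le hκc g2 g4 g1 g3 hx hx' rfl hk hkK
        hmk htop hν1 (hM1 l hl) (hM1 l' hl') hR e1 e1'.le (hδc l hl) (hβ l hl) (hβ l' hl') b3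
        (b1.trans (by gcongr; norm_num)) b2' (b1'.trans (by gcongr; norm_num)) (by
          calc 3 * C₀ * a ^ (l' + 1) ≤ 3 * C₀ * (a * a ^ (l + 1)) := by gcongr
            _ = 3 * C₀ * a * a ^ (l + 1) := by ring
            _ ≤ _ := by gcongr)
      -- The quantity `δ/N = N^{k-1}/R` is increasing in `δ`.
      have hq : ∀ l ∈ s, a ^ (l + 1) / N l = N l ^ (k - 1) / R := by
        intro l hl
        have h0 : 0 < N l := by linarith [(hscale l hl).2.2.2]
        rw [div_eq_div_iff h0.ne' hR.ne', ← pow_succ, show k - 1 + 1 = k by omega, (hNs l hl).2]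
      have hNN : N l' ≤ N l := by
        refine le_of_pow_le_pow_left₀ (show k ≠ 0 by omega) hN0.le ?_
        rw [(hNs l hl).2, (hNs l' hl').2]
        exact mul_le_mul_of_nonneg_right (hδδ.trans (mul_le_of_le_one_left e1.le ha4.le)) hR.le
      have hle : a ^ (l' + 1) / N l' ≤ a ^ (l + 1) / N l := by
        rw [hq l hl, hq l' hl']; gcongr
      have h3 : (c₀ / 2 * a ^ (l + 1)) ^ 2 / (4 * C₀) ≤ 2 * (D * (a ^ (l + 1) / N l)) := by
        have := mul_le_mul_of_nonneg_left hle hD0.le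
        linarith
      rw [div_le_iff₀ (by positivity), show 2 * (D * (a ^ (l + 1) / N l)) * (4 * C₀) =
        8 * C₀ * D * a ^ (l + 1) / N l by ring, le_div_iff₀ hN0] at h3
      have h4 : c₀ ^ 2 * (a ^ (l + 1) * N l) ≤ 32 * C₀ * D := by
        refine le_of_mul_le_mul_right ?_ e1
        linarith
      have h5 : 32 * C₀ * D / c₀ ^ 2 + 1 ≤ a ^ (l + 1) * N l :=
        ((le_max_right _ _).trans (le_max_right _ _)).trans (hNs l hl).1
      rw [mul_comm, ← le_div_iff₀ (by positivity)] at h4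
      linarith
    have hsum : ENNReal.ofReal (∑ l ∈ s, scaleMass k (min ν (1 / 4) ^ d * (κ / (4 * H))) (lam / Λ)
        (a ^ (l + 1)) (N l) R q) ≤ ∑ p ∈ s.sigma (fun l => Finset.range (gridCard κ H (N l))),
          ENNReal.ofReal (lam / (Λ * N p.1)) ^ q * ENNReal.ofReal (min ν (1 / 4) ^ d *
      (a ^ (p.1 + 1) * ((Λ * N p.1) ^ (k * (k - 1) / 2) / R ^ (k - 1)))) := by
      rw [Finset.sum_sigma, ENNReal.ofReal_sum_of_nonneg]
      · refine Finset.sum_le_sum fun l hl => ?_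
        simp only []
        rw [Finset.sum_const, Finset.card_range, nsmul_eq_mul]
        obtain ⟨e1, e2, e3, e4⟩ := hscale l hl
        exact scaleMass_le hν0 hlam hΛ1 hκ0 hH0 e1 (by linarith) hR (by linarith) le_rfl
      · intro l hl
        obtain ⟨e1, e2, e3, e4⟩ := hscale l hl
        have : 0 < N l := by linarith
        unfold scaleMass
        positivity
    refine hsum.trans (sum_le_lintegral_of_disjoint _ B _ _ _ ?_
      (fun p _ => measurableSet_slab _ _ _ _ _ _ _ _) (fun p _ => slab_subset _ _ _ _ _ _ _ _) ?_)
    · rintro ⟨l, i⟩ hp ⟨l', j⟩ hp' hne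
      rw [Finset.mem_coe, Finset.mem_sigma, Finset.mem_range] at hp hp'
      obtain ⟨hl, hi⟩ := hp
      obtain ⟨hl', hj⟩ := hp'
      simp only at hl hi hl' hj
      rcases lt_trichotomy l l' with h | h | h
      · exact hdis2 l hl l' hl' h i j hi hj
      · subst h
        have hij : i ≠ j := fun e => hne (by rw [e])
        rcases lt_or_gt_of_ne hij with h | h
        · exact hdis1 l hl i j h hi hj
        · exact (hdis1 l hl j i h hj hi).symm
      · exact (hdis2 l' hl' l hl h j i hj hi).symm
    · rintro ⟨l, i⟩ hp
      rw [Finset.mem_sigma, Finset.mem_range] at hp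
      obtain ⟨hl, hi⟩ := hp
      simp only at hl hi
      obtain ⟨e1, e2, e3, e4⟩ := hscale l hl
      have hN0 : 0 < N l := by linarith
      obtain ⟨g0, g1, g2⟩ := hgrid (N l) hN0 i hi
      have hRN : R ≤ N l ^ ((m : ℕ) + 1) := by
        rw [hmk, pow_succ, (hNs l hl).2]
        have : 1 ≤ a ^ (l + 1) * N l := hN₀1.trans (hNs l hl).1
        calc R ≤ R * (a ^ (l + 1) * N l) := le_mul_of_one_le_right hR.le this
          _ = _ := by ring
      have h8 : 8 * d * a ^ (l + 1) ≤ 1 := le_trans (by gcongr) ha1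
      refine le_trans ?_ ((key' z m _ R (a ^ (l + 1)) (N l) _ hk hkK rfl g0 g2 e1 (e2.trans ha4.le)
        (hN₀' _ e3).1 (hNs l hl).2 hRN (Or.inr ⟨hmk, h8⟩)).1 q hq)
      gcongr
      exact le_volume_box (by omega) (hkK.trans hKd) hν0 e1 (by positivity) hR
        (fun h => by omega) (by omega) _

/-! ### Existence of adapted frames -/

/-- Linear independence in quantitative form. -/
theorem exists_le_norm_sum {ι E : Type*} [Fintype ι] [NormedAddCommGroup E] [NormedSpace ℝ E]
    {v : ι → E} (hv : LinearIndependent ℝ v) :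
    ∃ c : ℝ, 0 < c ∧ ∀ x : ι → ℝ, c * ‖x‖ ≤ ‖∑ i, x i • v i‖ := by
  obtain ⟨C, hC, h⟩ := LinearMap.exists_antilipschitzWith (Fintype.linearCombination ℝ v)
    (LinearMap.ker_eq_bot.mpr (linearIndependent_iff_injective_fintypeLinearCombination.mp hv))
  refine ⟨(C : ℝ)⁻¹, by positivity, fun x => ?_⟩
  have := h.le_mul_dist x 0
  rw [dist_zero_right, map_zero, dist_zero_right, Fintype.linearCombination_apply] at this
  rw [inv_mul_le_iff₀ (by positivity)]
  exact this

/-- The bound of `exists_le_norm_sum` is stable under small perturbations of the vectors. -/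
theorem half_mul_le_norm_sum {n : ℕ} {E : Type*} [NormedAddCommGroup E] [NormedSpace ℝ E]
    {v w : Fin n → E} {c : ℝ} (hv : ∀ x : Fin n → ℝ, c * ‖x‖ ≤ ‖∑ i, x i • v i‖)
    (hw : ∀ i, n * ‖w i - v i‖ ≤ c / 2) (x : Fin n → ℝ) :
    c / 2 * ‖x‖ ≤ ‖∑ i, x i • w i‖ := by
  have h1 : ‖∑ i, x i • (w i - v i)‖ ≤ c / 2 * ‖x‖ := by
    rcases Nat.eq_zero_or_pos n with rfl | hn
    · have hx : ‖x‖ = 0 := by rw [Subsingleton.elim x 0, norm_zero]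
      simp [hx]
    have hn' : (0 : ℝ) < n := by exact_mod_cast hn
    calc ‖∑ i, x i • (w i - v i)‖ ≤ ∑ i, ‖x‖ * (c / 2 / n) := by
          refine norm_sum_le_of_le _ fun i _ => ?_
          rw [norm_smul]
          refine mul_le_mul (norm_le_pi_norm x i) ?_ (norm_nonneg _) (norm_nonneg _)
          rw [le_div_iff₀ hn', mul_comm]
          exact hw i
      _ = c / 2 * ‖x‖ := by
          rw [Finset.sum_const, Finset.card_univ, Fintype.card_fin, nsmul_eq_mul]
          field_simp
  have h2 : ∑ i, x i • v i = ∑ i, x i • w i - ∑ i, x i • (w i - v i) := by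
    rw [← Finset.sum_sub_distrib]
    refine Finset.sum_congr rfl fun i _ => ?_
    rw [smul_sub, sub_sub_cancel]
  have h3 := hv x
  rw [h2] at h3
  have h4 := norm_sub_le (∑ i, x i • w i) (∑ i, x i • (w i - v i))
  linarith

/-- The Gram–Schmidt basis of the derivatives is an adapted frame; its diagonal entries are the
distances of each derivative from the span of the preceding ones. -/
theorem exists_isFrame {d K : ℕ} (hKd : K ≤ d) {γ : ℝ → EuclideanSpace ℝ (Fin d)} {t c₀ : ℝ}
    (hc₀ : 0 < c₀)
    (h : ∀ x : Fin K → ℝ, c₀ * ‖x‖ ≤ ‖∑ i, x i • iteratedDeriv ((i : ℕ) + 1) γ t‖) :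
    ∃ f, IsFrame γ K c₀ t f := by
  set e : Fin d → EuclideanSpace ℝ (Fin d) :=
    fun j => if (j : ℕ) < K then iteratedDeriv ((j : ℕ) + 1) γ t else 0 with he
  have hcard : Module.finrank ℝ (EuclideanSpace ℝ (Fin d)) = Fintype.card (Fin d) := by simp
  set f := InnerProductSpace.gramSchmidtOrthonormalBasis hcard e with hf
  have htri : ∀ i j : Fin d, i < j → inner ℝ (f j) (e i) = 0 := fun i j hij =>
    InnerProductSpace.gramSchmidtOrthonormalBasis_inv_triangular hcard e hij
  refine ⟨f, ?_, ?_⟩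
  · intro j i hi hiK hij
    have := htri ⟨i - 1, by omega⟩ j (by rw [Fin.lt_def]; simp only; omega)
    rw [he] at this
    simp only at this
    rwa [if_pos (by omega), Nat.sub_add_cancel hi] at this
  · intro j hj
    have hspan : ∀ w ∈ Submodule.span ℝ (e '' Set.Iio j), ∃ x : Fin K → ℝ, x ⟨j, by omega⟩ = 0 ∧
        w = ∑ i, x i • iteratedDeriv ((i : ℕ) + 1) γ t := by
      intro w hw
      induction hw using Submodule.span_induction with
      | mem w hw =>
        obtain ⟨i, hi, rfl⟩ := hw
        have hij : (i : ℕ) < j := hi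
        refine ⟨Pi.single ⟨i, by omega⟩ 1, ?_, ?_⟩
        · rw [Pi.single_eq_of_ne]
          rw [ne_eq, Fin.mk.injEq]
          omega
        · rw [Finset.sum_eq_single (⟨i, by omega⟩ : Fin K)]
          · rw [Pi.single_eq_same, one_smul, he]
            simp only
            rw [if_pos (by omega)]
          · intro b _ hb
            rw [Pi.single_eq_of_ne hb, zero_smul]
          · exact fun h => absurd (Finset.mem_univ _) h
      | zero => exact ⟨0, rfl, by simp⟩
      | add u v _ _ hu hv =>
        obtain ⟨x, hx, rfl⟩ := hu
        obtain ⟨y, hy, rfl⟩ := hv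
        refine ⟨x + y, by rw [Pi.add_apply, hx, hy, add_zero], ?_⟩
        simp only [Pi.add_apply, add_smul, Finset.sum_add_distrib]
      | smul r u _ hu =>
        obtain ⟨x, hx, rfl⟩ := hu
        refine ⟨r • x, by rw [Pi.smul_apply, hx, smul_zero], ?_⟩
        simp only [Pi.smul_apply, smul_assoc, Finset.smul_sum]
    -- Up to normalisation `f j` is `e j` minus its projection `w` to the preceding span.
    set g := InnerProductSpace.gramSchmidt ℝ e j with hg
    set w := ∑ i ∈ Finset.Iio j,
      (Submodule.span ℝ {InnerProductSpace.gramSchmidt ℝ e i}).starProjection (e j) with hw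
    have hgw : g = e j - w := InnerProductSpace.gramSchmidt_def ℝ e j
    have hwmem : w ∈ Submodule.span ℝ (e '' Set.Iio j) := by
      rw [← InnerProductSpace.span_gramSchmidt_Iio ℝ e j]
      refine Submodule.sum_mem _ fun i hi => ?_
      refine Submodule.span_mono ?_ (Submodule.starProjection_apply_mem _ _)
      rw [Set.singleton_subset_iff]
      exact ⟨i, Finset.mem_Iio.mp hi, rfl⟩
    have hej : e j = iteratedDeriv ((j : ℕ) + 1) γ t := by
      rw [he]; simp only; rw [if_pos (by omega)]
    have hgnorm : c₀ ≤ ‖g‖ := by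
      obtain ⟨x, hx, hwx⟩ := hspan w hwmem
      have h1 := h (Pi.single (⟨j, by omega⟩ : Fin K) (1 : ℝ) - x)
      have h2 : ∑ i, (Pi.single (⟨j, by omega⟩ : Fin K) (1 : ℝ) - x : Fin K → ℝ) i •
          iteratedDeriv ((i : ℕ) + 1) γ t = g := by
        simp only [Pi.sub_apply, sub_smul, Finset.sum_sub_distrib]
        rw [hgw, ← hwx, hej]
        congr 1
        rw [Finset.sum_eq_single (⟨j, by omega⟩ : Fin K)]
        · rw [Pi.single_eq_same, one_smul]
        · intro b _ hb
          rw [Pi.single_eq_of_ne hb, zero_smul]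
        · exact fun h => absurd (Finset.mem_univ _) h
      rw [h2] at h1
      have h3 := norm_le_pi_norm (Pi.single (⟨j, by omega⟩ : Fin K) (1 : ℝ) - x : Fin K → ℝ) ⟨j, by omega⟩
      rw [Pi.sub_apply, Pi.single_eq_same, hx, sub_zero, norm_one] at h3
      exact (le_mul_of_one_le_right hc₀.le h3).trans h1
    have hg0 : 0 < ‖g‖ := hc₀.trans_le hgnorm
    have hfj : f j = (‖g‖⁻¹ : ℝ) • g := by
      have : InnerProductSpace.gramSchmidtNormed ℝ e j = (‖g‖⁻¹ : ℝ) • g := rfl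
      rw [hf, InnerProductSpace.gramSchmidtOrthonormalBasis_apply hcard, this]
      rw [this]
      exact smul_ne_zero (inv_ne_zero hg0.ne') (norm_pos_iff.mp hg0)
    have hfw : inner ℝ (f j) w = 0 := by
      have : w ∈ (ℝ ∙ f j)ᗮ := by
        refine Submodule.span_le.mpr ?_ hwmem
        rintro _ ⟨i, hi, rfl⟩
        exact Submodule.mem_orthogonal_singleton_iff_inner_right.mpr (htri i j hi)
      exact Submodule.mem_orthogonal_singleton_iff_inner_right.mp this
    have hfe : inner ℝ (f j) (e j) = ‖g‖ := by
      have : e j = g + w := by rw [hgw, sub_add_cancel]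
      rw [this, inner_add_right, hfw, add_zero, hfj, inner_smul_left, real_inner_self_eq_norm_sq]
      simp only [conj_trivial]
      field_simp
    rw [← hej, hfe]
    exact hgnorm

/-- Near `t₀` the curve coincides with a globally smooth curve that has uniformly nondegenerate
frames. -/
theorem exists_isNondegenerate {d K : ℕ} (hKd : K ≤ d) {a b : ℝ} (hab : a < b)
    {γ : ℝ → EuclideanSpace ℝ (Fin d)} (hγ : ContDiffOn ℝ ∞ γ (Set.Icc a b)) {t₀ : ℝ}
    (ht₀ : t₀ ∈ Set.Icc a b)
    (hind : LinearIndependent ℝ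
      (fun j : Fin K => iteratedDerivWithin ((j : ℕ) + 1) γ (Set.Icc a b) t₀)) :
    ∃ tc κ₀ c₀ C₀ : ℝ, 0 < κ₀ ∧ 0 < c₀ ∧ 0 < C₀ ∧ ∃ g : ℝ → EuclideanSpace ℝ (Fin d),
      IsNondegenerate g K c₀ C₀ tc κ₀ ∧ ∀ t, |t - tc| ≤ κ₀ → t ∈ Set.Ioo a b ∧ g t = γ t ∧
        ∀ i, iteratedDeriv i g t = iteratedDerivWithin i γ (Set.Icc a b) t := by
  obtain ⟨c, hc, hlin⟩ := exists_le_norm_sum hind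
  -- Nondegeneracy persists near `t₀`, which allows moving to an interior point.
  have hev : ∀ᶠ t in nhdsWithin t₀ (Set.Icc a b), ∀ j : Fin K,
      K * ‖iteratedDerivWithin ((j : ℕ) + 1) γ (Set.Icc a b) t -
        iteratedDerivWithin ((j : ℕ) + 1) γ (Set.Icc a b) t₀‖ ≤ c / 2 := by
    rw [Filter.eventually_all]
    intro j
    have hcont : ContinuousWithinAt (iteratedDerivWithin ((j : ℕ) + 1) γ (Set.Icc a b))
        (Set.Icc a b) t₀ := hγ.continuousOn_iteratedDerivWithin
      (by exact_mod_cast le_top) (uniqueDiffOn_Icc hab) t₀ ht₀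
    have h1 : Filter.Tendsto (fun t => K * ‖iteratedDerivWithin ((j : ℕ) + 1) γ (Set.Icc a b) t -
        iteratedDerivWithin ((j : ℕ) + 1) γ (Set.Icc a b) t₀‖) (nhdsWithin t₀ (Set.Icc a b))
        (nhds (K * ‖iteratedDerivWithin ((j : ℕ) + 1) γ (Set.Icc a b) t₀ -
        iteratedDerivWithin ((j : ℕ) + 1) γ (Set.Icc a b) t₀‖)) :=
      ((hcont.tendsto.sub_const _).norm).const_mul _
    rw [sub_self, norm_zero, mul_zero] at h1
    exact h1.eventually_le_const (by positivity)
  obtain ⟨U, hU, ht₀U, hUsub⟩ := mem_nhdsWithin.mp hev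
  have hcl : t₀ ∈ closure (Set.Ioo a b) := by rw [closure_Ioo hab.ne]; exact ht₀
  obtain ⟨tc, htcU, htc⟩ := mem_closure_iff.mp hcl U hU ht₀U
  obtain ⟨ε, hε, hball⟩ := Metric.isOpen_iff.mp (hU.inter isOpen_Ioo) tc ⟨htcU, htc⟩
  set κ₀ := ε / 4 with hκ₀
  have hκ : 0 < κ₀ := by positivity
  have hmem : ∀ t, |t - tc| < 4 * κ₀ → t ∈ U ∧ t ∈ Set.Ioo a b := fun t ht =>
    hball (by rw [Metric.mem_ball, Real.dist_eq]; linarith)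
  let ψ : ContDiffBump tc := ⟨2 * κ₀, 3 * κ₀, by positivity, by linarith⟩
  have hψ1 : ∀ t, |t - tc| ≤ 2 * κ₀ → ψ t = 1 := fun t ht =>
    ψ.one_of_mem_closedBall (by rw [Metric.mem_closedBall, Real.dist_eq]; exact ht)
  set g : ℝ → EuclideanSpace ℝ (Fin d) := fun t => ψ t • γ t with hg
  have hCD : ContDiff ℝ ∞ g := by
    rw [contDiff_iff_contDiffAt]
    intro t
    by_cases ht : |t - tc| < 4 * κ₀
    · exact ψ.contDiff.contDiffAt.smul (hγ.contDiffAt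
        (Icc_mem_nhds (hmem t ht).2.1 (hmem t ht).2.2))
    · have ht' : t ∉ tsupport ψ := by
        rw [ψ.tsupport_eq, Metric.mem_closedBall, Real.dist_eq]
        show ¬ |t - tc| ≤ 3 * κ₀
        push Not at ht ⊢
        linarith
      have h0 := notMem_tsupport_iff_eventuallyEq.mp ht'
      refine (contDiffAt_const (c := 0)).congr_of_eventuallyEq ?_
      filter_upwards [h0] with s hs
      rw [hg]
      simp only
      rw [hs, Pi.zero_apply, zero_smul]
  have hagree : ∀ t, |t - tc| ≤ κ₀ → t ∈ Set.Ioo a b ∧ g t = γ t ∧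
        ∀ i, iteratedDeriv i g t = iteratedDerivWithin i γ (Set.Icc a b) t := by
    intro t ht
    have htm := (hmem t (by linarith)).2
    refine ⟨htm, ?_, fun i => ?_⟩
    · rw [hg]; simp only; rw [hψ1 t (by linarith), one_smul]
    · have hn : Set.Icc a b ∈ nhds t := Icc_mem_nhds htm.1 htm.2
      rw [iteratedDerivWithin_eq_iteratedDeriv (n := i) (uniqueDiffOn_Icc hab)
        ((hγ.contDiffAt hn).of_le (by exact_mod_cast le_top)) (Ioo_subset_Icc_self htm)]
      refine Filter.EventuallyEq.iteratedDeriv_eq i ?_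
      have : Metric.ball tc (2 * κ₀) ∈ nhds t := Metric.isOpen_ball.mem_nhds (by
        rw [Metric.mem_ball, Real.dist_eq]; linarith)
      filter_upwards [this] with s hs
      rw [Metric.mem_ball, Real.dist_eq] at hs
      rw [hg]; simp only; rw [hψ1 s hs.le, one_smul]
  have hbd : ∃ C₀ : ℝ, 0 < C₀ ∧ ∀ t, |t - tc| ≤ κ₀ → ∀ i, i ≤ K + 1 → ‖iteratedDeriv i g t‖ ≤ C₀ := by
    have hcont : Continuous (fun t => ∑ i ∈ Finset.range (K + 2), ‖iteratedDeriv i g t‖) :=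
      continuous_finsetSum _ fun i _ => (hCD.continuous_iteratedDeriv i (by exact_mod_cast le_top)).norm
    obtain ⟨C, hC⟩ := (isCompact_closedBall tc κ₀).exists_bound_of_continuousOn hcont.continuousOn
    refine ⟨max C 1, by positivity, fun t ht i hi => ?_⟩
    have h1 := hC t (by rw [Metric.mem_closedBall, Real.dist_eq]; exact ht)
    refine le_trans ?_ (le_max_left _ _)
    refine le_trans ?_ ((le_abs_self _).trans h1)
    exact Finset.single_le_sum (f := fun i => ‖iteratedDeriv i g t‖) (fun _ _ => norm_nonneg _)
      (Finset.mem_range.mpr (by omega))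
  obtain ⟨C₀, hC₀, hC⟩ := hbd
  refine ⟨tc, κ₀, c / 2, C₀, hκ, by positivity, hC₀, g, ⟨hCD, hC, fun t ht => ?_⟩, hagree⟩
  refine exists_isFrame hKd (by positivity) fun x => ?_
  obtain ⟨h1, -, h3⟩ := hagree t ht
  simp only [h3]
  exact half_mul_le_norm_sum hlin
    (hUsub ⟨(hmem t (by linarith)).1, Ioo_subset_Icc_self h1⟩) x

/-! ### Curves contained in a `K`-dimensional affine subspace -/

/-- If `γ^{(K+1)}` vanishes near `tc`, the curve stays in the affine `K`-plane through `γ(tc)`. -/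
theorem IsFrame.inner_sub_eq_zero {d K : ℕ} {γ : ℝ → EuclideanSpace ℝ (Fin d)} {c₀ tc κ : ℝ}
    (hγ : ContDiff ℝ ∞ γ) {f : OrthonormalBasis (Fin d) ℝ (EuclideanSpace ℝ (Fin d))}
    (hf : IsFrame γ K c₀ tc f) (hflat : ∀ t, |t - tc| ≤ κ → iteratedDeriv (K + 1) γ t = 0)
    {j : Fin d} (hj : K ≤ j) {t : ℝ} (ht : |t - tc| ≤ κ) : inner ℝ (f j) (γ t - γ tc) = 0 := by
  have key := abs_le_of_derivs_eq_zero (ρ := κ) (C := 0) (t₁ := tc) (K + 1)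
    (fun i t => inner ℝ (f j) (iteratedDeriv i γ t - if i = 0 then γ tc else 0)) ?_ ?_ ?_ t ht
  · simpa using key
  · intro i t
    have h1 := hasDerivAt_inner_iteratedDeriv hγ (f j) i t
    simp only [inner_sub_right, Nat.add_eq_zero_iff, one_ne_zero, and_false, if_false, sub_zero]
    exact h1.sub_const _
  · intro i hi
    rcases Nat.eq_zero_or_pos i with rfl | hi0
    · simp
    · simp only [hi0.ne', if_false, sub_zero]
      exact hf.inner_eq_zero j i hi0 (by omega) (by omega)
  · intro t ht
    simp [hflat t ht]

/-- For a curve in an affine `K`-plane, `μ̂` does not decay in the directions within `O(1/R)` of the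
orthogonal complement of that plane, a set of measure comparable to `R^{-K}`. -/
theorem exists_lower_bound_of_flat {d K : ℕ} (hKd : K < d) {γ : ℝ → EuclideanSpace ℝ (Fin d)}
    {c₀ C₀ tc κ₀ κ : ℝ} (hC₀ : 0 < C₀) (hκ : 0 < κ) (hκκ : κ ≤ κ₀)
    (hγ : IsNondegenerate γ K c₀ C₀ tc κ₀) {χ : ℝ → ℝ} (hχ : Continuous χ) (hc : HasCompactSupport χ)
    (hχ0 : ∀ t, 0 ≤ χ t) (hχ1 : ∀ t, |t - tc| ≤ κ / 2 → χ t = 1) (hχs : ∀ t, χ t ≠ 0 → |t - tc| ≤ κ)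
    (hflat : ∀ t, |t - tc| ≤ κ → iteratedDeriv (K + 1) γ t = 0) :
    ∃ lam : ℝ, 0 < lam ∧ ∃ c : ℝ, 0 < c ∧ ∀ R : ℝ, 1 ≤ R →
      (∀ q : ℝ, 1 ≤ q → ENNReal.ofReal (c / R ^ K * lam ^ q) ≤
          ∫⁻ x in Metric.ball (0 : EuclideanSpace ℝ (Fin d)) 1 \ {0},
            ENNReal.ofReal (radial γ χ R x) ^ q) ∧
        ∃ x, x ≠ 0 ∧ lam ≤ radial γ χ R x := by
  obtain ⟨f, hf⟩ := hγ.exists_frame tc (by rw [sub_self, abs_zero]; linarith)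
  have hd : (0 : ℝ) < d := by exact_mod_cast (by omega : 0 < d)
  -- With this `ν` the phase `R⟨x/|x|, γ(t) - γ(tc)⟩` is at most `1` on the support of the cutoff.
  set ν : ℝ := min (1 / (4 * d)) (1 / (2 * d * C₀ * κ)) with hν
  have hν0 : 0 < ν := by positivity
  have hν1 : ν ≤ 1 / (4 * d) := min_le_left _ _
  have hν2 : d * (2 * ν * C₀ * κ) ≤ 1 := by
    have : ν ≤ 1 / (2 * d * C₀ * κ) := min_le_right _ _
    rw [le_div_iff₀ (by positivity)] at this
    linarith
  refine ⟨κ / 2, by positivity, ν ^ d, by positivity, fun R hR => ?_⟩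
  have hR0 : 0 < R := by linarith
  set m : Fin d := ⟨K, hKd⟩ with hm
  set W : Fin d → ℝ := fun j => if (j : ℕ) < K then ν / R else 1 / (4 * d) with hW
  have hW1 : ∀ j, W j ≤ 1 / (4 * d) := by
    intro j
    simp only [hW]
    split_ifs
    · exact (div_le_self hν0.le hR).trans hν1
    · exact le_rfl
  have hW0 : ∀ j, 0 ≤ W j := by
    intro j; simp only [hW]; split_ifs <;> positivity
  have hsub : box f m 0 W ⊆ Metric.ball (0 : EuclideanSpace ℝ (Fin d)) 1 \ {0} := by
    intro x hx
    have h1 := half_le_norm_of_mem_box hx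
    refine ⟨?_, ?_⟩
    · rw [mem_ball_zero_iff]
      exact norm_lt_one_of_mem_box (fun j _ => by simpa using hW0 j) (fun j _ => hW1 j) hx
    · rintro rfl
      rw [norm_zero] at h1
      linarith
  have hpt : ∀ x ∈ box f m 0 W, κ / 2 ≤ radial γ χ R x := by
    intro x hx
    have hx1 := half_le_norm_of_mem_box hx
    have hx0 : 0 < ‖x‖ := by linarith
    refine le_trans ?_ (integral_mul_cos_le_norm_muHat hγ.contDiff.continuous hχ hc
      (R • (‖x‖⁻¹ • x)) (γ tc))
    have hphase : ∀ t, |t - tc| ≤ κ → |inner ℝ (R • (‖x‖⁻¹ • x)) (γ t - γ tc)| ≤ 1 := by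
      intro t ht
      rw [inner_smul_left, inner_smul_left, inner_eq_sum f, Finset.mul_sum, Finset.mul_sum]
      refine (Finset.abs_sum_le_sum_abs _ _).trans (le_trans (Finset.sum_le_sum
        (g := fun _ => 2 * ν * C₀ * κ) fun j _ => ?_) ?_)
      · by_cases hj : (j : ℕ) < K
        · have hjm : j ≠ m := by
            intro h; rw [h] at hj; simp [hm] at hj
          have h1 := hx.1 j hjm
          have h2 := hγ.abs_inner_sub_le hf (ρ := κ) (by rw [sub_self, abs_zero]; linarith) j
            (n := 1) le_rfl (by omega) (by omega) ht
          rw [pow_one] at h2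
          have h3 : |inner ℝ (f j) x| ≤ ν / R := by
            rw [abs_of_nonneg (by simpa using h1.1)]
            have := h1.2
            simpa only [hW, if_pos hj] using this
          have h4 : ‖x‖⁻¹ ≤ 2 := by
            rw [inv_le_comm₀ hx0 (by norm_num)]; linarith
          simp only [conj_trivial]
          rw [abs_mul, abs_mul, abs_mul, abs_of_pos hR0, abs_of_pos (inv_pos.mpr hx0)]
          calc R * (‖x‖⁻¹ * (|inner ℝ (f j) x| * |inner ℝ (f j) (γ t - γ tc)|)) ≤
                R * (2 * (ν / R * (C₀ * κ))) := by
                gcongr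
                exact h2.trans (by gcongr)
            _ = _ := by field_simp
        · rw [hf.inner_sub_eq_zero hγ.contDiff hflat (not_lt.mp hj) ht, mul_zero, mul_zero, mul_zero,
            abs_zero]
          positivity
      · rw [Finset.sum_const, Finset.card_univ, Fintype.card_fin, nsmul_eq_mul]
        exact hν2
    have hχint : Integrable χ := hχ.integrable_of_hasCompactSupport hc
    have hcos : Integrable (fun t => χ t * Real.cos (inner ℝ (R • (‖x‖⁻¹ • x)) (γ t - γ tc))) := by
      have := hγ.contDiff.continuous
      exact Continuous.integrable_of_hasCompactSupport (by fun_prop) hc.mul_right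
    calc κ / 2 = ∫ _ in Set.Icc (tc - κ / 2) (tc + κ / 2), (1 / 2 : ℝ) := by
          rw [setIntegral_const, measureReal_def, Real.volume_Icc, ENNReal.toReal_ofReal (by linarith),
            smul_eq_mul]
          ring
      _ ≤ ∫ t in Set.Icc (tc - κ / 2) (tc + κ / 2),
            χ t * Real.cos (inner ℝ (R • (‖x‖⁻¹ • x)) (γ t - γ tc)) := by
          refine setIntegral_mono_on (by simp) hcos.integrableOn measurableSet_Icc fun t ht => ?_
          have ht' : |t - tc| ≤ κ / 2 := by rw [abs_le]; constructor <;> linarith [ht.1, ht.2]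
          have h1 := hphase t (by linarith)
          have h2 := Real.one_sub_sq_div_two_le_cos (x := inner ℝ (R • (‖x‖⁻¹ • x)) (γ t - γ tc))
          have h3 := (sq_le_one_iff_abs_le_one _).mpr h1
          rw [hχ1 t ht', one_mul]
          linarith
      _ ≤ _ := by
          refine setIntegral_le_integral hcos (Filter.Eventually.of_forall fun t => ?_)
          by_cases ht : χ t = 0
          · simp [ht]
          · have h1 := hphase t (hχs t ht)
            have h2 := Real.one_sub_sq_div_two_le_cos (x := inner ℝ (R • (‖x‖⁻¹ • x)) (γ t - γ tc))
            have h3 := (sq_le_one_iff_abs_le_one _).mpr h1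
            exact mul_nonneg (hχ0 t) (by linarith)
  have hvol : ENNReal.ofReal (ν ^ d / R ^ K) ≤ volume (box f m 0 W) := by
    have h1 : ν ^ d / R ^ K = ∏ j : Fin d, ν * (if (j : ℕ) < K then 1 / R else 1) := by
      rw [Finset.prod_mul_distrib, Finset.prod_const, Finset.card_univ, Fintype.card_fin,
        Finset.prod_ite, Finset.prod_const, Finset.prod_const_one, mul_one, Fin.card_filter_val_lt,
        min_eq_right hKd.le, div_pow, one_pow, mul_one_div]
    have hν4 : ν ≤ 1 / 4 := hν1.trans (by
      have : (1 : ℝ) ≤ d := by exact_mod_cast (by omega : 1 ≤ d)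
      gcongr
      linarith)
    rw [volume_box, h1, ENNReal.ofReal_prod_of_nonneg fun j _ => by positivity]
    refine Finset.prod_le_prod' fun j _ => ENNReal.ofReal_le_ofReal ?_
    by_cases hjm : j = m
    · have : ¬ (j : ℕ) < K := by rw [hjm, hm]; simp
      rw [if_pos hjm, if_neg this, mul_one]
      exact hν4
    · rw [if_neg hjm, Pi.zero_apply, sub_zero]
      simp only [hW]
      split_ifs
      · rw [mul_one_div]
      · rw [mul_one]; exact hν1
  constructor
  · intro q hq
    calc ENNReal.ofReal (ν ^ d / R ^ K * (κ / 2) ^ q) =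
          ENNReal.ofReal (κ / 2) ^ q * ENNReal.ofReal (ν ^ d / R ^ K) := by
          rw [ENNReal.ofReal_rpow_of_pos (by positivity), mul_comm,
            ENNReal.ofReal_mul (by positivity)]
      _ ≤ ENNReal.ofReal (κ / 2) ^ q * volume (box f m 0 W) := by gcongr
      _ = ∫⁻ _ in box f m 0 W, ENNReal.ofReal (κ / 2) ^ q := by rw [setLIntegral_const]
      _ ≤ ∫⁻ x in box f m 0 W, ENNReal.ofReal (radial γ χ R x) ^ q := by
          refine setLIntegral_mono' (measurableSet_box _ _ _ _) fun x hx => ?_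
          gcongr
          exact hpt x hx
      _ ≤ _ := lintegral_mono_set hsub
  · have hne : (box f m 0 W).Nonempty := by
      refine nonempty_of_measure_ne_zero (μ := volume) (ne_of_gt (lt_of_lt_of_le ?_ hvol))
      rw [ENNReal.ofReal_pos]
      positivity
    obtain ⟨x, hx⟩ := hne
    exact ⟨x, (hsub hx).2, hpt x hx⟩

/-! ### Decay exponents -/

theorem scaleMass_eq {k : ℕ} (hk : 1 ≤ k) {c lam δ R p : ℝ} (hlam : 0 ≤ lam) (hδ : 0 < δ)
    (hR : 0 < R) : scaleMass k c lam δ ((δ * R) ^ ((k : ℝ)⁻¹)) R p =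
      c * lam ^ p * (δ * (δ * R) ^ (((k : ℝ) - 1) / 2 + (1 - p) / k) / R ^ (k - 1)) := by
  have hk0 : (k : ℝ) ≠ 0 := by positivity
  have hX : 0 < δ * R := by positivity
  have hcast : ((k * (k - 1) / 2 + 1 : ℕ) : ℝ) = (k : ℝ) * (k - 1) / 2 + 1 := by
    rw [Nat.cast_add, Nat.cast_one, Nat.cast_div (Nat.even_mul_pred_self k).two_dvd (by norm_num),
      Nat.cast_mul, Nat.cast_sub hk]
    norm_num
  have he : ((k : ℝ) - 1) / 2 + (1 - p) / k =
      (k : ℝ)⁻¹ * ((k * (k - 1) / 2 + 1 : ℕ) : ℝ) - (k : ℝ)⁻¹ * p := by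
    rw [hcast]; field_simp; ring
  unfold scaleMass
  rw [Real.div_rpow hlam (by positivity), ← Real.rpow_mul_natCast hX.le, ← Real.rpow_mul hX.le, he,
    Real.rpow_sub hX]
  ring

/-- At the top scale `N = R^{1/k}` the exponent of `R` is `-q · decayExp k q`. -/
theorem scaleMass_one_eq {k : ℕ} (hk : 1 ≤ k) {c lam R p : ℝ} (hlam : 0 ≤ lam) (hR : 0 < R) {D : ℝ}
    (hD : D * p = p / k + ((k : ℝ) - 1) / 2 - 1 / k) :
    scaleMass k c lam 1 (R ^ ((k : ℝ)⁻¹)) R p = c * lam ^ p * R ^ (-(D * p)) := by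
  have h := scaleMass_eq hk (c := c) (p := p) hlam one_pos hR
  rw [one_mul, one_mul] at h
  rw [h, ← Real.rpow_natCast R (k - 1), ← Real.rpow_sub hR, hD, Nat.cast_sub hk]
  congr 2
  push_cast
  ring

/-- At the critical exponent all scales contribute equally. -/
theorem scaleMass_critical_eq {k : ℕ} (hk : 1 ≤ k) {c lam δ R p : ℝ} (hlam : 0 ≤ lam) (hδ : 0 < δ)
    (hR : 0 < R) (hp : p = ((k : ℝ) ^ 2 + k + 2) / 2) :
    scaleMass k c lam δ ((δ * R) ^ ((k : ℝ)⁻¹)) R p = c * lam ^ p * R ^ (-(k : ℝ)) := by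
  have hk0 : (k : ℝ) ≠ 0 := by positivity
  have he : ((k : ℝ) - 1) / 2 + (1 - p) / k = -1 := by rw [hp]; field_simp; ring
  rw [scaleMass_eq hk hlam hδ hR, he, Real.rpow_neg_one, Real.rpow_neg hR.le, Real.rpow_natCast]
  obtain ⟨n, rfl⟩ : ∃ n, k = n + 1 := ⟨k - 1, by omega⟩
  rw [Nat.add_sub_cancel, pow_succ]
  field_simp

theorem recip_eq_inv_toReal {q : ℝ≥0∞} : recip q = (q.toReal)⁻¹ := by
  rw [recip, ENNReal.toReal_inv]

theorem recip_top : recip ⊤ = 0 := by simp [recip]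

theorem toReal_qcrit (k : ℕ) : (qcrit k).toReal = ((k : ℝ) ^ 2 + k + 2) / 2 :=
  ENNReal.toReal_ofReal (by positivity)

theorem recip_qcrit (k : ℕ) : recip (qcrit k) = 2 / ((k : ℝ) ^ 2 + k + 2) := by
  rw [recip_eq_inv_toReal, toReal_qcrit, inv_div]

theorem decayExp_mul_toReal {k : ℕ} (hk : 1 ≤ k) {q : ℝ≥0∞} (hq : 0 < q.toReal) :
    decayExp k q * q.toReal = q.toReal / k + ((k : ℝ) - 1) / 2 - 1 / k := by
  have hk0 : (k : ℝ) ≠ 0 := by positivity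
  rw [decayExp, recip_eq_inv_toReal]
  field_simp
  ring

theorem decayExp_qcrit_mul {k : ℕ} (hk : 1 ≤ k) :
    decayExp k (qcrit k) * (qcrit k).toReal = k := by
  have hk0 : (k : ℝ) ≠ 0 := by positivity
  rw [decayExp_mul_toReal hk (by rw [toReal_qcrit]; positivity), toReal_qcrit]
  field_simp
  ring

/-- Among the lines `1/q ↦ decayExp j q` those with indices `k` and `k + 1` meet at `q_k`, and all the
others lie above them there. -/
theorem decayExp_qcrit_le {k j : ℕ} (hk : 1 ≤ k) (hj : 1 ≤ j) :
    decayExp k (qcrit k) ≤ decayExp j (qcrit k) := by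
  have hk0 : (0 : ℝ) < k := by positivity
  have hj0 : (0 : ℝ) < j := by positivity
  have h : decayExp j (qcrit k) - decayExp k (qcrit k) =
      ((j : ℝ) - k) * (j - k - 1) / (j * ((k : ℝ) ^ 2 + k + 2)) := by
    rw [decayExp, decayExp, recip_qcrit]
    field_simp
    ring
  have hint : (0 : ℤ) ≤ ((j : ℤ) - k) * (j - k - 1) := by
    rcases le_or_gt ((j : ℤ) - k) 0 with h0 | h0
    · exact mul_nonneg_of_nonpos_of_nonpos h0 (by linarith)
    · exact mul_nonneg h0.le (by linarith [Int.add_one_le_of_lt h0])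
  have hnum : (0 : ℝ) ≤ ((j : ℝ) - k) * (j - k - 1) := by exact_mod_cast hint
  have : 0 ≤ decayExp j (qcrit k) - decayExp k (qcrit k) := by rw [h]; positivity
  linarith

theorem decayExp_qcrit_le_mul_recip {k K : ℕ} (hk : 1 ≤ k) (hkK : k ≤ K) :
    decayExp k (qcrit k) ≤ K * recip (qcrit k) := by
  have hk0 : (k : ℝ) ≠ 0 := by positivity
  have h : decayExp k (qcrit k) = k * recip (qcrit k) := by
    rw [decayExp, recip_qcrit]
    field_simp
    ring
  rw [h]
  have : 0 ≤ recip (qcrit k) := ENNReal.toReal_nonneg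
  gcongr

/-- For `q < q_K` the term `K/q` in `σ_K` is not the minimum. -/
theorem decayExp_le_mul_recip {K : ℕ} (hK : 1 ≤ K) {q : ℝ≥0∞} (hq0 : 0 < q) (hq : q < qcrit K) :
    decayExp K q ≤ K * recip q := by
  have hq' : 0 < q.toReal := ENNReal.toReal_pos hq0.ne' hq.ne_top
  have h1 : q.toReal < ((K : ℝ) ^ 2 + K + 2) / 2 := by
    rw [← toReal_qcrit]
    exact (ENNReal.toReal_lt_toReal hq.ne_top ENNReal.ofReal_ne_top).mpr hq
  have hK0 : (0 : ℝ) < K := by positivity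
  refine le_of_mul_le_mul_right ?_ hq'
  rw [decayExp_mul_toReal hK hq', recip_eq_inv_toReal, mul_assoc, inv_mul_cancel₀ hq'.ne', mul_one]
  have h2 : q.toReal / K ≤ ((K : ℝ) ^ 2 + K + 2) / 2 / K := by gcongr
  have h3 : ((K : ℝ) ^ 2 + K + 2) / 2 / K + (K - 1) / 2 - 1 / K = K := by
    field_simp
    ring
  linarith

theorem min_one_rpow_le {c p : ℝ} (hc : 0 < c) (hp : 1 ≤ p) : min 1 c ^ p ≤ c := by
  have h0 : 0 < min 1 c := by positivity
  calc min 1 c ^ p ≤ min 1 c ^ (1 : ℝ) :=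
        Real.rpow_le_rpow_of_exponent_ge h0 (min_le_left _ _) hp
    _ = min 1 c := Real.rpow_one _
    _ ≤ c := min_le_right _ _

/-- The passage from a lower bound for `∫ |μ̂|^q` to one for `G_q`, with a constant that does not
depend on `q`. -/
theorem le_G_of_lintegral {d : ℕ} (hd : 1 ≤ d) {γ : ℝ → EuclideanSpace ℝ (Fin d)}
    (hγ : Continuous γ) {χ : ℝ → ℝ} (hχ : Continuous χ) (hc : HasCompactSupport χ)
    {q : ℝ≥0∞} (hq1 : 1 ≤ q) (hq : q ≠ ⊤) {R c lam D ℓ : ℝ} (hR : 0 < R) (hc0 : 0 < c)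
    (hlam : 0 < lam) (hℓ : 0 ≤ ℓ)
    (h : ENNReal.ofReal (c * ℓ * lam ^ q.toReal * R ^ (-(D * q.toReal))) ≤
      ∫⁻ x in Metric.ball (0 : EuclideanSpace ℝ (Fin d)) 1 \ {0},
        ENNReal.ofReal (radial γ χ R x) ^ q.toReal) :
    min 1 c * lam * R ^ (-D) * ℓ ^ recip q ≤ G γ χ q R := by
  have hq0 : q ≠ 0 := (lt_of_lt_of_le one_pos hq1).ne'
  have hp : 1 ≤ q.toReal := by
    rw [← ENNReal.toReal_one]
    exact (ENNReal.toReal_le_toReal ENNReal.one_ne_top hq).mpr hq1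
  refine le_G_of_le_lintegral hd hγ hχ hc R hq0 hq (by positivity) (le_trans ?_ h)
  refine ENNReal.ofReal_le_ofReal ?_
  rw [Real.mul_rpow (by positivity) (by positivity), Real.mul_rpow (by positivity) (by positivity),
    Real.mul_rpow (by positivity) (by positivity), ← Real.rpow_mul hR.le, ← Real.rpow_mul hℓ,
    recip_eq_inv_toReal, inv_mul_cancel₀ (by linarith), Real.rpow_one, neg_mul]
  calc min 1 c ^ q.toReal * lam ^ q.toReal * R ^ (-(D * q.toReal)) * ℓ ≤
        c * lam ^ q.toReal * R ^ (-(D * q.toReal)) * ℓ := by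
        gcongr
        exact min_one_rpow_le hc0 hp
    _ = _ := by ring

/-! ### Lower bounds for `G_q(R)` -/

/-- Lower bounds for `G_q(R)` at a given `R`: one for each single `k`, with a logarithm at `q_k`, and
one that does not involve any oscillation, for a curve whose derivative of order `K + 1` vanishes
(the proposition `flat`). As `σ_K` is a minimum, no comparison between different `k` is needed. -/
structure HasLowerBounds {d : ℕ} (γ : ℝ → EuclideanSpace ℝ (Fin d)) (χ : ℝ → ℝ) (K : ℕ) (flat : Prop)
    (c R : ℝ) : Prop where
  rpow_decayExp_le : ∀ k, 2 ≤ k → k ≤ K → ∀ q : ℝ≥0∞, 1 ≤ q → c * R ^ (-decayExp k q) ≤ G γ χ q R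
  rpow_decayExp_mul_log_le : ∀ k, 2 ≤ k → k ≤ K → k < d → (k + 1 ≤ K ∨ flat) →
    c * R ^ (-decayExp k (qcrit k)) * Real.log R ^ recip (qcrit k) ≤ G γ χ (qcrit k) R
  rpow_mul_recip_le : K < d → flat → ∀ q : ℝ≥0∞, 1 ≤ q → c * R ^ (-(K * recip q)) ≤ G γ χ q R

theorem one_le_qcrit (k : ℕ) : 1 ≤ qcrit k := by
  rw [qcrit, ENNReal.one_le_ofReal]
  have : (0 : ℝ) ≤ (k : ℝ) ^ 2 + k := by positivity
  linarith

/-- The bound for a single `k`, from the scale `N = R^{1/k}`. -/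
theorem top_scale_bound {d K : ℕ} (hKd : K ≤ d)
    {γ : ℝ → EuclideanSpace ℝ (Fin d)} (hγ : Continuous γ) {χ : ℝ → ℝ} (hχ : Continuous χ)
    (hc : HasCompactSupport χ) {c lam N₀ : ℝ} (hc0 : 0 < c) (hlam : 0 < lam) (hN₀ : 1 ≤ N₀)
    (h : ∀ (k : ℕ) (R : ℝ), 2 ≤ k → k ≤ K → 0 < R → ∀ N : ℝ, N₀ ≤ N → N ^ k = R →
        (∀ q : ℝ, 1 ≤ q → ENNReal.ofReal (scaleMass k c lam 1 N R q) ≤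
          ∫⁻ x in Metric.ball (0 : EuclideanSpace ℝ (Fin d)) 1 \ {0},
            ENNReal.ofReal (radial γ χ R x) ^ q) ∧
        ∃ x, x ≠ 0 ∧ lam / N ≤ radial γ χ R x)
    {k : ℕ} (hk : 2 ≤ k) (hkK : k ≤ K) {R : ℝ} (hR : N₀ ^ d ≤ R) {q : ℝ≥0∞} (hq : 1 ≤ q) :
    min 1 c * lam * R ^ (-decayExp k q) ≤ G γ χ q R := by
  have hk0 : (k : ℝ) ≠ 0 := by positivity
  have hR1 : 1 ≤ R := (one_le_pow₀ hN₀).trans hR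
  have hR0 : 0 < R := by linarith
  have hNk : (R ^ ((k : ℝ)⁻¹)) ^ k = R := Real.rpow_inv_natCast_pow hR0.le (by omega)
  have hN : N₀ ≤ R ^ ((k : ℝ)⁻¹) := by
    refine le_of_pow_le_pow_left₀ (show k ≠ 0 by omega) (by positivity) ?_
    rw [hNk]
    exact (pow_le_pow_right₀ hN₀ (hkK.trans hKd)).trans hR
  obtain ⟨h1, x, hx, h2⟩ := h k R hk hkK hR0 _ hN hNk
  by_cases hqt : q = ⊤
  · subst hqt
    refine le_trans ?_ (h2.trans (radial_le_G_top hγ hχ hc R hx))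
    rw [decayExp, recip_top, mul_zero, add_zero, one_div, Real.rpow_neg hR0.le, ← div_eq_mul_inv]
    gcongr
    exact mul_le_of_le_one_left hlam.le (min_le_left _ _)
  · have hp : 1 ≤ q.toReal := by
      rw [← ENNReal.toReal_one]
      exact (ENNReal.toReal_le_toReal ENNReal.one_ne_top hqt).mpr hq
    have h3 := h1 q.toReal hp
    rw [scaleMass_one_eq (by omega) hlam.le hR0
      (decayExp_mul_toReal (q := q) (by omega) (by linarith))] at h3
    have h4 := le_G_of_lintegral (ℓ := 1) (by omega) hγ hχ hc hq hqt hR0 hc0 hlam zero_le_one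
      (by rw [mul_one]; exact h3)
    rwa [Real.one_rpow, mul_one] at h4

/-- At `q_k` all the scales `δ = a^{l+1} ≥ R^{-1/(2d+2)}` contribute the same amount, and there are
about `log R` of them. -/
theorem critical_bound {d K : ℕ} (hKd : K ≤ d)
    {γ : ℝ → EuclideanSpace ℝ (Fin d)} (hγ : Continuous γ) {χ : ℝ → ℝ} (hχ : Continuous χ)
    (hc : HasCompactSupport χ) {c lam N₀ a : ℝ} (hc0 : 0 < c) (hlam : 0 < lam) (hN₀ : 1 ≤ N₀)
    (ha0 : 0 < a) (ha1 : a < 1) {k : ℕ} (hk : 2 ≤ k) (hkK : k ≤ K) {R : ℝ} (hR : N₀ ^ (2 * d) ≤ R)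
    (hRa : (2 * d + 2) * Real.log a⁻¹ ≤ Real.log R)
    (h : ∀ (s : Finset ℕ) (N : ℕ → ℝ), (∀ l ∈ s, N₀ ≤ a ^ (l + 1) * N l ∧ N l ^ k = a ^ (l + 1) * R) →
        ∀ q : ℝ, 1 ≤ q → ENNReal.ofReal (∑ l ∈ s, scaleMass k c lam (a ^ (l + 1)) (N l) R q) ≤
          ∫⁻ x in Metric.ball (0 : EuclideanSpace ℝ (Fin d)) 1 \ {0},
            ENNReal.ofReal (radial γ χ R x) ^ q) :
    min 1 (c / (2 * ((2 * d + 2) * Real.log a⁻¹))) * lam * R ^ (-decayExp k (qcrit k)) *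
      Real.log R ^ recip (qcrit k) ≤ G γ χ (qcrit k) R := by
  have hR1 : 1 ≤ R := (one_le_pow₀ hN₀).trans hR
  have hR0 : 0 < R := by linarith
  have hla : 0 < Real.log a⁻¹ := Real.log_pos ((one_lt_inv₀ ha0).mpr ha1)
  set A : ℝ := (2 * d + 2) * Real.log a⁻¹ with hA
  have hA0 : 0 < A := by positivity
  have hlog : 0 < Real.log R := hA0.trans_le hRa
  set L : ℕ := ⌊Real.log R / A⌋₊ with hL
  have hL1 : Real.log R / (2 * A) ≤ L := by
    have h1 : 1 ≤ Real.log R / A := by rw [le_div_iff₀ hA0, one_mul]; exact hRa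
    have h2 : (1 : ℝ) ≤ L := by exact_mod_cast Nat.le_floor (by simpa using h1)
    have h3 : Real.log R / A < L + 1 := Nat.lt_floor_add_one _
    have h4 : Real.log R / (2 * A) = Real.log R / A / 2 := by rw [mul_comm 2 A, div_div]
    linarith
  -- `a^{(2d+2)(l+1)} ≥ R⁻¹` for the scales used.
  have hscale : ∀ l ∈ Finset.range L, 1 ≤ (a ^ (l + 1)) ^ (2 * d + 2) * R := by
    intro l hl
    rw [Finset.mem_range] at hl
    have h1 : ((l : ℝ) + 1) ≤ L := by exact_mod_cast hl
    have h2 : (L : ℝ) ≤ Real.log R / A := Nat.floor_le (by positivity)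
    have h3 : ((l : ℝ) + 1) * A ≤ Real.log R := by
      rw [← le_div_iff₀ hA0]; linarith
    rw [← Real.log_nonneg_iff (by positivity), Real.log_mul (by positivity) hR0.ne', Real.log_pow,
      Real.log_pow]
    rw [hA, Real.log_inv] at h3
    push_cast
    linarith
  set N : ℕ → ℝ := fun l => (a ^ (l + 1) * R) ^ ((k : ℝ)⁻¹) with hN
  have hNk : ∀ l, N l ^ k = a ^ (l + 1) * R := fun l =>
    Real.rpow_inv_natCast_pow (by positivity) (by omega)
  have hN0 : ∀ l, 0 < N l := fun l => by simp only [hN]; positivity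
  have hNs : ∀ l ∈ Finset.range L, N₀ ≤ a ^ (l + 1) * N l ∧ N l ^ k = a ^ (l + 1) * R := by
    intro l hl
    refine ⟨?_, hNk l⟩
    have e0 : 0 < a ^ (l + 1) := by positivity
    have e1 : a ^ (l + 1) ≤ 1 := pow_le_one₀ ha0.le ha1.le
    have h0 : 0 < N l := hN0 l
    refine le_of_pow_le_pow_left₀ (show k * 2 ≠ 0 by omega) (by positivity) ?_
    calc N₀ ^ (k * 2) ≤ N₀ ^ (2 * d) := pow_le_pow_right₀ hN₀ (by omega)
      _ ≤ R := hR
      _ ≤ ((a ^ (l + 1)) ^ (2 * d + 2) * R) * R := le_mul_of_one_le_left hR0.le (hscale l hl)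
      _ ≤ ((a ^ (l + 1)) ^ (2 * k + 2) * R) * R := by
          have : (a ^ (l + 1)) ^ (2 * d + 2) ≤ (a ^ (l + 1)) ^ (2 * k + 2) :=
            pow_le_pow_of_le_one e0.le e1 (by omega)
          gcongr
      _ = (a ^ (l + 1)) ^ (k * 2) * (N l ^ k) ^ 2 := by rw [hNk]; ring
      _ = _ := by rw [mul_pow, pow_mul (N l)]
  have hp : 1 ≤ (qcrit k).toReal := by
    rw [toReal_qcrit]
    have : (0 : ℝ) ≤ (k : ℝ) ^ 2 + k := by positivity
    linarith
  refine le_G_of_lintegral (by omega) hγ hχ hc (one_le_qcrit k) ENNReal.ofReal_ne_top hR0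
    (by positivity) hlam hlog.le (le_trans ?_ (h (Finset.range L) N hNs _ hp))
  refine ENNReal.ofReal_le_ofReal ?_
  have hsum : ∑ l ∈ Finset.range L, scaleMass k c lam (a ^ (l + 1)) (N l) R (qcrit k).toReal =
      L * (c * lam ^ (qcrit k).toReal * R ^ (-(k : ℝ))) := by
    rw [Finset.sum_congr rfl fun l _ => scaleMass_critical_eq (k := k) (by omega) hlam.le
      (by positivity) hR0 (toReal_qcrit k), Finset.sum_const, Finset.card_range, nsmul_eq_mul]
  rw [hsum, decayExp_qcrit_mul (by omega)]
  calc c / (2 * A) * Real.log R * lam ^ (qcrit k).toReal * R ^ (-(k : ℝ)) =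
        Real.log R / (2 * A) * (c * lam ^ (qcrit k).toReal * R ^ (-(k : ℝ))) := by ring
    _ ≤ _ := by gcongr

/-- The cutoff is a smooth bump around the centre of nondegeneracy; the constants do not depend on
`k` or `q`. -/
theorem exists_hasLowerBounds {d K : ℕ} (hK : 2 ≤ K) (hKd : K ≤ d) {γ : ℝ → EuclideanSpace ℝ (Fin d)}
    {c₀ C₀ tc κ₀ : ℝ} (hc₀ : 0 < c₀) (hC₀ : 0 < C₀) (hκ₀ : 0 < κ₀)
    (hγ : IsNondegenerate γ K c₀ C₀ tc κ₀) :
    ∃ χ : ℝ → ℝ, ContDiff ℝ ∞ χ ∧ HasCompactSupport χ ∧ tsupport χ ⊆ Metric.closedBall tc κ₀ ∧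
      ∃ c : ℝ, 0 < c ∧ ∃ R₀ : ℝ, 1 ≤ R₀ ∧ ∀ R : ℝ, R₀ < R →
        HasLowerBounds γ χ K (∀ t, |t - tc| ≤ κ₀ → iteratedDeriv (K + 1) γ t = 0) c R := by
  obtain ⟨κ, hκ, hκκ, c, hc, lam, hlam, N₀, hN₀, a, ha0, ha1, key⟩ :=
    exists_lintegral_lower_bound d K hK hKd hc₀ hC₀ hκ₀
  let χ : ContDiffBump tc := ⟨κ / 2, κ, by positivity, by linarith⟩
  have hχ1 : ∀ t, |t - tc| ≤ κ / 2 → χ t = 1 := fun t ht =>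
    χ.one_of_mem_closedBall (by rw [Metric.mem_closedBall, Real.dist_eq]; exact ht)
  have hχs : ∀ t, χ t ≠ 0 → |t - tc| ≤ κ := by
    intro t ht
    have : t ∈ Function.support χ := ht
    rw [χ.support_eq, Metric.mem_ball, Real.dist_eq] at this
    exact le_of_lt this
  have key' := key tc γ χ hγ χ.continuous χ.hasCompactSupport (fun t => χ.nonneg)
    (fun t => χ.le_one) hχ1 hχs
  refine ⟨χ, χ.contDiff, χ.hasCompactSupport, ?_, ?_⟩
  · rw [χ.tsupport_eq]
    exact Metric.closedBall_subset_closedBall (show κ ≤ κ₀ by linarith)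
  have hγc := hγ.contDiff.continuous
  have hla : 0 < Real.log a⁻¹ := Real.log_pos ((one_lt_inv₀ ha0).mpr ha1)
  have hflat : ∃ c' : ℝ, 0 < c' ∧ ∀ R : ℝ, 1 ≤ R → K < d →
      (∀ t, |t - tc| ≤ κ₀ → iteratedDeriv (K + 1) γ t = 0) → ∀ q : ℝ≥0∞, 1 ≤ q →
      c' * R ^ (-(K * recip q)) ≤ G γ χ q R := by
    by_cases hf : K < d ∧ ∀ t, |t - tc| ≤ κ₀ → iteratedDeriv (K + 1) γ t = 0
    · obtain ⟨hlt, hf⟩ := hf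
      obtain ⟨lam', hlam', c', hc', hb⟩ := exists_lower_bound_of_flat hlt hC₀ hκ (by linarith) hγ
        χ.continuous χ.hasCompactSupport (fun t => χ.nonneg) hχ1 hχs
        (fun t ht => hf t (by linarith))
      refine ⟨min 1 c' * lam', by positivity, fun R hR _ _ q hq => ?_⟩
      have hR0 : 0 < R := by linarith
      obtain ⟨h1, x, hx, h2⟩ := hb R hR
      by_cases hqt : q = ⊤
      · subst hqt
        refine le_trans ?_ (h2.trans (radial_le_G_top hγc χ.continuous χ.hasCompactSupport R hx))
        rw [recip_top, mul_zero, neg_zero, Real.rpow_zero, mul_one]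
        exact mul_le_of_le_one_left hlam'.le (min_le_left _ _)
      · have hp : 1 ≤ q.toReal := by
          rw [← ENNReal.toReal_one]
          exact (ENNReal.toReal_le_toReal ENNReal.one_ne_top hqt).mpr hq
        have h4 := le_G_of_lintegral (ℓ := 1) (D := K * recip q) (by omega) hγc χ.continuous
          χ.hasCompactSupport hq hqt hR0 hc' hlam' zero_le_one (by
            have h3 := h1 q.toReal hp
            rw [mul_one, recip_eq_inv_toReal, mul_assoc (K : ℝ), inv_mul_cancel₀ (by linarith),
              mul_one, Real.rpow_neg hR0.le, Real.rpow_natCast]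
            convert h3 using 2
            ring)
        rwa [Real.one_rpow, mul_one] at h4
    · exact ⟨1, one_pos, fun R _ h1 h2 => absurd ⟨h1, h2⟩ hf⟩
  obtain ⟨c', hc', hflat⟩ := hflat
  set A : ℝ := (2 * d + 2) * Real.log a⁻¹ with hA
  have hA0 : 0 < A := by positivity
  set c₁ : ℝ := min 1 c * lam
  set c₂ : ℝ := min 1 (c / (2 * A)) * lam
  have hc₁ : 0 < c₁ := by positivity
  have hc₂ : 0 < c₂ := by positivity
  refine ⟨min (min c₁ c₂) c', by positivity, max (N₀ ^ (2 * d)) (Real.exp A),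
    (one_le_pow₀ hN₀).trans (le_max_left _ _), fun R hR => ?_⟩
  have hRN : N₀ ^ (2 * d) ≤ R := (le_max_left _ _).trans hR.le
  have hRA : Real.exp A ≤ R := (le_max_right _ _).trans hR.le
  have hR1 : 1 ≤ R := (one_le_pow₀ hN₀).trans hRN
  have hR0 : 0 < R := by linarith
  have hlog : 0 ≤ Real.log R := Real.log_nonneg hR1
  refine ⟨fun k hk hkK q hq => ?_, fun k hk hkK hkd hor => ?_, fun hlt hf q hq => ?_⟩
  · refine le_trans ?_ (top_scale_bound hKd hγc χ.continuous χ.hasCompactSupport hc hlam hN₀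
      (fun k R hk hkK hR => (key' k R hk hkK hR).1) hk hkK
      ((pow_le_pow_right₀ hN₀ (by omega)).trans hRN) hq)
    gcongr
    exact (min_le_left _ _).trans (min_le_left _ _)
  · refine le_trans ?_ (critical_bound hKd hγc χ.continuous χ.hasCompactSupport hc hlam hN₀
      ha0 ha1 hk hkK hRN ?_ ((key' k R hk hkK hR0).2 hkd ?_))
    · gcongr
      exact (min_le_left _ _).trans (min_le_right _ _)
    · exact (Real.le_log_iff_exp_le hR0).mpr hRA
    · rcases hor with h | h
      · exact Or.inl h
      · rcases hkK.lt_or_eq with h' | rfl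
        · exact Or.inl h'
        · exact Or.inr fun t ht => h t (by linarith)
  · refine le_trans ?_ (hflat R hR1 hlt hf q hq)
    gcongr
    exact min_le_right _ _

/-- `G_q` only sees the curve on the support of the cutoff. -/
theorem G_congr {d : ℕ} {γ g : ℝ → EuclideanSpace ℝ (Fin d)} {χ : ℝ → ℝ}
    (h : ∀ t, χ t ≠ 0 → g t = γ t) : G g χ = G γ χ := by
  have hmu : muHat g χ = muHat γ χ := by
    funext ξ
    unfold muHat
    congr 1
    funext t
    by_cases ht : χ t = 0
    · rw [ht, Complex.ofReal_zero, mul_zero, mul_zero]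
    · rw [h t ht]
  funext q R
  rw [G, G, hmu]

theorem mul_rpow_neg_inf'_le {s : Finset ℕ} (hs : s.Nonempty) {f : ℕ → ℝ} {c R B : ℝ}
    (h : ∀ k ∈ s, c * R ^ (-f k) ≤ B) : c * R ^ (-s.inf' hs f) ≤ B := by
  obtain ⟨k, hk, he⟩ := s.exists_mem_eq_inf' hs f
  rw [he]
  exact h k hk

end CurveDecay

end

theorem theorem3 (d K : ℕ) (hK : 2 ≤ K) (hKd : K ≤ d) (a b : ℝ) (hab : a < b)
    (γ : ℝ → EuclideanSpace ℝ (Fin d)) (hγ : ContDiffOn ℝ ∞ γ (Set.Icc a b))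
    (t₀ : ℝ) (ht₀ : t₀ ∈ Set.Icc a b)
    (hind : LinearIndependent ℝ
      (fun j : Fin K => iteratedDerivWithin ((j : ℕ) + 1) γ (Set.Icc a b) t₀)) :
    ∃ χ : ℝ → ℝ, ContDiff ℝ ∞ χ ∧ HasCompactSupport χ ∧ tsupport χ ⊆ Set.Ioo a b ∧
      ∃ c : ℝ, 0 < c ∧ ∃ R₀ : ℝ, 1 ≤ R₀ ∧ ∀ R : ℝ, R₀ < R →
        (K < d →
          (∀ q : ℝ≥0∞, 2 < q → q < CurveDecay.qcrit K →
            c * R ^ (-CurveDecay.sigma d K hK q) ≤ CurveDecay.G γ χ q R) ∧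
          (∀ k : ℕ, 2 ≤ k → k ≤ K - 1 → ∀ q : ℝ≥0∞, q = CurveDecay.qcrit k →
            c * R ^ (-CurveDecay.sigma d K hK q) * Real.log R ^ CurveDecay.recip q
              ≤ CurveDecay.G γ χ q R)) ∧
        (K = d →
          (∀ q : ℝ≥0∞, 2 < q →
            c * R ^ (-CurveDecay.sigma d K hK q) ≤ CurveDecay.G γ χ q R) ∧
          (∀ k : ℕ, 2 ≤ k → k ≤ d - 1 → ∀ q : ℝ≥0∞, q = CurveDecay.qcrit k →
            c * R ^ (-CurveDecay.sigma d K hK q) * Real.log R ^ CurveDecay.recip q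
              ≤ CurveDecay.G γ χ q R)) ∧
        (K < d → (∀ t ∈ Set.Icc a b, iteratedDerivWithin (K + 1) γ (Set.Icc a b) t = 0) →
          (∀ q : ℝ≥0∞, 2 < q →
            c * R ^ (-CurveDecay.sigma d K hK q) ≤ CurveDecay.G γ χ q R) ∧
          (∀ k : ℕ, 2 ≤ k → k ≤ K → ∀ q : ℝ≥0∞, q = CurveDecay.qcrit k →
            c * R ^ (-CurveDecay.sigma d K hK q) * Real.log R ^ CurveDecay.recip q
              ≤ CurveDecay.G γ χ q R)) := by
  open CurveDecay in
  obtain ⟨tc, κ₀, c₀, C₀, hκ₀, hc₀, hC₀, g, hg, hgγ⟩ := exists_isNondegenerate hKd hab hγ ht₀ hind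
  obtain ⟨χ, hχ, hχc, hχs, c, hc, R₀, hR₀, key⟩ := exists_hasLowerBounds hK hKd hc₀ hC₀ hκ₀ hg
  have hball : ∀ t ∈ tsupport χ, |t - tc| ≤ κ₀ := fun t ht => by
    have := hχs ht
    rwa [Metric.mem_closedBall, Real.dist_eq] at this
  have hG : G g χ = G γ χ :=
    G_congr fun t ht => (hgγ t (hball t (subset_tsupport χ ht))).2.1
  have hflat : (∀ t ∈ Set.Icc a b, iteratedDerivWithin (K + 1) γ (Set.Icc a b) t = 0) →
      ∀ t, |t - tc| ≤ κ₀ → iteratedDeriv (K + 1) g t = 0 := by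
    intro h t ht
    obtain ⟨h1, -, h2⟩ := hgγ t ht
    rw [h2]
    exact h t (Ioo_subset_Icc_self h1)
  refine ⟨χ, hχ, hχc, fun t ht => (hgγ t (hball t ht)).1, c, hc, R₀, hR₀, fun R hR => ?_⟩
  obtain ⟨hpow, hlogb, hrec⟩ := key R hR
  rw [hG] at hpow hlogb hrec
  have hR1 : 1 ≤ R := hR₀.trans hR.le
  have hmin : ∀ q : ℝ≥0∞, 2 < q → c * R ^ (-(Finset.Icc 2 K).inf' (Finset.nonempty_Icc.mpr hK)
      (fun k => decayExp k q)) ≤ G γ χ q R := fun q hq =>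
    mul_rpow_neg_inf'_le _ fun k hk =>
      hpow k (Finset.mem_Icc.mp hk).1 (Finset.mem_Icc.mp hk).2 q (one_le_two.trans hq.le)
  -- At `q_k` the minimum defining `σ_K` is attained by the index `k`.
  have hsig : ∀ k, 2 ≤ k → k ≤ K → decayExp k (qcrit k) ≤ sigma d K hK (qcrit k) := by
    intro k hk hkK
    have h1 : decayExp k (qcrit k) ≤ (Finset.Icc 2 K).inf' (Finset.nonempty_Icc.mpr hK)
        (fun j => decayExp j (qcrit k)) := by
      refine Finset.le_inf' _ _ fun j hj => decayExp_qcrit_le (by omega) ?_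
      have := (Finset.mem_Icc.mp hj).1
      omega
    rw [sigma]
    split_ifs
    · exact h1
    · exact le_min h1 (decayExp_qcrit_le_mul_recip (by omega) hkK)
  have hlogσ : ∀ k, 2 ≤ k → k ≤ K → k < d →
      (k + 1 ≤ K ∨ ∀ t, |t - tc| ≤ κ₀ → iteratedDeriv (K + 1) g t = 0) → ∀ q, q = qcrit k →
      c * R ^ (-sigma d K hK q) * Real.log R ^ recip q ≤ G γ χ q R := by
    rintro k hk hkK hkd hor q rfl
    refine le_trans ?_ (hlogb k hk hkK hkd hor)
    have hlog : 0 ≤ Real.log R := Real.log_nonneg hR1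
    have := hsig k hk hkK
    gcongr
  refine ⟨fun hlt => ⟨fun q hq hqK => ?_, fun k hk hkK => hlogσ k hk (by omega) (by omega)
      (Or.inl (by omega))⟩, fun heq => ⟨fun q hq => ?_, fun k hk hkK => hlogσ k hk (by omega)
      (by omega) (Or.inl (by omega))⟩, fun hlt hf => ⟨fun q hq => ?_, fun k hk hkK =>
      hlogσ k hk hkK (by omega) (Or.inr (hflat hf))⟩⟩
  · -- For `q < q_K` the term `K/q` does not lower the minimum.
    rw [sigma, if_neg hlt.ne, min_eq_left]
    · exact hmin q hq
    · exact (Finset.inf'_le _ (Finset.mem_Icc.mpr ⟨hK, le_rfl⟩)).trans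
        (decayExp_le_mul_recip (by omega) (zero_lt_two.trans hq) hqK)
  · rw [sigma, if_pos heq]
    exact hmin q hq
  · rw [sigma, if_neg hlt.ne]
    rcases min_choice ((Finset.Icc 2 K).inf' (Finset.nonempty_Icc.mpr hK) fun k => decayExp k q)
      (K * recip q) with h | h <;> rw [h]
    · exact hmin q hq
    · exact hrec hlt (hflat hf) q (one_le_two.trans hq.le)
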